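/- **Model.** Let $K\ge 1$, $[K]=\{1,\dots,K\}$. For each treatment $x\in[K]$ let $f_x,g_x$ be probability densities with respect to a $\sigma$-finite measure $\mu$ on a Polish space $\mathbb Y$. For each $\alpha\in(0,1)$ let $\pi_t(\cdot\,;\alpha):[K]^t\to[0,1]$, $t\ge 0$, be transition functions ($\pi_0(\alpha)$ is a number). On a probability space with independent random variables $U_t,V_t$ ($t\ge0$), uniform on $(0,1)$, and with measurable $h$ such that $h(x,0,V)\sim f_x$, $h(x,1,V)\sim g_x$ for $V$ uniform on $(0,1)$, a treatment process $\mathcal X=\{X_t,\,t\ge1\}$ with values in $[K]$ induces the latent state $L_0=1\{U_0\le\pi_0\}$, $L_t=1\{L_{t-1}=1\text{ or }U_t\le\Pi_t\}$, $\Pi_t=\pi_t(X_1,\dots,X_t;\alpha)$, the change-point $\Theta_{\mathcal X}=\inf\{t\ge0:L_t=1\}$ (with $\inf\emptyset=\infty$, here and below), the responses $Y_t=h(X_t,L_t,V_t)$, $t\ge 1$, the $\sigma$-algebras $\mathcal F_t=\sigma(Y_1,\dots,Y_t)$, and the posterior odds $\Gamma_t=\mathsf P(L_t=1\mid\mathcal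 F_t)/\mathsf P(L_t=0\mid\mathcal F_t)$. The class $\mathcal C_\alpha$ consists of the pairs $(T,\mathcal X)$ such that $X_t$ is $\mathcal F_{t-1}$-measurable for $t\ge1$, $T$ is an $\{\mathcal F_t\}$-stopping time, $\mathsf P(T<\Theta_{\mathcal X})\le\alpha$ and $\mathsf P(T<\infty,\Theta_{\mathcal X}<\infty)=1$. **Notation.** $I_x=\int\log(g_x/f_x)\,g_x\,d\mu$, $J_x=\int\log(f_x/g_x)\,f_x\,d\mu$; given numbers $p_x(\alpha)\in[0,1]$, $\mathsf D_x(\alpha)=I_x+|\log(1-p_x(\alpha))|$; $\lambda_x(\alpha)=\mathsf E[\Theta_{(x)}]$, where $(x)$ always assigns $x$; $\zeta_x(\alpha)=\inf_{t\ge0}\inf_{z\in[K]^t}\pi_{t+1}(z,x;\alpha)$; $\pi^*_t(\alpha)=\max_{z\in[K]^t}\pi_t(z;\alpha)$; $\lambda_*(\alpha)$ is the expected change-point when the transition probability at each time $t\ge 0$ is $\pi^*_t(\alpha)$. The treatments are labelled so that, for every $\alpha\in(0,1)$, $\lambda_1(\alpha)=\min_x\lambda_x(\alpha)$ and $\mathsf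 D_K(\alpha)=\max_x\mathsf D_x(\alpha)$. **Mastery-learning procedure** with thresholds $b_1,b_K,d$. The assignment rule $\widetilde{\mathcal X}$ and the times $0=S_0<S_1<\cdots$ are defined jointly, with $\Gamma$ and $Y$ those induced by $\widetilde{\mathcal X}$: let $\sigma(t;b)=\inf\{s\ge1:\Gamma_{t+s}\ge b\}$ and $\tau(t;d)=\inf\{s\ge1:\prod_{j=1}^s f_K(Y_{t+j})/g_K(Y_{t+j})\ge d\}$; for $m\ge1$, $S_{2m-1}=S_{2m-2}+\sigma(S_{2m-2};b_1)$ and treatment $1$ is assigned on $(S_{2m-2},S_{2m-1}]$; $S_{2m}=S_{2m-1}+\min\{\sigma(S_{2m-1};b_K),\tau(S_{2m-1};d)\}$ and treatment $K$ is assigned on $(S_{2m-1},S_{2m}]$. Finally $N=\inf\{m\ge1:\sigma(S_{2m-1};b_K)\le\tau(S_{2m-1};d)\}$ and $\widetilde T=S_{2N}$. **Theorem 2.** Assume: * (A-0) for every $x$, $\int(\log\frac{g_x}{f_x})^2g_x\,d\mu<\infty$, $\int(\log\frac{f_x}{g_x})^2f_x\,d\mu<\infty$, $I_x>0$ and $J_x>0$;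 * (A-1'') for every $x$, $\sup_{\alpha\in(0,1)}\sup_{z\in[K]^{t-1}}|\pi_t(z,x;\alpha)-p_x(\alpha)|\to0$ as $t\to\infty$; * (A-2) $|\log\zeta_1(\alpha)|=o(|\log\alpha|)$ as $\alpha\to0$ (in particular $\zeta_1(\alpha)>0$ for small $\alpha$); * (A-3) there is $\delta\in(0,1)$ with $\pi^*_t(\alpha)\le1-\delta$ for all $\alpha\in(0,1)$, $t\ge0$. (i) As $\alpha\to0$, $$\inf_{(T,\mathcal X)\in\mathcal C_\alpha}\mathsf E[T]\ \ge\ \Big(\lambda_*(\alpha)+\frac{|\log\alpha|}{\mathsf D_K(\alpha)}\Big)(1+o(1)),$$ that is, the $\liminf$ of the ratio of the two sides (without the factor $1+o(1)$) is at least $1$. (ii) Let $$b_K=\frac{1-\alpha}{\alpha},\qquad b_1=\frac{1/\zeta_1(\alpha)+\log(b_K)/\mathsf D_K(\alpha)}{1/\mathsf D_1(\alpha)-1/\mathsf D_K(\alpha)},\qquad d=b_1\,\frac{1/\zeta_1(\alpha)+\log(b_K)/\mathsf D_K(\alpha)}{1/I_K+1/J_K}.$$ For every $\alpha\in(0,1)$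 for which these are well defined, i.e. $\zeta_1(\alpha)>0$ and $\mathsf D_1(\alpha)<\mathsf D_K(\alpha)$, we have $(\widetilde T,\widetilde{\mathcal X})\in\mathcal C_\alpha$. If $\mathsf D_1(\alpha)<\mathsf D_K(\alpha)$ and $b_1<b_K$ for all sufficiently small $\alpha$, then as $\alpha\to0$ $$\mathsf E[\widetilde T]\ \le\ \Big(\lambda_1(\alpha)+\frac{|\log\alpha|}{\mathsf D_K(\alpha)}\Big)(1+o(1)),$$ that is, the $\limsup$ of the ratio is at most $1$. -/

import Mathlib

open MeasureTheory ProbabilityTheory Filter Topology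
open scoped ENNReal

/-! Change acceleration and detection with `K = k + 1` treatments, indexed by `Fin (k + 1)`; the
treatments `1` and `K` are the indices `0` and `Fin.last k`.  The latent state is a `Bool` (`true`
after the change).  Times are natural numbers, random times take values in `ℕ∞`. -/

namespace ChangeAccel

noncomputable section

/-- Response densities `f x` (before the change) and `g x` (after the change) with respect to a
`σ`-finite measure `μ`, for each treatment `x`. -/
structure ResponseModel (k : ℕ) (Y : Type*) [MeasurableSpace Y] where
  μ : Measure Y
  sigmaFinite : SigmaFinite μ
  f : Fin (k + 1) → Y → ℝ
  g : Fin (k + 1) → Y → ℝ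
  measurable_f : ∀ x, Measurable (f x)
  measurable_g : ∀ x, Measurable (g x)
  f_nonneg : ∀ x y, 0 ≤ f x y
  g_nonneg : ∀ x y, 0 ≤ g x y
  lintegral_f : ∀ x, ∫⁻ y, ENNReal.ofReal (f x y) ∂μ = 1
  lintegral_g : ∀ x, ∫⁻ y, ENNReal.ofReal (g x y) ∂μ = 1

namespace ResponseModel

variable {k : ℕ} {Y : Type*} [MeasurableSpace Y] (R : ResponseModel k Y)

/-- The law of a response to treatment `x` when the latent state is `i`. -/
def law (x : Fin (k + 1)) (i : Bool) : Measure Y :=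
  R.μ.withDensity fun y => ENNReal.ofReal (if i then R.g x y else R.f x y)

/-- The Kullback-Leibler number `I_x`. -/
def I (x : Fin (k + 1)) : ℝ := ∫ y, Real.log (R.g x y / R.f x y) * R.g x y ∂(R.μ)

/-- The Kullback-Leibler number `J_x`. -/
def J (x : Fin (k + 1)) : ℝ := ∫ y, Real.log (R.f x y / R.g x y) * R.f x y ∂(R.μ)

/-- The log-likelihood ratios have finite second moments and positive means.  The first field
expresses that `log (g / f)`, as an extended real number, is finite almost everywhere under both
densities, which is part of the finiteness of the two second moments (real division and `Real.log`
would hide the infinite values). -/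
structure Regular : Prop where
  pos_iff : ∀ x, ∀ᵐ y ∂(R.μ), 0 < f R x y ↔ 0 < g R x y
  sq_g : ∀ x, Integrable (fun y => Real.log (R.g x y / R.f x y) ^ 2 * R.g x y) R.μ
  sq_f : ∀ x, Integrable (fun y => Real.log (R.f x y / R.g x y) ^ 2 * R.f x y) R.μ
  I_pos : ∀ x, 0 < R.I x
  J_pos : ∀ x, 0 < R.J x

end ResponseModel

/-- The transition functions of a change-point model: `π t z` is the conditional probability that
the change happens at time `t` when the treatments `z = (x_1, ..., x_t)` have been assigned; `π 0`
(on the empty tuple) is the prior probability of a change at time `0`. -/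
abbrev Transition (k : ℕ) : Type := (t : ℕ) → (Fin t → Fin (k + 1)) → ℝ

/-- The latent state at each time, driven by the noise `u`, when the transition probability at time
`t` is `p t`. -/
def latent (p u : ℕ → ℝ) : ℕ → Bool
  | 0 => decide (u 0 ≤ p 0)
  | t + 1 => latent p u t || decide (u (t + 1) ≤ p (t + 1))

/-- The first time at which `q` holds (`⊤` if there is none). -/
def firstTime (q : ℕ → Prop) : ℕ∞ := ⨅ (t : ℕ) (_ : q t), (t : ℕ∞)

/-- The time of the change. -/
def changePoint (p u : ℕ → ℝ) : ℕ∞ := firstTime fun t => latent p u t = true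

/-- The expectation of a random time. -/
def expect {Ω : Type*} [MeasurableSpace Ω] (P : Measure Ω) (T : Ω → ℕ∞) : ℝ≥0∞ :=
  ∫⁻ ω, (T ω : ℝ≥0∞) ∂P

/-- A probability space with independent sequences `U`, `V` of independent random variables, uniform
on `(0,1)`, and a function `h` for which `h x i (V t)` has the law of a response to treatment `x` in
state `i`. -/
structure System {k : ℕ} {Y : Type*} [MeasurableSpace Y] (R : ResponseModel k Y)
    (Ω : Type*) [MeasurableSpace Ω] where
  P : Measure Ω
  isProb : IsProbabilityMeasure P
  U : ℕ → Ω → ℝ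
  V : ℕ → Ω → ℝ
  h : Fin (k + 1) → Bool → ℝ → Y
  measurable_U : ∀ t, Measurable (U t)
  measurable_V : ∀ t, Measurable (V t)
  measurable_h : ∀ x i, Measurable (h x i)
  law_U : ∀ t, P.map (U t) = volume.restrict (Set.Ioo (0 : ℝ) 1)
  law_V : ∀ t, P.map (V t) = volume.restrict (Set.Ioo (0 : ℝ) 1)
  indep : iIndepFun (Sum.elim U V : ℕ ⊕ ℕ → Ω → ℝ) P
  law_h : ∀ x i, (volume.restrict (Set.Ioo (0 : ℝ) 1)).map (h x i) = R.law x i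

/-- The transition probability `π_t(X_1, ..., X_t)` along a treatment process `X`.  Treatments are
assigned from time `1` on; the value `X 0` is never used. -/
def transitionProb {k : ℕ} {Ω : Type*} (π : Transition k) (X : ℕ → Ω → Fin (k + 1))
    (t : ℕ) (ω : Ω) : ℝ :=
  π t fun i => X (i + 1) ω

namespace System

variable {k : ℕ} {Y : Type*} [mY : MeasurableSpace Y] {R : ResponseModel k Y}
  {Ω : Type*} [mΩ : MeasurableSpace Ω] (S : System R Ω) (π : Transition k)

/-- The latent state `L_t` under the treatment process `X`. -/
def L (X : ℕ → Ω → Fin (k + 1)) (t : ℕ) (ω : Ω) : Bool :=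
  latent (fun s => transitionProb π X s ω) (fun s => S.U s ω) t

/-- The change-point under the treatment process `X`. -/
def Θ (X : ℕ → Ω → Fin (k + 1)) (ω : Ω) : ℕ∞ :=
  changePoint (fun s => transitionProb π X s ω) (fun s => S.U s ω)

/-- The response `Y_t`, `t ≥ 1`, under the treatment process `X`. -/
def response (X : ℕ → Ω → Fin (k + 1)) (t : ℕ) (ω : Ω) : Y :=
  S.h (X t ω) (S.L π X t ω) (S.V t ω)

/-- The `σ`-algebra generated by the responses `Y_1, ..., Y_t`. -/
abbrev obs (X : ℕ → Ω → Fin (k + 1)) (t : ℕ) : MeasurableSpace Ω :=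
  ⨆ (s : ℕ) (_ : 1 ≤ s ∧ s ≤ t), mY.comap (S.response π X s)

/-- `(T, X)` is admissible: the treatment at time `t + 1` is determined by the responses up to time
`t`, and `T` is a stopping time of the filtration of the responses. -/
structure Admissible (T : Ω → ℕ∞) (X : ℕ → Ω → Fin (k + 1)) : Prop where
  adapted : ∀ t, Measurable[S.obs π X t] (X (t + 1))
  stopping : ∀ t : ℕ, MeasurableSet[S.obs π X t] {ω | T ω = t}

/-- Membership of `(T, X)` in the class `C_α`. -/
structure InClass (α : ℝ) (T : Ω → ℕ∞) (X : ℕ → Ω → Fin (k + 1)) : Prop where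
  admissible : S.Admissible π T X
  falseAlarm : S.P {ω | T ω < S.Θ π X ω} ≤ ENNReal.ofReal α
  finite : S.P {ω | T ω < ⊤ ∧ S.Θ π X ω < ⊤} = 1

/-- The optimal expected sample size over the class `C_α`. -/
def optimal (α : ℝ) : ℝ≥0∞ :=
  ⨅ (T : Ω → ℕ∞) (X : ℕ → Ω → Fin (k + 1)) (_ : S.InClass π α T X), expect S.P T

/-- The posterior odds that the change has occurred by time `t`. -/
def odds (X : ℕ → Ω → Fin (k + 1)) (t : ℕ) (ω : Ω) : ℝ :=
  (S.P⟦{ω | S.L π X t ω = true} | S.obs π X t⟧) ω /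
    (S.P⟦{ω | S.L π X t ω = false} | S.obs π X t⟧) ω

/-- The number of observations after time `t` until the posterior odds reach `b`. -/
def sigma (X : ℕ → Ω → Fin (k + 1)) (b : ℝ) (t : ℕ) (ω : Ω) : ℕ∞ :=
  firstTime fun s => 1 ≤ s ∧ b ≤ S.odds π X (t + s) ω

/-- The one-sided sequential probability ratio test, started after time `t`, of "no change" against
"change" under treatment `K`. -/
def tau (X : ℕ → Ω → Fin (k + 1)) (d : ℝ) (t : ℕ) (ω : Ω) : ℕ∞ :=
  firstTime fun s => 1 ≤ s ∧ d ≤ ∏ j ∈ Finset.Icc 1 s,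
    R.f (Fin.last k) (S.response π X (t + j) ω) / R.g (Fin.last k) (S.response π X (t + j) ω)

/-- The end `S_n` of the `n`-th stage: odd stages (training) use the threshold `b1`, even stages
(assessment) the thresholds `bK` and `d`.  If a stage never ends, then all later ones end at `⊤`. -/
def stageEnd (X : ℕ → Ω → Fin (k + 1)) (b1 bK d : ℝ) (ω : Ω) : ℕ → ℕ∞
  | 0 => 0
  | n + 1 => stageEnd X b1 bK d ω n +
      if Odd (n + 1) then S.sigma π X b1 (stageEnd X b1 bK d ω n).toNat ω
      else min (S.sigma π X bK (stageEnd X b1 bK d ω n).toNat ω)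
        (S.tau π X d (stageEnd X b1 bK d ω n).toNat ω)

/-- `X` is the assignment rule of the mastery-learning procedure: treatment `1` is assigned in
training stages and treatment `K` in assessment stages, the stages being those of `X` itself.
(The treatment at time `t` is determined by the treatments before `t`, so this fixes `X` at all
times `t ≥ 1`; `exists_isMasteryRule` gives the existence.) -/
def IsMasteryRule (X : ℕ → Ω → Fin (k + 1)) (b1 bK d : ℝ) : Prop :=
  ∀ (ω : Ω) (m t : ℕ), 1 ≤ m →
    (S.stageEnd π X b1 bK d ω (2 * m - 2) < t → t ≤ S.stageEnd π X b1 bK d ω (2 * m - 1) →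
      X t ω = 0) ∧
    (S.stageEnd π X b1 bK d ω (2 * m - 1) < t → t ≤ S.stageEnd π X b1 bK d ω (2 * m) →
      X t ω = Fin.last k)

/-- The number `N` of cycles: the first cycle in which the detection rule stops no later than the
test. -/
def cycles (X : ℕ → Ω → Fin (k + 1)) (b1 bK d : ℝ) (ω : Ω) : ℕ∞ :=
  firstTime fun m => 1 ≤ m ∧
    S.sigma π X bK (S.stageEnd π X b1 bK d ω (2 * m - 1)).toNat ω ≤
      S.tau π X d (S.stageEnd π X b1 bK d ω (2 * m - 1)).toNat ω

open Classical in
/-- The stopping rule `S_{2N}` of the mastery-learning procedure. -/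
def masteryTime (X : ℕ → Ω → Fin (k + 1)) (b1 bK d : ℝ) (ω : Ω) : ℕ∞ :=
  if S.cycles π X b1 bK d ω = ⊤ then ⊤
  else S.stageEnd π X b1 bK d ω (2 * (S.cycles π X b1 bK d ω).toNat)

/-- `λ_x`: the expected time of the change when only treatment `x` is assigned. -/
def lam (x : Fin (k + 1)) : ℝ≥0∞ := expect S.P (S.Θ π fun _ _ => x)

end System

section Asymptotics

variable {k : ℕ}

/-- The smallest transition probability when treatment `x` is assigned. -/
def zeta (π : Transition k) (x : Fin (k + 1)) : ℝ :=
  ⨅ (t : ℕ) (z : Fin t → Fin (k + 1)), π (t + 1) (Fin.snoc (α := fun _ => Fin (k + 1)) z x)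

/-- The largest transition probability at time `t`. -/
def maxTransition (π : Transition k) (t : ℕ) : ℝ := ⨆ z : Fin t → Fin (k + 1), π t z

/-- `λ_*`: the expectation of the change-point for the maximal transition probabilities. -/
def System.lamStar {Y : Type*} [MeasurableSpace Y] {R : ResponseModel k Y}
    {Ω : Type*} [MeasurableSpace Ω] (S : System R Ω) (π : Transition k) : ℝ≥0∞ :=
  expect S.P fun ω => changePoint (maxTransition π) (fun s => S.U s ω)

/-- A family of transition functions, one for each `α ∈ (0,1)`. -/
def IsTransitionFamily (π : ℝ → Transition k) : Prop :=
  ∀ α ∈ Set.Ioo (0 : ℝ) 1, ∀ t z, π α t z ∈ Set.Icc (0 : ℝ) 1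

/-- The change-point model is asymptotically Markovian with limits `p x α`, uniformly in `α`. -/
def AsympMarkovian (π : ℝ → Transition k) (p : Fin (k + 1) → ℝ → ℝ) : Prop :=
  (∀ x, ∀ α ∈ Set.Ioo (0 : ℝ) 1, p x α ∈ Set.Icc (0 : ℝ) 1) ∧
  ∀ x, ∀ ε > 0, ∃ t₀ : ℕ, ∀ t ≥ t₀, ∀ α ∈ Set.Ioo (0 : ℝ) 1, ∀ z : Fin t → Fin (k + 1),
    |π α (t + 1) (Fin.snoc (α := fun _ => Fin (k + 1)) z x) - p x α| ≤ ε

/-- `|log ζ_1(α)| = o(|log α|)` as `α → 0`, where `|log 0| = ∞`. -/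
def SlowTraining (π : ℝ → Transition k) : Prop :=
  (∀ᶠ α in 𝓝[>] (0 : ℝ), 0 < zeta (π α) 0) ∧
  Tendsto (fun α => |Real.log (zeta (π α) 0)| / |Real.log α|) (𝓝[>] (0 : ℝ)) (𝓝 0)

/-- The transition probabilities are bounded away from `1`. -/
def BoundedAwayFromOne (π : ℝ → Transition k) : Prop :=
  ∃ δ ∈ Set.Ioo (0 : ℝ) 1, ∀ α ∈ Set.Ioo (0 : ℝ) 1, ∀ t, maxTransition (π α) t ≤ 1 - δ

variable {Y : Type*} [MeasurableSpace Y] (R : ResponseModel k Y)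

/-- `D_x(α) = I_x + |log (1 - p_x(α))|`. -/
def D (p : Fin (k + 1) → ℝ → ℝ) (x : Fin (k + 1)) (α : ℝ) : ℝ :=
  R.I x + |Real.log (1 - p x α)|

/-- The labelling of the treatments: `λ_1(α)` is the smallest of the `λ_x(α)` and `D_K(α)` is the
largest of the `D_x(α)`. -/
def Ordered {Ω : Type*} [MeasurableSpace Ω] (S : System R Ω) (π : ℝ → Transition k)
    (p : Fin (k + 1) → ℝ → ℝ) : Prop :=
  ∀ α ∈ Set.Ioo (0 : ℝ) 1, ∀ x,
    S.lam (π α) 0 ≤ S.lam (π α) x ∧ D R p x α ≤ D R p (Fin.last k) α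

/-- The threshold `b_K`. -/
def bK (α : ℝ) : ℝ := (1 - α) / α

/-- The threshold `b_1`. -/
def b1 (π : ℝ → Transition k) (p : Fin (k + 1) → ℝ → ℝ) (α : ℝ) : ℝ :=
  (1 / zeta (π α) 0 + Real.log (bK α) / D R p (Fin.last k) α) /
    (1 / D R p 0 α - 1 / D R p (Fin.last k) α)

/-- The threshold `d`. -/
def dThr (π : ℝ → Transition k) (p : Fin (k + 1) → ℝ → ℝ) (α : ℝ) : ℝ :=
  b1 R π p α *
    ((1 / zeta (π α) 0 + Real.log (bK α) / D R p (Fin.last k) α) /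
      (1 / R.I (Fin.last k) + 1 / R.J (Fin.last k)))

end Asymptotics

/-! Existence of the assignment rule of the mastery-learning procedure. -/

section Existence

theorem firstTime_le {q : ℕ → Prop} {r : ℕ} : firstTime q ≤ r ↔ ∃ s ≤ r, q s := by
  classical
  constructor
  · intro h
    by_contra! hc
    have : ((r + 1 : ℕ) : ℕ∞) ≤ firstTime q := by
      refine le_iInf₂ fun t ht => ?_
      by_contra! hlt
      exact hc t (Nat.lt_succ_iff.mp (by exact_mod_cast hlt)) ht
    have h2 := this.trans h
    have : r + 1 ≤ r := by exact_mod_cast h2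
    omega
  · rintro ⟨s, hs, hq⟩
    exact (iInf₂_le s hq).trans (by exact_mod_cast hs)

variable {k : ℕ} {Y : Type*} [mY : MeasurableSpace Y] {R : ResponseModel k Y}
  {Ω : Type*} [mΩ : MeasurableSpace Ω] (S : System R Ω) (π : Transition k)

namespace System

variable {S π} {X X' : ℕ → Ω → Fin (k + 1)} {n : ℕ}

theorem transitionProb_congr {Ω : Type*} {X X' : ℕ → Ω → Fin (k + 1)} (h : ∀ s, 1 ≤ s → s ≤ n → X s = X' s) {s : ℕ} (hs : s ≤ n) (ω : Ω) :
    transitionProb π X s ω = transitionProb π X' s ω := by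
  unfold transitionProb
  congr 1
  funext i
  rw [h (i + 1) (by omega) (by omega)]

theorem L_congr (h : ∀ s, 1 ≤ s → s ≤ n → X s = X' s) {s : ℕ} (hs : s ≤ n) :
    S.L π X s = S.L π X' s := by
  funext ω
  unfold L
  induction s with
  | zero => simp only [latent, transitionProb_congr h hs]
  | succ s ih => simp only [latent, transitionProb_congr h hs, ih (by omega)]

theorem response_congr (h : ∀ s, 1 ≤ s → s ≤ n → X s = X' s) {s : ℕ} (h1 : 1 ≤ s) (hs : s ≤ n) :
    S.response π X s = S.response π X' s := by
  funext ω
  unfold response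
  rw [h s h1 hs, L_congr h hs]

theorem obs_congr (h : ∀ s, 1 ≤ s → s ≤ n → X s = X' s) {s : ℕ} (hs : s ≤ n) :
    S.obs π X s = S.obs π X' s := by
  unfold obs
  refine iSup_congr fun j => iSup_congr fun hj => ?_
  rw [response_congr h hj.1 (hj.2.trans hs)]

theorem odds_congr (h : ∀ s, 1 ≤ s → s ≤ n → X s = X' s) {s : ℕ} (hs : s ≤ n) :
    S.odds π X s = S.odds π X' s := by
  unfold odds
  rw [obs_congr h hs, L_congr h hs]

theorem sigma_le_congr (h : ∀ s, 1 ≤ s → s ≤ n → X s = X' s) (b : ℝ) {t r : ℕ} (hr : t + r ≤ n)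
    (ω : Ω) : S.sigma π X b t ω ≤ r ↔ S.sigma π X' b t ω ≤ r := by
  unfold sigma
  rw [firstTime_le, firstTime_le]
  refine exists_congr fun s => and_congr_right fun hs => and_congr_right fun _ => ?_
  rw [odds_congr h (by omega)]

theorem tau_le_congr (h : ∀ s, 1 ≤ s → s ≤ n → X s = X' s) (d : ℝ) {t r : ℕ} (hr : t + r ≤ n)
    (ω : Ω) : S.tau π X d t ω ≤ r ↔ S.tau π X' d t ω ≤ r := by
  unfold tau
  rw [firstTime_le, firstTime_le]
  refine exists_congr fun s => and_congr_right fun hs => and_congr_right fun _ => ?_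
  rw [Finset.prod_congr rfl fun j hj => ?_]
  rw [Finset.mem_Icc] at hj
  rw [response_congr h (s := t + j) (by omega) (by omega)]

theorem stageEnd_le_of_le (h : ∀ s, 1 ≤ s → s ≤ n → X s = X' s) (b1 bK d : ℝ) (ω : Ω) (m : ℕ) :
    ∀ r ≤ n, S.stageEnd π X b1 bK d ω m ≤ r → S.stageEnd π X' b1 bK d ω m ≤ r := by
  induction m generalizing X X' with
  | zero => intro r _ hr; simp [stageEnd]
  | succ m ih =>
    intro r hrn hr
    have hle : S.stageEnd π X b1 bK d ω m ≤ r := le_trans (by rw [stageEnd]; exact le_self_add) hr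
    obtain ⟨a, ha⟩ := ENat.ne_top_iff_exists.mp (ne_top_of_le_ne_top (ENat.natCast_ne_top r) hle)
    have har : a ≤ r := by rw [← ha] at hle; exact_mod_cast hle
    have h' : ∀ s, 1 ≤ s → s ≤ n → X' s = X s := fun s h1 h2 => (h s h1 h2).symm
    have h1 : S.stageEnd π X' b1 bK d ω m ≤ a := ih h a (har.trans hrn) ha.symm.le
    obtain ⟨a', ha'⟩ := ENat.ne_top_iff_exists.mp (ne_top_of_le_ne_top (ENat.natCast_ne_top a) h1)
    have haa' : a' ≤ a := by rw [← ha'] at h1; exact_mod_cast h1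
    have h2 : S.stageEnd π X b1 bK d ω m ≤ a' :=
      ih h' a' ((haa'.trans har).trans hrn) ha'.symm.le
    have haa : a' = a := le_antisymm haa' (by rw [← ha] at h2; exact_mod_cast h2)
    subst haa
    rw [stageEnd, ← ha] at hr
    rw [stageEnd, ← ha']
    simp only [ENat.toNat_natCast] at hr ⊢
    obtain ⟨c, rfl⟩ := Nat.exists_eq_add_of_le har
    have key : ∀ u : ℕ∞, (a' : ℕ∞) + u ≤ ((a' + c : ℕ) : ℕ∞) ↔ u ≤ c := by
      intro u
      push_cast
      exact ENat.add_le_add_iff_left (ENat.natCast_ne_top a')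
    rw [key] at hr ⊢
    split_ifs at hr ⊢ with hodd
    · exact (sigma_le_congr h b1 hrn ω).mp hr
    · rw [min_le_iff] at hr ⊢
      exact hr.imp (sigma_le_congr h bK hrn ω).mp (tau_le_congr h d hrn ω).mp

theorem stageEnd_mono (X : ℕ → Ω → Fin (k + 1)) (b1 bK d : ℝ) (ω : Ω) :
    Monotone (S.stageEnd π X b1 bK d ω) :=
  monotone_nat_of_le_succ fun n => by rw [stageEnd.eq_2]; exact le_self_add

open Classical in
/-- The assignment rule up to time `n`, defined recursively in `n`. -/
def ruleUpTo (S : System R Ω) (π : Transition k) (b1 bK d : ℝ) : ℕ → ℕ → Ω → Fin (k + 1)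
  | 0 => fun _ _ => 0
  | n + 1 => Function.update (ruleUpTo S π b1 bK d n) (n + 1) fun ω =>
      if ∃ m, S.stageEnd π (ruleUpTo S π b1 bK d n) b1 bK d ω (2 * m + 1) ≤ n ∧
        ¬ S.stageEnd π (ruleUpTo S π b1 bK d n) b1 bK d ω (2 * m + 2) ≤ n
      then Fin.last k else 0

theorem ruleUpTo_eq (b1 bK d : ℝ) {s n : ℕ} (h : s ≤ n) :
    ruleUpTo S π b1 bK d n s = ruleUpTo S π b1 bK d s s := by
  induction n, h using Nat.le_induction with
  | base => rfl
  | succ n hn ih => rw [ruleUpTo, Function.update_of_ne (by omega), ih]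

theorem exists_isMasteryRule (S : System R Ω) (π : Transition k) (b1 bK d : ℝ) :
    ∃ X, S.IsMasteryRule π X b1 bK d := by
  classical
  refine ⟨fun t => ruleUpTo S π b1 bK d t t, ?_⟩
  set X : ℕ → Ω → Fin (k + 1) := fun t => ruleUpTo S π b1 bK d t t with hX
  intro ω m t hm
  obtain ⟨m, rfl⟩ : ∃ m', m = m' + 1 := ⟨m - 1, by omega⟩
  rw [show 2 * (m + 1) - 2 = 2 * m by omega, show 2 * (m + 1) - 1 = 2 * m + 1 by omega,
    show 2 * (m + 1) = 2 * m + 2 by omega]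
  rcases t with _ | n
  · constructor <;> intro h <;> simp at h
  have hag : ∀ s, 1 ≤ s → s ≤ n → ruleUpTo S π b1 bK d n s = X s :=
    fun s _ hs => ruleUpTo_eq b1 bK d hs
  have hag' : ∀ s, 1 ≤ s → s ≤ n → X s = ruleUpTo S π b1 bK d n s :=
    fun s h1 hs => (hag s h1 hs).symm
  have hiff : ∀ j, S.stageEnd π (ruleUpTo S π b1 bK d n) b1 bK d ω j ≤ n ↔
      S.stageEnd π X b1 bK d ω j ≤ n := fun j =>
    ⟨stageEnd_le_of_le hag b1 bK d ω j n le_rfl, stageEnd_le_of_le hag' b1 bK d ω j n le_rfl⟩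
  have hval : X (n + 1) ω = if ∃ m, S.stageEnd π X b1 bK d ω (2 * m + 1) ≤ n ∧
      ¬ S.stageEnd π X b1 bK d ω (2 * m + 2) ≤ n then Fin.last k else 0 := by
    simp only [hX]
    rw [ruleUpTo, Function.update_self]
    simp only [hiff]
    rfl
  have hlt : ∀ u : ℕ∞, u < ((n + 1 : ℕ) : ℕ∞) ↔ u ≤ n := by
    intro u
    push_cast
    exact Order.lt_add_one_iff_of_not_isMax (by simp)
  have hge : ∀ u : ℕ∞, ((n + 1 : ℕ) : ℕ∞) ≤ u ↔ ¬ u ≤ n := by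
    intro u
    rw [← hlt, not_lt]
  simp only [hlt, hge, hval]
  refine ⟨fun ha hb => if_neg ?_, fun ha hb => if_pos ⟨m, ha, hb⟩⟩
  rintro ⟨j, hj1, hj2⟩
  rcases le_or_gt m j with hmj | hmj
  · exact hb ((stageEnd_mono X b1 bK d ω (by omega : 2 * m + 1 ≤ 2 * j + 1)).trans hj1)
  · exact hj2 ((stageEnd_mono X b1 bK d ω (by omega : 2 * j + 2 ≤ 2 * m)).trans ha)

end System

end Existence

end

end ChangeAccel

/-!
The proof compares the responses before and after the change by a change of measure. For a set `A` of
times, `System.ratio A` is the likelihood ratio of "the change has happened, at a time in `A`" against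
"no change so far", defined by the usual recursion. `System.changeOfMeasure` shows by induction that
integrals of functions of the responses over the first event turn into integrals weighted by this
ratio over the second one. For `A = Set.univ` the ratio is the posterior odds (`System.odds_ae_eq`);
for `A = {s}` it is the ratio used in the lower bound. After the change, each time step under
treatment `x` raises the logarithm of the ratio by a log-likelihood ratio with mean `I x`, plus the
hazard `|log (1 - Π_t)|`, which tends to `|log (1 - p_x)|`; the drift is therefore `D_x`.

**Lower bound.** Let `n` be about `(1 - ε) |log α| / D_K`, and consider an alarm less than `n` time
units after the change (`System.measure_window_le`). If the likelihood ratio of the change is then at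
most `α ^ -(1 - ε / 4)`, the change of measure charges the event to the false alarms, of which there
are few. If not, the sum of the centered log-likelihood ratios is of the order of `ε |log α|` after at
most `n` steps, which is unlikely by Chebyshev's inequality (`System.integral_centered_sum_sq_le`).
Hence `T ≥ Θ + n` with high probability. Driving the model with the maximal transition probabilities
by the same noise gives a change-point `Θ_* ≤ Θ` with expectation `λ_*`. Where `T < Θ`, the part of
`λ_*` that is lost is at most `2 √α / ζ_1` (`System.lintegral_maxChangePoint_le`), which is bounded
because `ζ_1` decays more slowly than every power of `α`. This is `System.InClass.lower_bound`, and
its asymptotic form is `eventually_le_optimal`.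

**Admissibility of the procedure.** It stops only when the posterior odds are at least `b_K`, hence
before the change with probability at most `1 / (1 + b_K)`, which is `α`. The change happens almost
surely: without it every assessment stage would end, since the test has the positive drift `J_K`, and
there would be infinitely many steps under treatment `1`, each bringing the change with probability
at least `ζ_1`. After the change the posterior odds become large, and the procedure stops once they
are large at two consecutive times. See `System.IsMasteryRule.inClass`.

**Upper bound.** The expected number of steps until a sum of log-likelihood ratios and hazards with
drift `m` exceeds a level `b` is about `b / m`; the overshoot is controlled by `ξ ≤ c + ξ² / (4c)`, with
`c` large, so that it costs a small part of the drift (`System.sum_measure_le_of_drift`). In the first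
cycle, the training stage takes `λ_1` for the change and about `(log b_1 + |log ζ_1|) / D_1` steps after
it, and the assessment stage about `(log b_K - log b_1) / D_K` steps. A cycle fails when its training
stage ends before the change, with probability at most `1 / (1 + b_1)`, or when the test rejects a
change that has happened. In the latter case the product in the test, a nonnegative martingale,
exceeds `d`, which has probability at most `1 / d` (`System.IsMasteryRule.measure_tau_lt_sigma_le`).
So the later cycles contribute a geometric series (`System.IsMasteryRule.expect_masteryTime_le`).
The thresholds balance these terms: `b_1` and `d` exceed, up to constants, the expected length of a
cycle, so that the later cycles contribute a bounded amount (`later_cycles_le`), while the extra cost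
`(1 / D_1 - 1 / D_K) log b_1` of training is `o(|log α|)`, even if `D_1` and `D_K` are close
(`first_cycle_le`). The result is `eventually_expect_le`.
-/

namespace ChangeAccel

noncomputable section

/-! ### The noise and the latent state -/

theorem latent_mono (p u : ℕ → ℝ) {s t : ℕ} (h : s ≤ t) (hs : latent p u s = true) :
    latent p u t = true := by
  induction t, h using Nat.le_induction with
  | base => exact hs
  | succ n _ ih => simp [latent, ih]

theorem changePoint_le_iff (p u : ℕ → ℝ) (t : ℕ) :
    changePoint p u ≤ t ↔ latent p u t = true := by
  rw [changePoint, firstTime_le]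
  exact ⟨fun ⟨s, hs, h⟩ => latent_mono p u hs h, fun h => ⟨t, le_rfl, h⟩⟩

theorem lt_changePoint_iff (p u : ℕ → ℝ) (t : ℕ) :
    (t : ℕ∞) < changePoint p u ↔ latent p u t = false := by
  rw [← not_le, changePoint_le_iff, Bool.not_eq_true]

theorem measurable_latent {Ω : Type*} {m : MeasurableSpace Ω} {p u : ℕ → Ω → ℝ} {t : ℕ}
    (hp : ∀ s ≤ t, Measurable (p s)) (hu : ∀ s ≤ t, Measurable (u s)) :
    Measurable fun ω => latent (fun s => p s ω) (fun s => u s ω) t := by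
  have hdec : ∀ s ≤ t, Measurable fun ω => decide (u s ω ≤ p s ω) := by
    intro s hs
    refine measurable_to_bool ?_
    have : (fun ω => decide (u s ω ≤ p s ω)) ⁻¹' {true} = {ω | u s ω ≤ p s ω} := by ext; simp
    rw [this]
    exact measurableSet_le (hu s hs) (hp s hs)
  induction t with
  | zero => exact hdec 0 le_rfl
  | succ t ih =>
    have h1 := ih (fun s hs => hp s (by omega)) (fun s hs => hu s (by omega))
      (fun s hs => hdec s (by omega))
    exact (Measurable.of_discrete (f := fun q : Bool × Bool => q.1 || q.2)).comp
      (h1.prodMk (hdec (t + 1) le_rfl))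

theorem measurable_treatments {k : ℕ} {Ω : Type*} {m : MeasurableSpace Ω}
    {X : ℕ → Ω → Fin (k + 1)} {t : ℕ} (h : ∀ s, 1 ≤ s → s ≤ t → Measurable (X s)) :
    Measurable fun ω => fun i : Fin t => X (i + 1) ω :=
  measurable_pi_lambda _ fun i => h _ (by omega) (by omega)

theorem measurable_transitionProb {k : ℕ} {π : Transition k} {Ω : Type*} {m : MeasurableSpace Ω}
    {X : ℕ → Ω → Fin (k + 1)} {t : ℕ}
    (h : ∀ s, 1 ≤ s → s ≤ t → Measurable (X s)) : Measurable (transitionProb π X t) := by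
  exact (Measurable.of_discrete (f := π t)).comp (measurable_treatments h)

/-- Two measures that agree on the intersections of sets from two `σ`-algebras agree on the
`σ`-algebra that these generate. -/
theorem measure_eq_of_sup {Ω : Type*} {mΩ : MeasurableSpace Ω} {μ ν : Measure Ω} [IsFiniteMeasure μ]
    {m₁ m₂ : MeasurableSpace Ω} (h₁ : m₁ ≤ mΩ) (h₂ : m₂ ≤ mΩ)
    (h : ∀ A B, MeasurableSet[m₁] A → MeasurableSet[m₂] B → μ (A ∩ B) = ν (A ∩ B))
    {s : Set Ω} (hs : MeasurableSet[m₁ ⊔ m₂] s) : μ s = ν s := by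
  have hle : m₁ ⊔ m₂ ≤ mΩ := sup_le h₁ h₂
  let C : Set (Set Ω) := {s | ∃ A B, MeasurableSet[m₁] A ∧ MeasurableSet[m₂] B ∧ s = A ∩ B}
  have hgen : m₁ ⊔ m₂ = MeasurableSpace.generateFrom C := by
    apply le_antisymm
    · refine sup_le (fun A hA => ?_) (fun B hB => ?_)
      · exact MeasurableSpace.measurableSet_generateFrom
          ⟨A, Set.univ, hA, MeasurableSet.univ, (Set.inter_univ A).symm⟩
      · exact MeasurableSpace.measurableSet_generateFrom
          ⟨Set.univ, B, MeasurableSet.univ, hB, (Set.univ_inter B).symm⟩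
    · refine MeasurableSpace.generateFrom_le ?_
      rintro _ ⟨A, B, hA, hB, rfl⟩
      exact MeasurableSet.inter ((le_sup_left : m₁ ≤ m₁ ⊔ m₂) _ hA)
        ((le_sup_right : m₂ ≤ m₁ ⊔ m₂) _ hB)
  have hpi : IsPiSystem C := by
    rintro _ ⟨A, B, hA, hB, rfl⟩ _ ⟨A', B', hA', hB', rfl⟩ _
    exact ⟨A ∩ A', B ∩ B', hA.inter hA', hB.inter hB', by
      ext; simp only [Set.mem_inter_iff]; tauto⟩
  have huniv : μ Set.univ = ν Set.univ := by
    simpa using h Set.univ Set.univ MeasurableSet.univ MeasurableSet.univ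
  have key : μ.trim hle = ν.trim hle := by
    refine ext_of_generate_finite C hgen hpi ?_ ?_
    · rintro _ ⟨A, B, hA, hB, rfl⟩
      have hAB : MeasurableSet[m₁ ⊔ m₂] (A ∩ B) :=
        MeasurableSet.inter ((le_sup_left : m₁ ≤ m₁ ⊔ m₂) _ hA)
          ((le_sup_right : m₂ ≤ m₁ ⊔ m₂) _ hB)
      rw [trim_measurableSet_eq hle hAB, trim_measurableSet_eq hle hAB]
      exact h A B hA hB
    · rw [trim_measurableSet_eq hle MeasurableSet.univ, trim_measurableSet_eq hle MeasurableSet.univ]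
      exact huniv
  rw [← trim_measurableSet_eq hle hs, ← trim_measurableSet_eq hle hs, key]

namespace System

variable {k : ℕ} {Y : Type*} [mY : MeasurableSpace Y] {R : ResponseModel k Y}
  {Ω : Type*} [mΩ : MeasurableSpace Ω] (S : System R Ω) (π : Transition k)

instance : IsProbabilityMeasure S.P := S.isProb

/-- The `σ`-algebra generated by the noise variables with index in `I`, where `Sum.inl t` stands for
`U_t` and `Sum.inr t` for `V_t`. -/
abbrev noise (I : Set (ℕ ⊕ ℕ)) : MeasurableSpace Ω :=
  ⨆ i ∈ I, MeasurableSpace.comap (Sum.elim S.U S.V i) inferInstance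

/-- The noise `U_s, V_s` with `s < t`. -/
abbrev prev (t : ℕ) : MeasurableSpace Ω := S.noise {i | i.elim (· < t) (· < t)}

/-- The noise available just before the response at time `t` is drawn: `U_s` with `s ≤ t` and `V_s`
with `s < t`. -/
abbrev curr (t : ℕ) : MeasurableSpace Ω := S.noise {i | i.elim (· ≤ t) (· < t)}

theorem measurable_noiseVar (i : ℕ ⊕ ℕ) : Measurable (Sum.elim S.U S.V i) := by
  rcases i with t | t
  exacts [S.measurable_U t, S.measurable_V t]

theorem noise_le (I : Set (ℕ ⊕ ℕ)) : S.noise I ≤ mΩ :=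
  iSup₂_le fun i _ => (S.measurable_noiseVar i).comap_le

theorem noise_mono {I J : Set (ℕ ⊕ ℕ)} (h : I ⊆ J) : S.noise I ≤ S.noise J :=
  biSup_mono h

theorem prev_le (t : ℕ) : S.prev t ≤ mΩ := S.noise_le _

theorem curr_le (t : ℕ) : S.curr t ≤ mΩ := S.noise_le _

theorem prev_le_curr (t : ℕ) : S.prev t ≤ S.curr t :=
  S.noise_mono fun i hi => by rcases i with s | s <;> simp at hi ⊢ <;> omega

theorem curr_le_prev {s t : ℕ} (h : s < t) : S.curr s ≤ S.prev t :=
  S.noise_mono fun i hi => by rcases i with r | r <;> simp at hi ⊢ <;> omega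

theorem prev_mono {s t : ℕ} (h : s ≤ t) : S.prev s ≤ S.prev t :=
  S.noise_mono fun i hi => by rcases i with r | r <;> simp at hi ⊢ <;> omega

theorem measurable_noise {I : Set (ℕ ⊕ ℕ)} {i : ℕ ⊕ ℕ} (hi : i ∈ I) :
    Measurable[S.noise I] (Sum.elim S.U S.V i) :=
  Measurable.of_comap_le
    (le_iSup₂ (f := fun i (_ : i ∈ I) => MeasurableSpace.comap (Sum.elim S.U S.V i) inferInstance) i hi)

theorem measurable_U_curr (t : ℕ) : Measurable[S.curr t] (S.U t) :=
  S.measurable_noise (I := {i | i.elim (· ≤ t) (· < t)}) (i := Sum.inl t) (by simp)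

theorem measurable_V_prev (t : ℕ) : Measurable[S.prev (t + 1)] (S.V t) :=
  S.measurable_noise (I := {i | i.elim (· < t + 1) (· < t + 1)}) (i := Sum.inr t) (by simp)

theorem indep_noise {I : Set (ℕ ⊕ ℕ)} {i : ℕ ⊕ ℕ} (hi : i ∉ I) :
    Indep (S.noise I) (MeasurableSpace.comap (Sum.elim S.U S.V i) inferInstance) S.P := by
  have h := indep_iSup_of_disjoint (m := fun i => MeasurableSpace.comap (Sum.elim S.U S.V i) inferInstance)
    (fun i => (S.measurable_noiseVar i).comap_le) S.indep.iIndep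
    (Set.disjoint_singleton_right.mpr hi)
  simpa [noise] using h

theorem indep_curr_V (t : ℕ) :
    Indep (S.curr t) (MeasurableSpace.comap (S.V t) inferInstance) S.P :=
  S.indep_noise (I := {i | i.elim (· ≤ t) (· < t)}) (i := Sum.inr t) (by simp)

theorem indep_prev_U (t : ℕ) :
    Indep (S.prev t) (MeasurableSpace.comap (S.U t) inferInstance) S.P :=
  S.indep_noise (I := {i | i.elim (· < t) (· < t)}) (i := Sum.inl t) (by simp)

theorem lintegral_mul_V {t : ℕ} {Z : Ω → ℝ≥0∞} (hZ : Measurable[S.curr t] Z) {φ : ℝ → ℝ≥0∞}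
    (hφ : Measurable φ) :
    ∫⁻ ω, Z ω * φ (S.V t ω) ∂S.P = (∫⁻ ω, Z ω ∂S.P) * ∫⁻ v in Set.Ioo (0 : ℝ) 1, φ v := by
  rw [← S.law_V t, lintegral_map hφ (S.measurable_V t)]
  exact lintegral_mul_eq_lintegral_mul_lintegral_of_independent_measurableSpace (S.curr_le t)
    (S.measurable_V t).comap_le (S.indep_curr_V t) hZ (hφ.comp (comap_measurable (S.V t)))

theorem lintegral_mul_U {t : ℕ} {Z : Ω → ℝ≥0∞} (hZ : Measurable[S.prev t] Z) {φ : ℝ → ℝ≥0∞}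
    (hφ : Measurable φ) :
    ∫⁻ ω, Z ω * φ (S.U t ω) ∂S.P = (∫⁻ ω, Z ω ∂S.P) * ∫⁻ v in Set.Ioo (0 : ℝ) 1, φ v := by
  rw [← S.law_U t, lintegral_map hφ (S.measurable_U t)]
  exact lintegral_mul_eq_lintegral_mul_lintegral_of_independent_measurableSpace (S.prev_le t)
    (S.measurable_U t).comap_le (S.indep_prev_U t) hZ (hφ.comp (comap_measurable (S.U t)))

section Adapted

variable {S π} {X : ℕ → Ω → Fin (k + 1)}

theorem L_mono {s t : ℕ} (h : s ≤ t) {ω : Ω} (hs : S.L π X s ω = true) : S.L π X t ω = true :=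
  latent_mono _ _ h hs

theorem Θ_le_iff (t : ℕ) (ω : Ω) : S.Θ π X ω ≤ t ↔ S.L π X t ω = true :=
  changePoint_le_iff _ _ _

theorem lt_Θ_iff (t : ℕ) (ω : Ω) : (t : ℕ∞) < S.Θ π X ω ↔ S.L π X t ω = false :=
  lt_changePoint_iff _ _ _

theorem obs_mono {s t : ℕ} (h : s ≤ t) : S.obs π X s ≤ S.obs π X t :=
  biSup_mono fun _ hr => ⟨hr.1, hr.2.trans h⟩

theorem measurable_response_obs {s t : ℕ} (h1 : 1 ≤ s) (hs : s ≤ t) :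
    Measurable[S.obs π X t] (S.response π X s) :=
  Measurable.of_comap_le (le_iSup₂ (f := fun (s : ℕ) (_ : 1 ≤ s ∧ s ≤ t) =>
    mY.comap (S.response π X s)) s ⟨h1, hs⟩)

theorem obs_succ (t : ℕ) :
    S.obs π X (t + 1) = S.obs π X t ⊔ mY.comap (S.response π X (t + 1)) := by
  apply le_antisymm
  · refine iSup₂_le fun s hs => ?_
    rcases Nat.lt_or_ge t s with h | h
    · obtain rfl : s = t + 1 := by omega
      exact le_sup_right
    · exact le_trans (measurable_response_obs hs.1 h).comap_le le_sup_left
  · exact sup_le (obs_mono (Nat.le_succ t)) (measurable_response_obs (by omega) le_rfl).comap_le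

theorem measurable_h_uncurry (S : System R Ω) :
    Measurable fun q : (Fin (k + 1) × Bool) × ℝ => S.h q.1.1 q.1.2 q.2 :=
  measurable_from_prod_countable_right fun q => S.measurable_h q.1 q.2

variable (hX : ∀ t, Measurable[S.obs π X t] (X (t + 1)))
include hX

theorem obs_le_prev (t : ℕ) : S.obs π X t ≤ S.prev (t + 1) := by
  induction t using Nat.strong_induction_on with
  | _ t ih =>
    have hXs : ∀ s, 1 ≤ s → s ≤ t → Measurable[S.prev s] (X s) := by
      intro s h1 hs
      obtain ⟨r, rfl⟩ := Nat.exists_eq_add_of_le' h1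
      exact (hX r).mono (ih r (by omega)) le_rfl
    refine iSup₂_le fun s hs => ?_
    refine Measurable.comap_le ?_
    have hXs' : ∀ r, 1 ≤ r → r ≤ s → Measurable[S.prev (t + 1)] (X r) := fun r h1 h2 =>
      (hXs r h1 (by omega)).mono (S.prev_mono (by omega)) le_rfl
    have hL : Measurable[S.prev (t + 1)] (S.L π X s) := by
      refine measurable_latent (fun r hr => measurable_transitionProb
        fun q h1 h2 => hXs' q h1 (h2.trans hr)) fun r hr => ?_
      exact (S.measurable_U_curr r).mono (S.curr_le_prev (by omega)) le_rfl
    have hV : Measurable[S.prev (t + 1)] (S.V s) :=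
      (S.measurable_V_prev s).mono (S.prev_mono (by omega)) le_rfl
    exact (measurable_h_uncurry S).comp (((hXs' s hs.1 le_rfl).prodMk hL).prodMk hV)

theorem obs_le (t : ℕ) : S.obs π X t ≤ mΩ := (obs_le_prev hX t).trans (S.prev_le _)

theorem measurable_X_prev {t : ℕ} (ht : 1 ≤ t) : Measurable[S.prev t] (X t) := by
  obtain ⟨r, rfl⟩ := Nat.exists_eq_add_of_le' ht
  exact (hX r).mono (obs_le_prev hX r) le_rfl

theorem measurable_X_obs {s t : ℕ} (hs : 1 ≤ s) (hst : s ≤ t + 1) :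
    Measurable[S.obs π X t] (X s) := by
  obtain ⟨r, rfl⟩ := Nat.exists_eq_add_of_le' hs
  exact (hX r).mono (obs_mono (by omega)) le_rfl

theorem measurable_transitionProb_obs (t : ℕ) :
    Measurable[S.obs π X t] (transitionProb π X (t + 1)) :=
  measurable_transitionProb fun _ h1 h2 => measurable_X_obs hX h1 h2

theorem measurable_transitionProb_prev (t : ℕ) :
    Measurable[S.prev t] (transitionProb π X t) :=
  measurable_transitionProb fun _ h1 h2 =>
    (measurable_X_prev hX h1).mono (S.prev_mono h2) le_rfl

theorem measurable_L_curr (t : ℕ) : Measurable[S.curr t] (S.L π X t) :=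
  measurable_latent (fun _ hs => measurable_transitionProb fun _ h1 h2 => (measurable_X_prev hX h1).mono
      ((S.prev_mono (h2.trans hs)).trans (S.prev_le_curr t)) le_rfl)
    fun s hs => by
      rcases hs.lt_or_eq with h | rfl
      · exact (S.measurable_U_curr s).mono ((S.curr_le_prev h).trans (S.prev_le_curr t)) le_rfl
      · exact S.measurable_U_curr s

theorem measurable_L_prev (t : ℕ) : Measurable[S.prev (t + 1)] (S.L π X t) :=
  (measurable_L_curr hX t).mono (S.curr_le_prev (by omega)) le_rfl

theorem measurable_L' (t : ℕ) : Measurable (S.L π X t) :=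
  (measurable_L_curr hX t).mono (S.curr_le t) le_rfl

theorem measurableSet_L_curr (t : ℕ) (i : Bool) : MeasurableSet[S.curr t] {ω | S.L π X t ω = i} :=
  measurable_L_curr hX t (measurableSet_singleton i)

theorem measurableSet_L_prev (t : ℕ) (i : Bool) :
    MeasurableSet[S.prev (t + 1)] {ω | S.L π X t ω = i} :=
  measurable_L_prev hX t (measurableSet_singleton i)

theorem measurableSet_L (t : ℕ) (i : Bool) : MeasurableSet {ω | S.L π X t ω = i} :=
  measurable_L' hX t (measurableSet_singleton i)

theorem obs_le_curr (t : ℕ) : S.obs π X t ≤ S.curr (t + 1) :=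
  (obs_le_prev hX t).trans (S.prev_le_curr _)

theorem measurable_response {t : ℕ} (ht : 1 ≤ t) : Measurable (S.response π X t) :=
  (measurable_response_obs ht le_rfl).mono (obs_le hX t) le_rfl

theorem measurable_X {t : ℕ} (ht : 1 ≤ t) : Measurable (X t) :=
  (measurable_X_prev hX ht).mono (S.prev_le t) le_rfl

/-- Given the noise before the response at time `t`, in latent state `i`, the response has the law of
a response to the treatment `X_t` in state `i`. -/
theorem lintegral_response {t : ℕ} (ht : 1 ≤ t) {Z : Ω → ℝ≥0∞} (hZ : Measurable[S.curr t] Z)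
    {ψ : Fin (k + 1) → Y → ℝ≥0∞} (hψ : ∀ x, Measurable (ψ x)) (i : Bool)
    (hi : ∀ ω, Z ω ≠ 0 → S.L π X t ω = i) :
    ∫⁻ ω, Z ω * ψ (X t ω) (S.response π X t ω) ∂S.P =
      ∫⁻ ω, Z ω * (∫⁻ y, ψ (X t ω) y ∂(R.law (X t ω) i)) ∂S.P := by
  have hXt : Measurable[S.curr t] (X t) :=
    (measurable_X_prev hX ht).mono (S.prev_le_curr t) le_rfl
  have hZx : ∀ x, Measurable[S.curr t] (({ω | X t ω = x}).indicator Z) := fun x =>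
    hZ.indicator (hXt (measurableSet_singleton x))
  have hZ0 : Measurable Z := hZ.mono (S.curr_le t) le_rfl
  have e1 : ∀ ω, Z ω * ψ (X t ω) (S.response π X t ω) =
      ∑ x, ({ω | X t ω = x}).indicator Z ω * ψ x (S.h x i (S.V t ω)) := by
    intro ω
    rw [Finset.sum_eq_single (X t ω)]
    · by_cases h0 : Z ω = 0
      · simp [h0, Set.indicator]
      · simp [Set.indicator, response, hi ω h0]
    · intro x _ hx
      simp [Set.indicator, Ne.symm hx]
    · simp
  have e2 : ∀ ω, (Z ω * (∫⁻ y, ψ (X t ω) y ∂(R.law (X t ω) i))) =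
      ∑ x, ({ω | X t ω = x}).indicator Z ω * (∫⁻ y, ψ x y ∂(R.law x i)) := by
    intro ω
    rw [Finset.sum_eq_single (X t ω)]
    · simp [Set.indicator]
    · intro x _ hx
      simp [Set.indicator, Ne.symm hx]
    · simp
  have hm : ∀ x, Measurable fun v => ψ x (S.h x i v) := fun x => (hψ x).comp (S.measurable_h x i)
  simp only [e1, e2]
  rw [lintegral_finsetSum, lintegral_finsetSum]
  · refine Finset.sum_congr rfl fun x _ => ?_
    rw [S.lintegral_mul_V (hZx x) (hm x), lintegral_mul_const _ ((hZx x).mono (S.curr_le t) le_rfl),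
      ← S.law_h x i, lintegral_map (hψ x) (S.measurable_h x i)]
  · exact fun x _ => ((hZx x).mono (S.curr_le t) le_rfl).mul_const _
  · exact fun x _ => ((hZx x).mono (S.curr_le t) le_rfl).mul ((hm x).comp (S.measurable_V t))

/-- Given the noise before time `t`, the variable `U_t` falls into a random set determined by the
transition probability with the probability of that set. -/
theorem lintegral_transition {t : ℕ} {Z : Ω → ℝ≥0∞} (hZ : Measurable[S.prev t] Z)
    {φ : ℝ → ℝ → ℝ≥0∞} (hφ : ∀ a, Measurable (φ a)) :
    ∫⁻ ω, Z ω * φ (transitionProb π X t ω) (S.U t ω) ∂S.P =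
      ∫⁻ ω, Z ω * (∫⁻ u in Set.Ioo (0 : ℝ) 1, φ (transitionProb π X t ω) u) ∂S.P := by
  let ξ : Ω → (Fin t → Fin (k + 1)) := fun ω i => X (i + 1) ω
  have hξ : Measurable[S.prev t] ξ := measurable_treatments fun s h1 h2 =>
    (measurable_X_prev hX h1).mono (S.prev_mono h2) le_rfl
  have hZx : ∀ z, Measurable[S.prev t] (({ω | ξ ω = z}).indicator Z) := fun z =>
    hZ.indicator (hξ (measurableSet_singleton z))
  have e1 : ∀ ω, Z ω * φ (transitionProb π X t ω) (S.U t ω) =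
      ∑ z, ({ω | ξ ω = z}).indicator Z ω * φ (π t z) (S.U t ω) := by
    intro ω
    rw [Finset.sum_eq_single (ξ ω)]
    · simp [Set.indicator, transitionProb, ξ]
    · intro x _ hx
      simp [Set.indicator, Ne.symm hx]
    · simp
  have e2 : ∀ ω, (Z ω * ∫⁻ u in Set.Ioo (0 : ℝ) 1, φ (transitionProb π X t ω) u) =
      ∑ z, ({ω | ξ ω = z}).indicator Z ω * ∫⁻ u in Set.Ioo (0 : ℝ) 1, φ (π t z) u := by
    intro ω
    rw [Finset.sum_eq_single (ξ ω)]
    · simp [Set.indicator, transitionProb, ξ]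
    · intro x _ hx
      simp [Set.indicator, Ne.symm hx]
    · simp
  simp only [e1, e2]
  rw [lintegral_finsetSum, lintegral_finsetSum]
  · refine Finset.sum_congr rfl fun x _ => ?_
    rw [S.lintegral_mul_U (hZx x) (hφ _), lintegral_mul_const _ ((hZx x).mono (S.prev_le t) le_rfl)]
  · exact fun x _ => ((hZx x).mono (S.prev_le t) le_rfl).mul_const _
  · exact fun x _ => ((hZx x).mono (S.prev_le t) le_rfl).mul ((hφ _).comp (S.measurable_U t))

theorem lintegral_U_le (hπ : ∀ t z, π t z ∈ Set.Icc (0 : ℝ) 1) {t : ℕ} {Z : Ω → ℝ≥0∞}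
    (hZ : Measurable[S.prev t] Z) :
    ∫⁻ ω in {ω | S.U t ω ≤ transitionProb π X t ω}, Z ω ∂S.P =
      ∫⁻ ω, Z ω * ENNReal.ofReal (transitionProb π X t ω) ∂S.P := by
  have hm : MeasurableSet {ω | S.U t ω ≤ transitionProb π X t ω} :=
    measurableSet_le (S.measurable_U t)
      ((measurable_transitionProb_prev hX t).mono (S.prev_le t) le_rfl)
  have h := lintegral_transition hX hZ (φ := fun a => (Set.Iic a).indicator 1)
    fun a => measurable_one.indicator measurableSet_Iic
  rw [← lintegral_indicator hm]
  convert h using 3 with ω ω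
  · by_cases hω : S.U t ω ≤ transitionProb π X t ω <;> simp [Set.indicator, hω]
  · have h01 := hπ t (fun i => X (i + 1) ω)
    rw [lintegral_indicator_one measurableSet_Iic, Measure.restrict_apply measurableSet_Iic]
    have h1 : Set.Ioo 0 (transitionProb π X t ω) ⊆
        Set.Iic (transitionProb π X t ω) ∩ Set.Ioo (0 : ℝ) 1 :=
      fun u hu => ⟨hu.2.le, hu.1, hu.2.trans_le h01.2⟩
    have h2 : Set.Iic (transitionProb π X t ω) ∩ Set.Ioo (0 : ℝ) 1 ⊆
        Set.Ioc 0 (transitionProb π X t ω) := fun u hu => ⟨hu.2.1, hu.1⟩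
    have h3 := measure_mono (μ := volume) h1
    have h4 := measure_mono (μ := volume) h2
    rw [Real.volume_Ioo, sub_zero] at h3
    rw [Real.volume_Ioc, sub_zero] at h4
    rw [le_antisymm h4 h3]

theorem lintegral_lt_U (hπ : ∀ t z, π t z ∈ Set.Icc (0 : ℝ) 1) {t : ℕ} {Z : Ω → ℝ≥0∞}
    (hZ : Measurable[S.prev t] Z) :
    ∫⁻ ω in {ω | transitionProb π X t ω < S.U t ω}, Z ω ∂S.P =
      ∫⁻ ω, Z ω * ENNReal.ofReal (1 - transitionProb π X t ω) ∂S.P := by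
  have hm : MeasurableSet {ω | transitionProb π X t ω < S.U t ω} :=
    measurableSet_lt 
      ((measurable_transitionProb_prev hX t).mono (S.prev_le t) le_rfl) (S.measurable_U t)
  have h := lintegral_transition hX hZ (φ := fun a => (Set.Ioi a).indicator 1)
    fun a => measurable_one.indicator measurableSet_Ioi
  rw [← lintegral_indicator hm]
  convert h using 3 with ω ω
  · by_cases hω : transitionProb π X t ω < S.U t ω <;> simp [Set.indicator, hω]
  · have h01 := hπ t (fun i => X (i + 1) ω)
    rw [lintegral_indicator_one measurableSet_Ioi, Measure.restrict_apply measurableSet_Ioi]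
    have : Set.Ioi (transitionProb π X t ω) ∩ Set.Ioo (0 : ℝ) 1 =
        Set.Ioo (transitionProb π X t ω) 1 := by
      ext u
      exact ⟨fun hu => ⟨hu.1, hu.2.2⟩, fun hu => ⟨hu.1, h01.1.trans_lt hu.1, hu.2⟩⟩
    rw [this, Real.volume_Ioo]

omit hX in
theorem L_succ_false_iff (t : ℕ) (ω : Ω) : S.L π X (t + 1) ω = false ↔
    S.L π X t ω = false ∧ transitionProb π X (t + 1) ω < S.U (t + 1) ω := by
  simp [L, latent]

omit hX in
theorem L_zero_false_iff (ω : Ω) : S.L π X 0 ω = false ↔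
    transitionProb π X 0 ω < S.U 0 ω := by
  simp [L, latent]

end Adapted

end System

end

end ChangeAccel

namespace ChangeAccel

noncomputable section

/-! ### Likelihood ratios and change of measure -/

namespace ResponseModel

variable {k : ℕ} {Y : Type*} [mY : MeasurableSpace Y] (R : ResponseModel k Y)

theorem measurable_ratio (x : Fin (k + 1)) : Measurable fun y => R.g x y / R.f x y :=
  (R.measurable_g x).div (R.measurable_f x)

theorem measurable_density (x : Fin (k + 1)) (i : Bool) :
    Measurable fun y => ENNReal.ofReal (if i then R.g x y else R.f x y) := by
  cases i
  · simpa using (R.measurable_f x).ennreal_ofReal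
  · simpa using (R.measurable_g x).ennreal_ofReal

instance isProbabilityMeasure_law (x : Fin (k + 1)) (i : Bool) : IsProbabilityMeasure (R.law x i) := by
  constructor
  rw [law, withDensity_apply _ MeasurableSet.univ, Measure.restrict_univ]
  cases i
  · simpa using R.lintegral_f x
  · simpa using R.lintegral_g x

theorem lintegral_law {x : Fin (k + 1)} {i : Bool} {φ : Y → ℝ≥0∞} (hφ : Measurable φ) :
    ∫⁻ y, φ y ∂(R.law x i) =
      ∫⁻ y, ENNReal.ofReal (if i then R.g x y else R.f x y) * φ y ∂(R.μ) := by
  rw [law, lintegral_withDensity_eq_lintegral_mul _ (R.measurable_density x i) hφ]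
  rfl

variable {R}

/-- Almost surely, both densities are positive at the response. -/
theorem Regular.ae_pos (hR : R.Regular) (x : Fin (k + 1)) (i : Bool) :
    ∀ᵐ y ∂(R.law x i), 0 < R.f x y ∧ 0 < R.g x y := by
  rw [law, ae_withDensity_iff (R.measurable_density x i)]
  filter_upwards [hR.pos_iff x] with y hy h
  cases i
  · have : 0 < R.f x y := by simpa using h
    exact ⟨this, hy.mp this⟩
  · have : 0 < R.g x y := by simpa using h
    exact ⟨hy.mpr this, this⟩

/-- The likelihood ratio is the density of the post-change law with respect to the pre-change law. -/
theorem Regular.lintegral_ratio (hR : R.Regular) (x : Fin (k + 1)) {φ : Y → ℝ≥0∞}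
    (hφ : Measurable φ) :
    ∫⁻ y, φ y * ENNReal.ofReal (R.g x y / R.f x y) ∂(R.law x false) =
      ∫⁻ y, φ y ∂(R.law x true) := by
  have hφ' : Measurable fun y => φ y * ENNReal.ofReal (R.g x y / R.f x y) :=
    hφ.mul (R.measurable_ratio x).ennreal_ofReal
  rw [R.lintegral_law hφ, R.lintegral_law hφ']
  refine lintegral_congr_ae ?_
  filter_upwards [hR.pos_iff x] with y hy
  rcases (R.f_nonneg x y).eq_or_lt with h | h
  · have : R.g x y = 0 := by
      by_contra hne
      exact (hy.mpr (lt_of_le_of_ne (R.g_nonneg x y) (Ne.symm hne))).ne h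
    simp [← h, this]
  · simp only [Bool.false_eq_true, if_false, if_true]
    rw [mul_comm (φ y), ← mul_assoc, ← ENNReal.ofReal_mul h.le, mul_div_cancel₀ _ h.ne']

/-- The inverse likelihood ratio has mean one under the post-change law. -/
theorem Regular.lintegral_inv_ratio (hR : R.Regular) (x : Fin (k + 1)) :
    ∫⁻ y, ENNReal.ofReal (R.f x y / R.g x y) ∂(R.law x true) = 1 := by
  have hφ : Measurable fun y => ENNReal.ofReal (R.f x y / R.g x y) :=
    ((R.measurable_f x).div (R.measurable_g x)).ennreal_ofReal
  rw [R.lintegral_law hφ, ← R.lintegral_f x]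
  refine lintegral_congr_ae ?_
  filter_upwards [hR.pos_iff x] with y hy
  rcases (R.g_nonneg x y).eq_or_lt with h | h
  · have : R.f x y = 0 := by
      by_contra hne
      exact (hy.mp (lt_of_le_of_ne (R.f_nonneg x y) (Ne.symm hne))).ne h
    simp [← h, this]
  · simp only [if_true]
    rw [← ENNReal.ofReal_mul h.le, mul_div_cancel₀ _ h.ne']

end ResponseModel

theorem measurableSet_le_of {Ω : Type*} {m : MeasurableSpace Ω} {f g : Ω → ℝ} (hf : Measurable f)
    (hg : Measurable g) : MeasurableSet {ω | f ω ≤ g ω} := measurableSet_le hf hg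

namespace System

variable {k : ℕ} {Y : Type*} [mY : MeasurableSpace Y] {R : ResponseModel k Y}
  {Ω : Type*} [mΩ : MeasurableSpace Ω] (S : System R Ω) (π : Transition k)

open Classical in
/-- The likelihood ratio, based on the responses up to time `t`, of "the change has happened by time
`t`, at a time in `A`" against "no change by time `t`", computed recursively.  For `A = Set.univ` it
is the posterior odds. -/
def ratio (A : Set ℕ) (X : ℕ → Ω → Fin (k + 1)) : ℕ → Ω → ℝ
  | 0 => fun ω => (if 0 ∈ A then transitionProb π X 0 ω else 0) / (1 - transitionProb π X 0 ω)
  | t + 1 => fun ω => (ratio A X t ω + if t + 1 ∈ A then transitionProb π X (t + 1) ω else 0) /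
      (1 - transitionProb π X (t + 1) ω) *
      (R.g (X (t + 1) ω) (S.response π X (t + 1) ω) / R.f (X (t + 1) ω) (S.response π X (t + 1) ω))

/-- The change has happened by time `t`, at a time in `A`. -/
def changedIn (A : Set ℕ) (X : ℕ → Ω → Fin (k + 1)) (t : ℕ) : Set Ω :=
  {ω | ∃ s ∈ A, s ≤ t ∧ S.Θ π X ω = s}

variable {S π} {X : ℕ → Ω → Fin (k + 1)} {A : Set ℕ}

theorem Θ_eq_zero_iff (ω : Ω) : S.Θ π X ω = (0 : ℕ) ↔ S.U 0 ω ≤ transitionProb π X 0 ω := by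
  have h : S.Θ π X ω ≤ (0 : ℕ) ↔ S.L π X 0 ω = true := Θ_le_iff 0 ω
  rw [Nat.cast_zero] at h ⊢
  rw [← nonpos_iff_eq_zero, h]
  simp [L, latent]

theorem Θ_eq_succ_iff (t : ℕ) (ω : Ω) : S.Θ π X ω = (t + 1 : ℕ) ↔
    S.L π X t ω = false ∧ S.U (t + 1) ω ≤ transitionProb π X (t + 1) ω := by
  have h1 : S.Θ π X ω = (t + 1 : ℕ) ↔ S.Θ π X ω ≤ (t + 1 : ℕ) ∧ (t : ℕ∞) < S.Θ π X ω := by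
    rw [le_antisymm_iff, Nat.cast_succ, ENat.add_one_le_iff (ENat.natCast_ne_top t)]
  rw [h1, Θ_le_iff, lt_Θ_iff]
  constructor
  · rintro ⟨h2, h3⟩
    refine ⟨h3, ?_⟩
    by_contra hlt
    rw [(L_succ_false_iff t ω).mpr ⟨h3, not_le.mp hlt⟩] at h2
    simp at h2
  · rintro ⟨h2, h3⟩
    refine ⟨?_, h2⟩
    by_contra hne
    rw [Bool.not_eq_true, L_succ_false_iff] at hne
    exact absurd h3 (not_le.mpr hne.2)

theorem changedIn_univ (t : ℕ) : S.changedIn π Set.univ X t = {ω | S.L π X t ω = true} := by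
  ext ω
  simp only [changedIn, Set.mem_univ, true_and, Set.mem_ofPred_eq, ← Θ_le_iff]
  constructor
  · rintro ⟨s, hs, h⟩
    rw [h]; exact_mod_cast hs
  · intro h
    obtain ⟨s, hs⟩ := ENat.ne_top_iff_exists.mp (ne_top_of_le_ne_top (ENat.natCast_ne_top t) h)
    exact ⟨s, by rw [← hs] at h; exact_mod_cast h, hs.symm⟩

theorem changedIn_zero : S.changedIn π A X 0 =
    {ω | 0 ∈ A ∧ S.U 0 ω ≤ transitionProb π X 0 ω} := by
  ext ω
  simp only [changedIn, Set.mem_ofPred_eq, ← Θ_eq_zero_iff]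
  constructor
  · rintro ⟨s, hs, h0, h⟩
    obtain rfl : s = 0 := by omega
    exact ⟨hs, h⟩
  · exact fun h => ⟨0, h.1, le_rfl, h.2⟩

theorem changedIn_succ (t : ℕ) : S.changedIn π A X (t + 1) = S.changedIn π A X t ∪
    {ω | t + 1 ∈ A ∧ S.L π X t ω = false ∧ S.U (t + 1) ω ≤ transitionProb π X (t + 1) ω} := by
  ext ω
  simp only [changedIn, Set.mem_ofPred_eq, Set.mem_union, ← Θ_eq_succ_iff]
  constructor
  · rintro ⟨s, hs, h0, h⟩
    rcases Nat.lt_or_ge t s with hlt | hle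
    · obtain rfl : s = t + 1 := by omega
      exact Or.inr ⟨hs, h⟩
    · exact Or.inl ⟨s, hs, hle, h⟩
  · rintro (⟨s, hs, h0, h⟩ | h)
    · exact ⟨s, hs, by omega, h⟩
    · exact ⟨t + 1, h.1, le_rfl, h.2⟩

theorem L_of_mem_changedIn {t : ℕ} {ω : Ω} (h : ω ∈ S.changedIn π A X t) :
    S.L π X t ω = true := by
  obtain ⟨s, _, hs, h⟩ := h
  rw [← Θ_le_iff, h]
  exact_mod_cast hs

theorem ratio_nonneg (hπ : ∀ t z, π t z ∈ Set.Ico (0 : ℝ) 1) (t : ℕ) (ω : Ω) :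
    0 ≤ S.ratio π A X t ω := by
  have h := fun t => hπ t (fun i => X (i + 1) ω)
  induction t with
  | zero =>
    refine div_nonneg ?_ (sub_nonneg.mpr (h 0).2.le)
    split_ifs
    exacts [(h 0).1, le_rfl]
  | succ t ih =>
    refine mul_nonneg (div_nonneg (add_nonneg ih ?_) (sub_nonneg.mpr (h (t + 1)).2.le))
      (div_nonneg (R.g_nonneg _ _) (R.f_nonneg _ _))
    split_ifs
    exacts [(h (t + 1)).1, le_rfl]

section

variable (hX : ∀ t, Measurable[S.obs π X t] (X (t + 1)))
include hX

theorem measurable_density_response {w : Fin (k + 1) → Y → ℝ} (hw : ∀ x, Measurable (w x)) (t : ℕ) :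
    Measurable[S.obs π X (t + 1)] fun ω => w (X (t + 1) ω) (S.response π X (t + 1) ω) := by
  have h : Measurable fun q : Fin (k + 1) × Y => w q.1 q.2 := measurable_from_prod_countable_right hw
  exact h.comp ((measurable_X_obs hX (by omega) (by omega)).prodMk
    (measurable_response_obs (by omega) le_rfl))

theorem measurable_ratio_obs (t : ℕ) : Measurable[S.obs π X t] (S.ratio π A X t) := by
  induction t with
  | zero =>
    have h := measurable_transitionProb (π := π) (X := X) (m := S.obs π X 0) (t := 0)
      fun s h1 h2 => by omega
    unfold ratio
    split_ifs
    · exact h.div (measurable_const.sub h)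
    · exact measurable_const.div (measurable_const.sub h)
  | succ t ih =>
    have h1 := ih.mono (obs_mono (Nat.le_succ t)) le_rfl
    have h2 := (measurable_transitionProb_obs hX t).mono (obs_mono (Nat.le_succ t)) le_rfl
    have h3 := measurable_density_response hX R.measurable_ratio t
    unfold ratio
    refine Measurable.mul (Measurable.div (h1.add ?_) (measurable_const.sub h2)) h3
    split_ifs
    exacts [h2, measurable_const]

theorem measurableSet_changedIn_curr (t : ℕ) : MeasurableSet[S.curr t] (S.changedIn π A X t) := by
  have hU : ∀ t, MeasurableSet[S.curr t] {ω | S.U t ω ≤ transitionProb π X t ω} := fun t =>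
    measurableSet_le_of (S.measurable_U_curr t)
      ((measurable_transitionProb_prev hX t).mono (S.prev_le_curr t) le_rfl)
  induction t with
  | zero =>
    rw [changedIn_zero]
    by_cases h : 0 ∈ A
    · simpa [h] using hU 0
    · simp [h]
  | succ t ih =>
    rw [changedIn_succ]
    refine MeasurableSet.union (((S.curr_le_prev (Nat.lt_succ_self t)).trans (S.prev_le_curr _)) _ ih) ?_
    by_cases h : t + 1 ∈ A
    · simp only [h, true_and]
      exact MeasurableSet.inter (S.prev_le_curr _ _ (measurableSet_L_prev hX t false)) (hU (t + 1))
    · simp [h]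

theorem measurableSet_changedIn (t : ℕ) : MeasurableSet (S.changedIn π A X t) :=
  S.curr_le t _ (measurableSet_changedIn_curr hX t)

open Classical in
theorem changeOfMeasure_zero (hπ : ∀ t z, π t z ∈ Set.Ico (0 : ℝ) 1) {Z : Ω → ℝ≥0∞}
    (hZ : Measurable[S.obs π X 0] Z) :
    ∫⁻ ω in S.changedIn π A X 0, Z ω ∂S.P =
      ∫⁻ ω in {ω | S.L π X 0 ω = false}, Z ω * ENNReal.ofReal (S.ratio π A X 0 ω) ∂S.P := by
  have hbot : S.obs π X 0 ≤ S.prev 0 := by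
    refine iSup₂_le fun s hs => ?_
    omega
  have hI : ∀ t z, π t z ∈ Set.Icc (0 : ℝ) 1 := fun t z => ⟨(hπ t z).1, (hπ t z).2.le⟩
  have e : {ω | S.L π X 0 ω = false} = {ω | transitionProb π X 0 ω < S.U 0 ω} := by
    ext ω; exact L_zero_false_iff ω
  rw [e, lintegral_lt_U hX hI, changedIn_zero]
  · by_cases h : 0 ∈ A
    · simp only [h, true_and]
      rw [lintegral_U_le hX hI (hZ.mono hbot le_rfl)]
      refine lintegral_congr fun ω => ?_
      have := hπ 0 (fun i => X (i + 1) ω)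
      have h1 : 0 < 1 - transitionProb π X 0 ω := sub_pos.mpr this.2
      rw [mul_assoc, ← ENNReal.ofReal_mul (ratio_nonneg hπ 0 ω)]
      simp only [ratio, h, if_true]
      rw [div_mul_cancel₀ _ h1.ne']
    · simp [h, ratio]
  · exact (hZ.mul (measurable_ratio_obs hX 0).ennreal_ofReal).mono hbot le_rfl

open Classical in
/-- Change of measure: on the event that the change has happened by time `t`, at a time in `A`, the
responses up to time `t` have the density `ratio A` with respect to their law on the event that no
change has happened by time `t`. -/
theorem changeOfMeasure (hπ : ∀ t z, π t z ∈ Set.Ico (0 : ℝ) 1) (hR : R.Regular) (t : ℕ)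
    {Z : Ω → ℝ≥0∞} (hZ : Measurable[S.obs π X t] Z) :
    ∫⁻ ω in S.changedIn π A X t, Z ω ∂S.P =
      ∫⁻ ω in {ω | S.L π X t ω = false}, Z ω * ENNReal.ofReal (S.ratio π A X t ω) ∂S.P := by
  induction t generalizing Z with
  | zero => exact changeOfMeasure_zero hX hπ hZ
  | succ t ih =>
    have hI : ∀ t z, π t z ∈ Set.Icc (0 : ℝ) 1 := fun t z => ⟨(hπ t z).1, (hπ t z).2.le⟩
    have hL1 := measurableSet_L hX (t + 1) false
    have hC1 := measurableSet_changedIn (A := A) hX (t + 1)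
    have hrho : Measurable fun ω => ENNReal.ofReal (S.ratio π A X (t + 1) ω) :=
      ((measurable_ratio_obs hX (t + 1)).mono (obs_le hX _) le_rfl).ennreal_ofReal
    suffices hset : ∀ B C, MeasurableSet[S.obs π X t] B →
        MeasurableSet[mY.comap (S.response π X (t + 1))] C →
        (S.P.restrict (S.changedIn π A X (t + 1))) (B ∩ C) =
          ((S.P.restrict {ω | S.L π X (t + 1) ω = false}).withDensity
            fun ω => ENNReal.ofReal (S.ratio π A X (t + 1) ω)) (B ∩ C) by
      have hle := obs_le hX (t + 1)
      have h1 : (S.P.restrict (S.changedIn π A X (t + 1))).trim hle =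
          ((S.P.restrict {ω | S.L π X (t + 1) ω = false}).withDensity
            fun ω => ENNReal.ofReal (S.ratio π A X (t + 1) ω)).trim hle := by
        refine @Measure.ext _ (S.obs π X (t + 1)) _ _ fun s hs => ?_
        rw [trim_measurableSet_eq hle hs, trim_measurableSet_eq hle hs]
        rw [obs_succ] at hs
        exact measure_eq_of_sup (mΩ := mΩ) (m₁ := S.obs π X t)
          (m₂ := mY.comap (S.response π X (t + 1))) (obs_le hX t)
          (measurable_response hX (by omega)).comap_le hset hs
      rw [← lintegral_trim hle hZ, h1, lintegral_trim hle hZ,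
        lintegral_withDensity_eq_lintegral_mul _ hrho (hZ.mono hle le_rfl)]
      exact lintegral_congr fun ω => mul_comm _ _
    rintro B _ hB ⟨D, hD, rfl⟩
    have hB0 : MeasurableSet B := obs_le hX t _ hB
    have hBD : MeasurableSet (B ∩ S.response π X (t + 1) ⁻¹' D) :=
      hB0.inter (measurable_response hX (by omega) hD)
    -- the conditional probability, given the past, of a post-change response in `D`
    let G : Ω → ℝ≥0∞ := fun ω => R.law (X (t + 1) ω) true D
    have hG : Measurable[S.obs π X t] G :=
      (Measurable.of_discrete (f := fun x => R.law x true D)).comp (hX t)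
    let q : Ω → ℝ := fun ω => if t + 1 ∈ A then transitionProb π X (t + 1) ω else 0
    have hq : Measurable[S.obs π X t] q := by
      simp only [q]
      split_ifs
      exacts [measurable_transitionProb_obs hX t, measurable_const]
    have hq0 : ∀ ω, 0 ≤ q ω := by
      intro ω; simp only [q]; split_ifs
      exacts [(hπ _ _).1, le_rfl]
    have hone : Measurable[S.obs π X t] (B.indicator (1 : Ω → ℝ≥0∞)) := 
      Measurable.indicator (@measurable_const _ _ _ (S.obs π X t) 1) hB
    have hBG : Measurable[S.obs π X t] fun ω => B.indicator 1 ω * G ω := hone.mul hG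
    have hpc : S.obs π X t ≤ S.prev (t + 1) := obs_le_prev hX t
    have hcu : S.obs π X t ≤ S.curr (t + 1) := obs_le_curr hX t
    have hL0 := measurableSet_L hX t false
    have hL0p := measurableSet_L_prev hX t false
    have hL1c := measurableSet_L_curr hX (t + 1) false
    have hC1c := measurableSet_changedIn_curr (A := A) hX (t + 1)
    have hC0 := measurableSet_changedIn (A := A) hX t
    have hind : ∀ ω, D.indicator (1 : Y → ℝ≥0∞) (S.response π X (t + 1) ω) =
        (S.response π X (t + 1) ⁻¹' D).indicator 1 ω := fun ω => rfl
    -- both sides reduce to the same integral over the event of no change by time `t`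
    trans ∫⁻ ω in {ω | S.L π X t ω = false}, B.indicator 1 ω * G ω *
        (ENNReal.ofReal (S.ratio π A X t ω + q ω)) ∂S.P
    · calc (S.P.restrict (S.changedIn π A X (t + 1))) (B ∩ S.response π X (t + 1) ⁻¹' D)
          = ∫⁻ ω, (S.changedIn π A X (t + 1)).indicator (B.indicator 1) ω *
              D.indicator 1 (S.response π X (t + 1) ω) ∂S.P := by
            rw [← lintegral_indicator_one hBD, ← lintegral_indicator hC1]
            refine lintegral_congr fun ω => ?_
            by_cases h1 : ω ∈ S.changedIn π A X (t + 1) <;> by_cases h2 : ω ∈ B <;>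
              by_cases h3 : S.response π X (t + 1) ω ∈ D <;> simp [Set.indicator, h1, h2, h3]
        _ = ∫⁻ ω, (S.changedIn π A X (t + 1)).indicator (B.indicator 1) ω * G ω ∂S.P := by
            rw [lintegral_response hX (by omega) ((hone.mono hcu le_rfl).indicator hC1c)
              (ψ := fun _ => D.indicator 1) (fun _ => measurable_one.indicator hD) true]
            · refine lintegral_congr fun ω => ?_
              rw [lintegral_indicator_one hD]
            · intro ω h
              exact L_of_mem_changedIn (Set.mem_of_indicator_ne_zero h)
        _ = ∫⁻ ω in S.changedIn π A X (t + 1), B.indicator 1 ω * G ω ∂S.P := by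
            rw [← lintegral_indicator hC1]
            refine lintegral_congr fun ω => ?_
            by_cases h1 : ω ∈ S.changedIn π A X (t + 1) <;> simp [Set.indicator, h1]
        _ = ∫⁻ ω in S.changedIn π A X t, B.indicator 1 ω * G ω ∂S.P +
              ∫⁻ ω in {ω | S.L π X t ω = false}, B.indicator 1 ω * G ω * ENNReal.ofReal (q ω) ∂S.P := by
            rw [changedIn_succ, lintegral_union]
            · congr 1
              by_cases hA : t + 1 ∈ A
              · have hUm : MeasurableSet {ω | S.U (t + 1) ω ≤ transitionProb π X (t + 1) ω} :=
                  measurableSet_le (S.measurable_U _)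
                    ((measurable_transitionProb_prev hX _).mono (S.prev_le _) le_rfl)
                simp only [hA, true_and, q, if_true]
                rw [Set.ofPred_and, Set.inter_comm, ← Measure.restrict_restrict hUm,
                  ← lintegral_indicator hUm]
                rw [← lintegral_indicator hL0]
                have := lintegral_U_le hX hI (t := t + 1)
                  (Z := {ω | S.L π X t ω = false}.indicator fun ω => B.indicator 1 ω * G ω)
                  ((hBG.mono hpc le_rfl).indicator hL0p)
                rw [← lintegral_indicator hUm] at this
                convert this using 1
                · refine lintegral_congr fun ω => ?_
                  by_cases h1 : S.L π X t ω = false <;> by_cases h2 : S.U (t + 1) ω ≤ transitionProb π X (t + 1) ω <;>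
                    simp [Set.indicator, h1, h2]
                · rw [← lintegral_indicator hL0]
                  refine lintegral_congr fun ω => ?_
                  by_cases h1 : S.L π X t ω = false <;> simp [Set.indicator, h1]
              · simp [hA, q]
            · by_cases hA : t + 1 ∈ A
              · simp only [hA, true_and]
                exact hL0.inter (measurableSet_le (S.measurable_U _)
                    ((measurable_transitionProb_prev hX _).mono (S.prev_le _) le_rfl))
              · simp [hA]
            · rw [Set.disjoint_left]
              intro ω h1 h2
              have := L_of_mem_changedIn h1
              rw [h2.2.1] at this
              simp at this
        _ = _ := by
            rw [ih hBG, ← lintegral_add_left]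
            · refine lintegral_congr fun ω => ?_
              rw [ENNReal.ofReal_add (ratio_nonneg hπ t ω) (hq0 ω), mul_add]
            · exact (hBG.mul (measurable_ratio_obs hX t).ennreal_ofReal).mono (obs_le hX t) le_rfl
    · symm
      let c : Ω → ℝ≥0∞ := fun ω => ENNReal.ofReal ((S.ratio π A X t ω + q ω) /
        (1 - transitionProb π X (t + 1) ω))
      have hc : Measurable[S.obs π X t] c :=
        (((measurable_ratio_obs hX t).add hq).div
          (measurable_const.sub (measurable_transitionProb_obs hX t))).ennreal_ofReal
      have hBc : Measurable[S.obs π X t] fun ω => B.indicator 1 ω * c ω := hone.mul hc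
      have hBcG : Measurable[S.obs π X t] fun ω => B.indicator 1 ω * c ω * G ω := hBc.mul hG
      calc ((S.P.restrict {ω | S.L π X (t + 1) ω = false}).withDensity
            fun ω => ENNReal.ofReal (S.ratio π A X (t + 1) ω)) (B ∩ S.response π X (t + 1) ⁻¹' D)
          = ∫⁻ ω, {ω | S.L π X (t + 1) ω = false}.indicator (fun ω => B.indicator 1 ω * c ω) ω *
              (D.indicator 1 (S.response π X (t + 1) ω) *
                ENNReal.ofReal (R.g (X (t + 1) ω) (S.response π X (t + 1) ω) /
                  R.f (X (t + 1) ω) (S.response π X (t + 1) ω))) ∂S.P := by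
            rw [withDensity_apply _ hBD, ← lintegral_indicator hBD, ← lintegral_indicator hL1]
            refine lintegral_congr fun ω => ?_
            have e : ENNReal.ofReal (S.ratio π A X (t + 1) ω) = c ω *
                ENNReal.ofReal (R.g (X (t + 1) ω) (S.response π X (t + 1) ω) /
                  R.f (X (t + 1) ω) (S.response π X (t + 1) ω)) := by
              simp only [c, q]
              rw [← ENNReal.ofReal_mul]
              · rfl
              · exact div_nonneg (add_nonneg (ratio_nonneg hπ t ω) (hq0 ω))
                  (sub_nonneg.mpr (hπ _ _).2.le)
            by_cases h1 : S.L π X (t + 1) ω = false <;> by_cases h2 : ω ∈ B <;>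
              by_cases h3 : S.response π X (t + 1) ω ∈ D <;> simp [Set.indicator, h1, h2, h3, e]
        _ = ∫⁻ ω, {ω | S.L π X (t + 1) ω = false}.indicator (fun ω => B.indicator 1 ω * c ω) ω *
              G ω ∂S.P := by
            rw [lintegral_response hX (by omega) ((hBc.mono hcu le_rfl).indicator hL1c)
              (ψ := fun x y => D.indicator 1 y * ENNReal.ofReal (R.g x y / R.f x y))
              (fun x => (measurable_one.indicator hD).mul (R.measurable_ratio x).ennreal_ofReal) false]
            · refine lintegral_congr fun ω => ?_
              rw [hR.lintegral_ratio _ (measurable_one.indicator hD), lintegral_indicator_one hD]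
            · intro ω h
              exact Set.mem_of_indicator_ne_zero (s := {ω | S.L π X (t + 1) ω = false}) h
        _ = ∫⁻ ω in {ω | transitionProb π X (t + 1) ω < S.U (t + 1) ω},
              {ω | S.L π X t ω = false}.indicator (fun ω => B.indicator 1 ω * c ω * G ω) ω ∂S.P := by
            rw [← lintegral_indicator (measurableSet_lt
              ((measurable_transitionProb_prev hX _).mono (S.prev_le _) le_rfl) (S.measurable_U _))]
            refine lintegral_congr fun ω => ?_
            have h := L_succ_false_iff (S := S) (π := π) (X := X) t ω
            by_cases h1 : S.L π X t ω = false <;>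
              by_cases h2 : transitionProb π X (t + 1) ω < S.U (t + 1) ω <;>
              simp [Set.indicator, h, h1, h2]
        _ = _ := by
            rw [lintegral_lt_U hX hI ((hBcG.mono hpc le_rfl).indicator hL0p),
              ← lintegral_indicator hL0]
            refine lintegral_congr fun ω => ?_
            have h1 : 0 < 1 - transitionProb π X (t + 1) ω := sub_pos.mpr (hπ _ _).2
            have e : c ω * ENNReal.ofReal (1 - transitionProb π X (t + 1) ω) =
                ENNReal.ofReal (S.ratio π A X t ω + q ω) := by
              simp only [c]
              rw [← ENNReal.ofReal_mul, div_mul_cancel₀ _ h1.ne']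
              exact div_nonneg (add_nonneg (ratio_nonneg hπ t ω) (hq0 ω)) h1.le
            by_cases h1 : S.L π X t ω = false
            · simp only [Set.indicator, Set.mem_ofPred_eq, h1, if_true]
              rw [← e]
              ring
            · simp [Set.indicator, h1]

/-- The recursive likelihood ratio is the posterior odds: by the change of measure, the conditional
probability of a change is `ratio` times the conditional probability of no change. -/
theorem odds_ae_eq (hπ : ∀ t z, π t z ∈ Set.Ico (0 : ℝ) 1) (hR : R.Regular) (t : ℕ) :
    S.odds π X t =ᵐ[S.P] S.ratio π Set.univ X t := by
  have hle := obs_le hX t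
  set r := S.ratio π Set.univ X t with hr
  set f1 : Ω → ℝ := {ω | S.L π X t ω = true}.indicator fun _ => 1 with hf1
  set f0 : Ω → ℝ := {ω | S.L π X t ω = false}.indicator fun _ => 1 with hf0
  have hL1 := measurableSet_L hX t true
  have hL0 := measurableSet_L hX t false
  have hrm : Measurable[S.obs π X t] r := measurable_ratio_obs hX t
  have hrm0 : Measurable r := hrm.mono hle le_rfl
  have hr0 : ∀ ω, 0 ≤ r ω := ratio_nonneg hπ t
  have hi1 : Integrable f1 S.P := (integrable_const 1).indicator hL1
  have hi0 : Integrable f0 S.P := (integrable_const 1).indicator hL0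
  have hset : ∀ s, MeasurableSet[S.obs π X t] s →
      ∫⁻ ω in s, ENNReal.ofReal ((r * f0) ω) ∂S.P = ∫⁻ ω in s, ENNReal.ofReal (f1 ω) ∂S.P := by
    intro s hs
    have h := changeOfMeasure (A := Set.univ) hX hπ hR t
      (Z := s.indicator 1) (Measurable.indicator (@measurable_const _ _ _ (S.obs π X t) 1) hs)
    rw [changedIn_univ, ← lintegral_indicator hL1, ← lintegral_indicator hL0] at h
    rw [← lintegral_indicator (hle _ hs), ← lintegral_indicator (hle _ hs)]
    convert h.symm using 1
    · refine lintegral_congr fun ω => ?_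
      by_cases h1 : S.L π X t ω = false <;> by_cases h2 : ω ∈ s <;> simp [Set.indicator, hf0, h1, h2, hr]
    · refine lintegral_congr fun ω => ?_
      by_cases h1 : S.L π X t ω = true <;> by_cases h2 : ω ∈ s <;> simp [Set.indicator, hf1, h1, h2]
  have hrf0 : ∀ ω, 0 ≤ (r * f0) ω := fun ω =>
    mul_nonneg (hr0 ω) (Set.indicator_nonneg (fun _ _ => zero_le_one) ω)
  have hf1nn : ∀ ω, 0 ≤ f1 ω := fun ω => Set.indicator_nonneg (fun _ _ => zero_le_one) ω
  have hirf : Integrable (r * f0) S.P := by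
    refine ⟨(hrm0.mul (measurable_const.indicator hL0)).aestronglyMeasurable, ?_⟩
    rw [hasFiniteIntegral_iff_ofReal (Eventually.of_forall hrf0)]
    have h := hset Set.univ MeasurableSet.univ
    rw [Measure.restrict_univ] at h
    rw [h]
    exact (hasFiniteIntegral_iff_ofReal (Eventually.of_forall hf1nn)).mp hi1.2
  have h1 : S.P[f1 | S.obs π X t] =ᵐ[S.P] S.P[r * f0 | S.obs π X t] := by
    refine ae_eq_condExp_of_forall_setIntegral_eq hle hirf
      (fun s _ _ => integrable_condExp.integrableOn) (fun s hs _ => ?_)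
      stronglyMeasurable_condExp.aestronglyMeasurable
    rw [setIntegral_condExp hle hi1 hs,
      integral_eq_lintegral_of_nonneg_ae (Eventually.of_forall hf1nn) hi1.aestronglyMeasurable.restrict,
      integral_eq_lintegral_of_nonneg_ae (Eventually.of_forall hrf0) hirf.aestronglyMeasurable.restrict,
      hset s hs]
  have h2 : S.P[r * f0 | S.obs π X t] =ᵐ[S.P] r * S.P[f0 | S.obs π X t] :=
    condExp_mul_of_stronglyMeasurable_left hrm.stronglyMeasurable hirf hi0
  have h3 : S.P[f1 | S.obs π X t] + S.P[f0 | S.obs π X t] =ᵐ[S.P] fun _ => 1 := by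
    have h4 : f1 + f0 = fun _ => (1 : ℝ) := by
      ext ω
      by_cases h1 : S.L π X t ω = true <;> simp [hf1, hf0, Set.indicator, h1]
    have h5 := condExp_add hi1 hi0 (S.obs π X t)
    rw [h4, condExp_const hle] at h5
    exact h5.symm
  filter_upwards [h1, h2, h3] with ω e1 e2 e3
  simp only [odds]
  change S.P[f1 | S.obs π X t] ω / S.P[f0 | S.obs π X t] ω = r ω
  rw [Pi.add_apply, e1, e2, Pi.mul_apply] at e3
  rw [e1, e2, Pi.mul_apply]
  have : S.P[f0 | S.obs π X t] ω ≠ 0 := by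
    intro h0
    rw [h0] at e3
    simp at e3
  rw [mul_div_cancel_right₀ _ this]

end

end System

end

end ChangeAccel

namespace ChangeAccel

noncomputable section

/-! ### Sums of log-likelihood ratios -/

namespace ResponseModel

variable {k : ℕ} {Y : Type*} [mY : MeasurableSpace Y] (R : ResponseModel k Y)

/-- The log-likelihood ratio in favour of the latent state `i`. -/
def llr (i : Bool) (x : Fin (k + 1)) (y : Y) : ℝ :=
  if i then Real.log (R.g x y / R.f x y) else Real.log (R.f x y / R.g x y)

/-- The Kullback-Leibler number of the latent state `i`: `I_x` after the change, `J_x` before. -/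
def KL (i : Bool) (x : Fin (k + 1)) : ℝ := if i then R.I x else R.J x

/-- A common bound for the second moments of all log-likelihood ratios. -/
def secondMoment : ℝ := ∑ i : Bool, ∑ x, ∫ y, R.llr i x y ^ 2 ∂(R.law x i)

theorem measurable_llr (i : Bool) (x : Fin (k + 1)) : Measurable (R.llr i x) := by
  cases i
  · exact Real.measurable_log.comp ((R.measurable_f x).div (R.measurable_g x))
  · exact Real.measurable_log.comp ((R.measurable_g x).div (R.measurable_f x))

theorem integrable_law_iff {x : Fin (k + 1)} {i : Bool} {φ : Y → ℝ} :
    Integrable φ (R.law x i) ↔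
      Integrable (fun y => φ y * (if i then R.g x y else R.f x y)) R.μ := by
  rw [law, integrable_withDensity_iff (R.measurable_density x i) (by simp)]
  have : ∀ y, (ENNReal.ofReal (if i then R.g x y else R.f x y)).toReal =
      if i then R.g x y else R.f x y := by
    intro y
    apply ENNReal.toReal_ofReal
    split_ifs
    exacts [R.g_nonneg x y, R.f_nonneg x y]
  simp only [this]

theorem integral_law {x : Fin (k + 1)} {i : Bool} (φ : Y → ℝ) :
    ∫ y, φ y ∂(R.law x i) = ∫ y, φ y * (if i then R.g x y else R.f x y) ∂(R.μ) := by
  rw [law, integral_withDensity_eq_integral_toReal_smul (R.measurable_density x i) (by simp)]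
  refine integral_congr_ae (Eventually.of_forall fun y => ?_)
  have : (ENNReal.ofReal (if i then R.g x y else R.f x y)).toReal =
      if i then R.g x y else R.f x y := by
    apply ENNReal.toReal_ofReal
    split_ifs
    exacts [R.g_nonneg x y, R.f_nonneg x y]
  simp only [this, smul_eq_mul, mul_comm]

theorem integral_llr (i : Bool) (x : Fin (k + 1)) : ∫ y, R.llr i x y ∂(R.law x i) = R.KL i x := by
  rw [integral_law]
  cases i <;> simp [llr, KL, I, J]

theorem secondMoment_nonneg : 0 ≤ R.secondMoment :=
  Finset.sum_nonneg fun _ _ => Finset.sum_nonneg fun _ _ => integral_nonneg fun _ => sq_nonneg _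

theorem integral_llr_sq_le (i : Bool) (x : Fin (k + 1)) :
    ∫ y, R.llr i x y ^ 2 ∂(R.law x i) ≤ R.secondMoment := by
  let F : Bool → Fin (k + 1) → ℝ := fun i x => ∫ y, R.llr i x y ^ 2 ∂(R.law x i)
  have hF : ∀ i x, 0 ≤ F i x := fun i x => integral_nonneg fun _ => sq_nonneg _
  have h1 : F i x ≤ ∑ x, F i x := Finset.single_le_sum (fun x _ => hF i x) (Finset.mem_univ x)
  have h2 : ∑ x, F i x ≤ ∑ i, ∑ x, F i x :=
    Finset.single_le_sum (f := fun i => ∑ x, F i x)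
      (fun i _ => Finset.sum_nonneg fun x _ => hF i x) (Finset.mem_univ i)
  exact h1.trans h2

variable {R}

theorem Regular.integrable_llr_sq (hR : R.Regular) (i : Bool) (x : Fin (k + 1)) :
    Integrable (fun y => R.llr i x y ^ 2) (R.law x i) := by
  rw [integrable_law_iff]
  cases i
  · simpa [llr] using hR.sq_f x
  · simpa [llr] using hR.sq_g x

theorem Regular.memLp_llr (hR : R.Regular) (i : Bool) (x : Fin (k + 1)) :
    MemLp (R.llr i x) 2 (R.law x i) :=
  (memLp_two_iff_integrable_sq (R.measurable_llr i x).aestronglyMeasurable).mpr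
    (hR.integrable_llr_sq i x)

theorem Regular.integrable_llr (hR : R.Regular) (i : Bool) (x : Fin (k + 1)) :
    Integrable (R.llr i x) (R.law x i) :=
  (hR.memLp_llr i x).integrable one_le_two

theorem Regular.KL_pos (hR : R.Regular) (i : Bool) (x : Fin (k + 1)) : 0 < R.KL i x := by
  cases i
  exacts [hR.J_pos x, hR.I_pos x]

theorem Regular.integral_centered_sq_le (hR : R.Regular) (i : Bool) (x : Fin (k + 1)) :
    ∫ y, (R.llr i x y - R.KL i x) ^ 2 ∂(R.law x i) ≤ R.secondMoment := by
  have h : ∀ y, (R.llr i x y - R.KL i x) ^ 2 =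
      R.llr i x y ^ 2 - 2 * R.KL i x * R.llr i x y + R.KL i x ^ 2 := fun y => by ring
  have h1 := hR.integrable_llr_sq i x
  have h2 := (hR.integrable_llr i x).const_mul (2 * R.KL i x)
  have h3 : Integrable (fun y => R.llr i x y ^ 2 - 2 * R.KL i x * R.llr i x y) (R.law x i) :=
    h1.sub h2
  simp only [h]
  rw [integral_add h3 (integrable_const _), integral_sub h1 h2, integral_const_mul, R.integral_llr]
  have := R.integral_llr_sq_le i x
  simp
  nlinarith [sq_nonneg (R.KL i x)]

end ResponseModel

namespace System

variable {k : ℕ} {Y : Type*} [mY : MeasurableSpace Y] {R : ResponseModel k Y}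
  {Ω : Type*} [mΩ : MeasurableSpace Ω] {S : System R Ω} {π : Transition k}
  {X : ℕ → Ω → Fin (k + 1)}

theorem integral_mul_V {t : ℕ} {Z : Ω → ℝ} (hZ : Measurable[S.curr t] Z) {φ : ℝ → ℝ}
    (hφ : Measurable φ) :
    ∫ ω, Z ω * φ (S.V t ω) ∂S.P = (∫ ω, Z ω ∂S.P) * ∫ v in Set.Ioo (0 : ℝ) 1, φ v := by
  rw [← S.law_V t, integral_map (S.measurable_V t).aemeasurable hφ.aestronglyMeasurable]
  have hind : IndepFun Z (fun ω => φ (S.V t ω)) S.P := by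
    rw [IndepFun_iff_Indep]
    exact indep_of_indep_of_le_left (indep_of_indep_of_le_right (S.indep_curr_V t)
      (hφ.comp (comap_measurable (S.V t))).comap_le) hZ.comap_le
  exact hind.integral_fun_mul_eq_mul_integral
    (hZ.mono (S.curr_le t) le_rfl).aestronglyMeasurable
    (hφ.comp (S.measurable_V t)).aestronglyMeasurable

theorem integrable_mul_V {t : ℕ} {Z : Ω → ℝ} (hZ : Measurable[S.curr t] Z) (hZi : Integrable Z S.P)
    {φ : ℝ → ℝ} (hφ : Measurable φ) (hφi : IntegrableOn φ (Set.Ioo (0 : ℝ) 1)) :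
    Integrable (fun ω => Z ω * φ (S.V t ω)) S.P := by
  have hind : IndepFun Z (fun ω => φ (S.V t ω)) S.P := by
    rw [IndepFun_iff_Indep]
    exact indep_of_indep_of_le_left (indep_of_indep_of_le_right (S.indep_curr_V t)
      (hφ.comp (comap_measurable (S.V t))).comap_le) hZ.comap_le
  refine hind.integrable_mul hZi ?_
  rw [IntegrableOn, ← S.law_V t] at hφi
  exact hφi.comp_measurable (S.measurable_V t)

section

variable (hX : ∀ t, Measurable[S.obs π X t] (X (t + 1)))
include hX

theorem integral_response {t : ℕ} (ht : 1 ≤ t) {Z : Ω → ℝ} (hZ : Measurable[S.curr t] Z)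
    (hZi : Integrable Z S.P) {w : Fin (k + 1) → Y → ℝ} (hw : ∀ x, Measurable (w x)) (i : Bool)
    (hwi : ∀ x, Integrable (w x) (R.law x i)) (hi : ∀ ω, Z ω ≠ 0 → S.L π X t ω = i) :
    Integrable (fun ω => Z ω * w (X t ω) (S.response π X t ω)) S.P ∧
    ∫ ω, Z ω * w (X t ω) (S.response π X t ω) ∂S.P =
      ∫ ω, Z ω * (∫ y, w (X t ω) y ∂(R.law (X t ω) i)) ∂S.P := by
  have hXt : Measurable[S.curr t] (X t) :=
    (measurable_X_prev hX ht).mono (S.prev_le_curr t) le_rfl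
  have hZx : ∀ x, Measurable[S.curr t] (({ω | X t ω = x}).indicator Z) := fun x =>
    hZ.indicator (hXt (measurableSet_singleton x))
  have hZxi : ∀ x, Integrable (({ω | X t ω = x}).indicator Z) S.P := fun x =>
    hZi.indicator (measurable_X hX ht (measurableSet_singleton x))
  have e1 : ∀ ω, Z ω * w (X t ω) (S.response π X t ω) =
      ∑ x, ({ω | X t ω = x}).indicator Z ω * w x (S.h x i (S.V t ω)) := by
    intro ω
    rw [Finset.sum_eq_single (X t ω)]
    · by_cases h0 : Z ω = 0
      · simp [h0, Set.indicator]
      · simp [Set.indicator, response, hi ω h0]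
    · intro x _ hx
      simp [Set.indicator, Ne.symm hx]
    · simp
  have e2 : ∀ ω, (Z ω * (∫ y, w (X t ω) y ∂(R.law (X t ω) i))) =
      ∑ x, ({ω | X t ω = x}).indicator Z ω * (∫ y, w x y ∂(R.law x i)) := by
    intro ω
    rw [Finset.sum_eq_single (X t ω)]
    · simp [Set.indicator]
    · intro x _ hx
      simp [Set.indicator, Ne.symm hx]
    · simp
  have hm : ∀ x, Measurable fun v => w x (S.h x i v) := fun x => (hw x).comp (S.measurable_h x i)
  have hmi : ∀ x, IntegrableOn (fun v => w x (S.h x i v)) (Set.Ioo (0 : ℝ) 1) := by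
    intro x
    have := hwi x
    rw [← S.law_h x i] at this
    exact this.comp_measurable (S.measurable_h x i)
  have hint : ∀ x, Integrable (fun ω => ({ω | X t ω = x}).indicator Z ω * w x (S.h x i (S.V t ω))) S.P :=
    fun x => integrable_mul_V (hZx x) (hZxi x) (hm x) (hmi x)
  simp only [e1, e2]
  refine ⟨integrable_finsetSum _ fun x _ => hint x, ?_⟩
  rw [integral_finsetSum _ fun x _ => hint x,
    integral_finsetSum _ fun x _ => (hZxi x).mul_const _]
  refine Finset.sum_congr rfl fun x _ => ?_
  rw [integral_mul_V (hZx x) (hm x), integral_mul_const, ← S.law_h x i,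
    integral_map (S.measurable_h x i).aemeasurable (hw x).aestronglyMeasurable]

omit hX in
theorem ae_response_pos (hR : R.Regular) : ∀ᵐ ω ∂S.P, ∀ t, 1 ≤ t →
    0 < R.f (X t ω) (S.response π X t ω) ∧ 0 < R.g (X t ω) (S.response π X t ω) := by
  have h : ∀ᵐ ω ∂S.P, ∀ (t : ℕ) (x : Fin (k + 1)) (i : Bool),
      0 < R.f x (S.h x i (S.V t ω)) ∧ 0 < R.g x (S.h x i (S.V t ω)) := by
    rw [ae_all_iff]; intro t
    rw [ae_all_iff]; intro x
    rw [ae_all_iff]; intro i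
    have h1 := hR.ae_pos x i
    rw [← S.law_h x i, ← S.law_V t] at h1
    exact ae_of_ae_map (S.measurable_V t).aemeasurable
      (ae_of_ae_map (S.measurable_h x i).aemeasurable h1)
  filter_upwards [h] with ω hω t _
  exact hω t _ _

/-- The log-likelihood ratio of the response at time `t`, counted on the event `C`. -/
theorem integral_indicator_llr {t : ℕ} (ht : 1 ≤ t) {C : Set Ω}
    (hC : MeasurableSet[S.curr t] C) (i : Bool) (hCi : ∀ ω ∈ C, S.L π X t ω = i)
    {w : Fin (k + 1) → Y → ℝ} (hw : ∀ x, Measurable (w x))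
    (hwi : ∀ x, Integrable (w x) (R.law x i)) :
    Integrable (C.indicator fun ω => w (X t ω) (S.response π X t ω)) S.P ∧
    ∫ ω, C.indicator (fun ω => w (X t ω) (S.response π X t ω)) ω ∂S.P =
      ∫ ω in C, (∫ y, w (X t ω) y ∂(R.law (X t ω) i)) ∂S.P := by
  have hC' := S.curr_le t _ hC
  have h := integral_response hX ht (Z := C.indicator fun _ => 1)
    (Measurable.indicator (@measurable_const _ _ _ (S.curr t) 1) hC)
    ((integrable_const 1).indicator hC') hw i hwi
    (fun ω hω => hCi ω (Set.mem_of_indicator_ne_zero hω))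
  have e : ∀ φ : Ω → ℝ, (fun ω => C.indicator (fun _ => (1 : ℝ)) ω * φ ω) = C.indicator φ := by
    intro φ; ext ω; by_cases hω : ω ∈ C <;> simp [hω]
  rw [e fun ω => w (X t ω) (S.response π X t ω),
    e fun ω => ∫ y, w (X t ω) y ∂(R.law (X t ω) i)] at h
  exact ⟨h.1, h.2.trans (integral_indicator hC')⟩

/-- First-passage bound for a run of log-likelihood ratios.  The steps in the run are the times `j`
for which `C j` occurs; each of them adds a log-likelihood ratio and a nonnegative term `q j`, with a
total drift of at least `m` from time `t₀` on, and the sum before each step of the run is at most `b`.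
The overshoot is bounded by `w ≤ c + w² / (4c)`, and the squares are charged to the number of
steps. -/
theorem sum_measure_le_of_drift (hR : R.Regular) (i : Bool) {C : ℕ → Set Ω}
    (hC : ∀ j, MeasurableSet[S.curr j] (C j)) (hC0 : C 0 = ∅)
    (hCi : ∀ j, ∀ ω ∈ C j, S.L π X j ω = i) {q : ℕ → Ω → ℝ} (hq : ∀ j, Measurable (q j))
    {κ : ℝ} (hq0 : ∀ j ω, 0 ≤ q j ω) (hqκ : ∀ j ω, q j ω ≤ κ)
    {E : Set Ω} (hE : MeasurableSet E) (hCE : ∀ j, C j ⊆ E) {b : ℝ} (hb : 0 ≤ b)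
    (hpath : ∀ᵐ ω ∂S.P, ∀ n, ω ∈ C n → ∑ j ∈ Finset.range n,
      (C j).indicator (fun ω => R.llr i (X j ω) (S.response π X j ω) + q j ω) ω ≤ b)
    {m c : ℝ} (hc : 0 < c) (hm : R.secondMoment / (4 * c) < m) {t₀ : ℕ}
    (hdrift : ∀ j ≥ t₀, ∀ ω ∈ C j, m ≤ R.KL i (X j ω) + q j ω) :
    ∑' j, S.P (C j) ≤
      ENNReal.ofReal ((b + c + κ + m * t₀) / (m - R.secondMoment / (4 * c))) * S.P E := by
  set V := R.secondMoment with hV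
  have hV0 : 0 ≤ V := R.secondMoment_nonneg
  have hm0 : 0 < m := lt_of_le_of_lt (by positivity) hm
  have hκ : 0 ≤ κ := (hq0 0 (Classical.choice (nonempty_of_isProbabilityMeasure S.P))).trans (hqκ 0 _)
  have hCm : ∀ j, MeasurableSet (C j) := fun j => S.curr_le j _ (hC j)
  let w : ℕ → Ω → ℝ := fun j ω => R.llr i (X j ω) (S.response π X j ω)
  have hint_w : ∀ j, Integrable ((C j).indicator (w j)) S.P ∧
      ∫ ω, (C j).indicator (w j) ω ∂S.P = ∫ ω in C j, R.KL i (X j ω) ∂S.P := by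
    intro j
    rcases Nat.eq_zero_or_pos j with rfl | hj
    · simp [hC0]
    · have h := integral_indicator_llr hX hj (hC j) i (hCi j) (R.measurable_llr i)
        (hR.integrable_llr i)
      simpa only [R.integral_llr] using h
  have hint_w2 : ∀ j, Integrable ((C j).indicator fun ω => w j ω ^ 2) S.P ∧
      ∫ ω, (C j).indicator (fun ω => w j ω ^ 2) ω ∂S.P ≤ V * S.P.real (C j) := by
    intro j
    rcases Nat.eq_zero_or_pos j with rfl | hj
    · simp [hC0]
    · have h := integral_indicator_llr hX hj (hC j) i (hCi j)
        (w := fun x y => R.llr i x y ^ 2)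
        (fun x => (R.measurable_llr i x).pow_const 2) (hR.integrable_llr_sq i)
      refine ⟨h.1, h.2.le.trans ?_⟩
      have h2 : ∫ ω in C j, (∫ y, R.llr i (X j ω) y ^ 2 ∂(R.law (X j ω) i)) ∂S.P ≤
          ∫ ω in C j, V ∂S.P := by
        refine integral_mono_of_nonneg (Eventually.of_forall fun ω => ?_) (integrable_const _)
          (Eventually.of_forall fun ω => R.integral_llr_sq_le i _)
        exact integral_nonneg fun _ => sq_nonneg _
      refine h2.trans (le_of_eq ?_)
      rw [setIntegral_const, smul_eq_mul, mul_comm]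
  have hint_q : ∀ j, Integrable (q j) S.P := fun j =>
    Integrable.of_bound (hq j).aestronglyMeasurable κ (Eventually.of_forall fun ω => by
      rw [Real.norm_of_nonneg (hq0 j ω)]; exact hqκ j ω)
  have hKLi : ∀ j, IntegrableOn (fun ω => R.KL i (X j ω)) (C j) S.P := by
    intro j
    rcases Nat.eq_zero_or_pos j with rfl | hj
    · simp [hC0]
    · refine Integrable.of_bound ((Measurable.of_discrete (f := R.KL i)).comp
        (measurable_X hX hj)).aestronglyMeasurable (∑ x, |R.KL i x|) (Eventually.of_forall fun ω => ?_)
      exact Finset.single_le_sum (f := fun x => |R.KL i x|) (fun x _ => abs_nonneg _)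
        (Finset.mem_univ (X j ω))
  -- the lower bound for the expected sum
  have hlow : ∀ n, (∑ j ∈ Finset.range n, m * S.P.real (C j)) - m * t₀ * S.P.real E ≤
      ∑ j ∈ Finset.range n, ∫ ω, (C j).indicator (fun ω => w j ω + q j ω) ω ∂S.P := by
    have hterm : ∀ j, ∫ ω, (C j).indicator (fun ω => w j ω + q j ω) ω ∂S.P =
        ∫ ω in C j, (R.KL i (X j ω) + q j ω) ∂S.P := by
      intro j
      rw [integral_add (hKLi j) (hint_q j).integrableOn, ← (hint_w j).2,
        ← integral_indicator (f := q j) (hCm j), ← integral_add (hint_w j).1 ((hint_q j).indicator (hCm j))]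
      exact integral_congr_ae (Eventually.of_forall fun ω => by
        by_cases hω : ω ∈ C j <;> simp [hω])
    have hge : ∀ j ≥ t₀, m * S.P.real (C j) ≤ ∫ ω, (C j).indicator (fun ω => w j ω + q j ω) ω ∂S.P := by
      intro j hj
      rw [hterm j]
      have h := setIntegral_mono_on (μ := S.P) (integrableOn_const (C := m) (by simp)) 
        ((hKLi j).add (hint_q j).integrableOn) (hCm j) (fun ω hω => hdrift j hj ω hω)
      rw [setIntegral_const, smul_eq_mul, mul_comm] at h
      exact h
    have hlt : ∀ j, m * S.P.real (C j) - m * S.P.real E ≤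
        ∫ ω, (C j).indicator (fun ω => w j ω + q j ω) ω ∂S.P := by
      intro j
      have h1 : S.P.real (C j) ≤ S.P.real E := measureReal_mono (hCE j)
      have h2 : 0 ≤ ∫ ω, (C j).indicator (fun ω => w j ω + q j ω) ω ∂S.P := by
        rw [hterm j]
        exact integral_nonneg fun ω => add_nonneg (hR.KL_pos i _).le (hq0 j ω)
      nlinarith
    intro n
    have hcount : ∀ n, (∑ j ∈ Finset.range n, if j < t₀ then m * S.P.real E else 0) ≤
        m * t₀ * S.P.real E := by
      intro n
      rw [← Finset.sum_filter, Finset.sum_const, nsmul_eq_mul]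
      have : ((Finset.range n).filter (· < t₀)).card ≤ t₀ := by
        calc _ ≤ (Finset.range t₀).card := Finset.card_le_card fun j hj => by
              simp at hj ⊢; exact hj.2
          _ = t₀ := Finset.card_range t₀
      have h2 : (((Finset.range n).filter (· < t₀)).card : ℝ) ≤ t₀ := by exact_mod_cast this
      have h3 : 0 ≤ m * S.P.real E := mul_nonneg hm0.le measureReal_nonneg
      nlinarith
    have : ∑ j ∈ Finset.range n, (m * S.P.real (C j) - if j < t₀ then m * S.P.real E else 0) ≤
        ∑ j ∈ Finset.range n, ∫ ω, (C j).indicator (fun ω => w j ω + q j ω) ω ∂S.P := by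
      refine Finset.sum_le_sum fun j _ => ?_
      split_ifs with h
      · exact hlt j
      · rw [sub_zero]; exact hge j (not_lt.mp h)
    rw [Finset.sum_sub_distrib] at this
    linarith [hcount n]
  -- the pathwise upper bound, with the overshoot charged to the squares
  have hup : ∀ᵐ ω ∂S.P, ∀ n, ∑ j ∈ Finset.range n, (C j).indicator (fun ω => w j ω + q j ω) ω ≤
      E.indicator (fun _ => b + c + κ) ω +
        ∑ j ∈ Finset.range n, (1 / (4 * c)) * (C j).indicator (fun ω => w j ω ^ 2) ω := by
    filter_upwards [hpath] with ω hω n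
    have hbE : 0 ≤ E.indicator (fun _ => b + c + κ) ω :=
      Set.indicator_nonneg (fun _ _ => by linarith) ω
    induction n with
    | zero => simpa using hbE
    | succ n ih =>
      rw [Finset.sum_range_succ, Finset.sum_range_succ]
      by_cases hn : ω ∈ C n
      · have h1 := hω n hn
        have h2 : 0 ≤ ∑ j ∈ Finset.range n, (1 / (4 * c)) * (C j).indicator (fun ω => w j ω ^ 2) ω :=
          Finset.sum_nonneg fun j _ => mul_nonneg (by positivity)
            (Set.indicator_nonneg (fun _ _ => sq_nonneg _) ω)
        have h3 : w n ω ≤ c + 1 / (4 * c) * w n ω ^ 2 := by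
          have : c + 1 / (4 * c) * w n ω ^ 2 - w n ω = (w n ω - 2 * c) ^ 2 / (4 * c) := by
            field_simp; ring
          have h4 : 0 ≤ (w n ω - 2 * c) ^ 2 / (4 * c) := by positivity
          linarith
        rw [Set.indicator_of_mem hn, Set.indicator_of_mem hn, Set.indicator_of_mem (hCE n hn)]
        have h5 := hqκ n ω
        simp only [w] at h1 h2 h3 ⊢
        linarith
      · rw [Set.indicator_of_notMem hn, Set.indicator_of_notMem hn]
        simpa using ih
  have hfin : ∀ n, (m - V / (4 * c)) * ∑ j ∈ Finset.range n, S.P.real (C j) ≤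
      (b + c + κ + m * t₀) * S.P.real E := by
    intro n
    have hi : ∀ j, Integrable ((C j).indicator fun ω => w j ω + q j ω) S.P := by
      intro j
      have := (hint_w j).1.add ((hint_q j).indicator (hCm j))
      refine this.congr (Eventually.of_forall fun ω => ?_)
      by_cases hω : ω ∈ C j <;> simp [hω]
    have h1 : ∫ ω, ∑ j ∈ Finset.range n, (C j).indicator (fun ω => w j ω + q j ω) ω ∂S.P ≤
        ∫ ω, (E.indicator (fun _ => b + c + κ) ω +
        ∑ j ∈ Finset.range n, (1 / (4 * c)) * (C j).indicator (fun ω => w j ω ^ 2) ω) ∂S.P := by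
      refine integral_mono_ae (integrable_finsetSum _ fun j _ => hi j)
        (((integrable_const _).indicator hE).add
          (integrable_finsetSum _ fun j _ => (hint_w2 j).1.const_mul _)) ?_
      filter_upwards [hup] with ω hω using hω n
    rw [integral_finsetSum _ fun j _ => hi j, integral_add ((integrable_const _).indicator hE)
      (integrable_finsetSum _ fun j _ => (hint_w2 j).1.const_mul _),
      integral_finsetSum _ fun j _ => (hint_w2 j).1.const_mul _, integral_indicator hE,
      setIntegral_const, smul_eq_mul] at h1
    have h2 : ∑ j ∈ Finset.range n, ∫ ω, 1 / (4 * c) * (C j).indicator (fun ω => w j ω ^ 2) ω ∂S.P ≤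
        ∑ j ∈ Finset.range n, V / (4 * c) * S.P.real (C j) := by
      refine Finset.sum_le_sum fun j _ => ?_
      rw [integral_const_mul]
      have h3 := mul_le_mul_of_nonneg_left (hint_w2 j).2 (show 0 ≤ 1 / (4 * c) by positivity)
      refine h3.trans (le_of_eq (by ring))
    have h4 := hlow n
    rw [← Finset.mul_sum] at h2 h4
    nlinarith
  have hden : 0 < m - V / (4 * c) := sub_pos.mpr hm
  refine ENNReal.tsum_le_of_sum_range_le fun n => ?_
  have h1 : ∑ j ∈ Finset.range n, S.P (C j) = ENNReal.ofReal (∑ j ∈ Finset.range n, S.P.real (C j)) := by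
    rw [ENNReal.ofReal_sum_of_nonneg fun _ _ => measureReal_nonneg]
    simp
  rw [h1, ← ofReal_measureReal (s := E), ← ENNReal.ofReal_mul (by positivity)]
  apply ENNReal.ofReal_le_ofReal
  rw [div_mul_eq_mul_div, le_div_iff₀ hden, mul_comm]
  exact hfin n

/-- The sum of the centered log-likelihood ratios over the steps `j` for which `C j` occurs has a
variance of at most a constant times the expected number of these steps. -/
theorem integral_centered_sum_sq_le (hR : R.Regular) (i : Bool) {C : ℕ → Set Ω}
    (hC : ∀ j, MeasurableSet[S.curr j] (C j)) (hC0 : C 0 = ∅)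
    (hCi : ∀ j, ∀ ω ∈ C j, S.L π X j ω = i) (n : ℕ) :
    MemLp (fun ω => ∑ j ∈ Finset.range n, (C j).indicator
        (fun ω => R.llr i (X j ω) (S.response π X j ω) - R.KL i (X j ω)) ω) 2 S.P ∧
    ∫ ω, (∑ j ∈ Finset.range n, (C j).indicator
        (fun ω => R.llr i (X j ω) (S.response π X j ω) - R.KL i (X j ω)) ω) ^ 2 ∂S.P ≤
      R.secondMoment * ∑ j ∈ Finset.range n, S.P.real (C j) := by
  have hCm : ∀ j, MeasurableSet (C j) := fun j => S.curr_le j _ (hC j)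
  let w : Fin (k + 1) → Y → ℝ := fun x y => R.llr i x y - R.KL i x
  have hw : ∀ x, Measurable (w x) := fun x => (R.measurable_llr i x).sub_const _
  have hwL : ∀ x, MemLp (w x) 2 (R.law x i) := fun x => (hR.memLp_llr i x).sub (memLp_const _)
  have hw0 : ∀ x, ∫ y, w x y ∂(R.law x i) = 0 := by
    intro x
    simp only [w]
    rw [integral_sub (hR.integrable_llr i x) (integrable_const _), R.integral_llr]
    simp
  let D : ℕ → Ω → ℝ := fun j => (C j).indicator fun ω => w (X j ω) (S.response π X j ω)
  let M : ℕ → Ω → ℝ := fun n ω => ∑ j ∈ Finset.range n, D j ω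
  have hD : ∀ j, Measurable[S.prev (j + 1)] (D j) := by
    intro j
    rcases Nat.eq_zero_or_pos j with rfl | hj
    · simp only [D, hC0, Set.indicator_empty]; exact measurable_const
    · obtain ⟨r, rfl⟩ := Nat.exists_eq_add_of_le' hj
      exact Measurable.indicator ((measurable_density_response hX hw r).mono (obs_le_prev hX _) le_rfl)
        (S.curr_le_prev (Nat.lt_succ_self _) _ (hC _))
  have hM : ∀ n, Measurable[S.curr n] (M n) := fun n =>
    Finset.measurable_fun_sum _ fun j hj => (hD j).mono
      ((S.prev_mono (Finset.mem_range.mp hj)).trans (S.prev_le_curr n)) le_rfl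
  have hDsq : ∀ j, Integrable (fun ω => D j ω ^ 2) S.P ∧
      ∫ ω, D j ω ^ 2 ∂S.P ≤ R.secondMoment * S.P.real (C j) := by
    intro j
    rcases Nat.eq_zero_or_pos j with rfl | hj
    · simp [D, hC0]
    · have h := integral_indicator_llr hX hj (hC j) i (hCi j) (w := fun x y => w x y ^ 2)
        (fun x => (hw x).pow_const 2) (fun x => (hwL x).integrable_sq)
      have e : (fun ω => D j ω ^ 2) = (C j).indicator fun ω => w (X j ω) (S.response π X j ω) ^ 2 := by
        ext ω; by_cases hω : ω ∈ C j <;> simp [D, hω]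
      rw [e]
      refine ⟨h.1, h.2.le.trans ?_⟩
      have h2 : ∫ ω in C j, (∫ y, w (X j ω) y ^ 2 ∂(R.law (X j ω) i)) ∂S.P ≤
          ∫ ω in C j, R.secondMoment ∂S.P := by
        refine integral_mono_of_nonneg (Eventually.of_forall fun ω => ?_) (integrable_const _)
          (Eventually.of_forall fun ω => hR.integral_centered_sq_le i _)
        exact integral_nonneg fun _ => sq_nonneg _
      refine h2.trans (le_of_eq ?_)
      rw [setIntegral_const, smul_eq_mul, mul_comm]
  have hDL : ∀ j, MemLp (D j) 2 S.P := fun j =>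
    (memLp_two_iff_integrable_sq ((hD j).mono (S.prev_le _) le_rfl).aestronglyMeasurable).mpr (hDsq j).1
  have hML : ∀ n, MemLp (M n) 2 S.P := fun n => memLp_finsetSum _ fun j _ => hDL j
  -- each summand has conditional mean zero given the earlier ones
  have hcross : ∀ j, ∫ ω, M j ω * D j ω ∂S.P = 0 := by
    intro j
    rcases Nat.eq_zero_or_pos j with rfl | hj
    · simp [M]
    · have h := integral_response hX hj (Z := (C j).indicator (M j)) ((hM j).indicator (hC j))
        (((hML j).integrable one_le_two).indicator (hCm j)) hw i (fun x => (hwL x).integrable one_le_two)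
        (fun ω hω => hCi j ω (Set.mem_of_indicator_ne_zero hω))
      simp only [hw0, mul_zero, integral_zero] at h
      rw [← h.2]
      refine integral_congr_ae (Eventually.of_forall fun ω => ?_)
      by_cases hω : ω ∈ C j <;> simp [D, hω]
  refine ⟨hML n, ?_⟩
  change ∫ ω, M n ω ^ 2 ∂S.P ≤ _
  induction n with
  | zero => simp [M]
  | succ n ih =>
    have e : ∀ ω, M (n + 1) ω ^ 2 = M n ω ^ 2 + 2 * (M n ω * D n ω) + D n ω ^ 2 := by
      intro ω
      simp only [M, Finset.sum_range_succ]
      ring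
    have hi1 : Integrable (fun ω => M n ω ^ 2) S.P := (hML n).integrable_sq
    have hi2 : Integrable (fun ω => 2 * (M n ω * D n ω)) S.P :=
      ((hML n).integrable_mul (hDL n)).const_mul 2
    have hi12 : Integrable (fun ω => M n ω ^ 2 + 2 * (M n ω * D n ω)) S.P := hi1.add hi2
    simp only [e]
    rw [integral_add hi12 (hDsq n).1, integral_add hi1 hi2, integral_const_mul, hcross,
      Finset.sum_range_succ, mul_add]
    linarith [(hDsq n).2]

end

end System

end

end ChangeAccel

namespace ChangeAccel

noncomputable section

/-! ### The lower bound -/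

theorem measurableSet_finset_biUnion {Ω : Type*} {m : MeasurableSpace Ω} {A : ℕ → Set Ω} (s : Finset ℕ)
    (h : ∀ t ∈ s, MeasurableSet (A t)) : MeasurableSet (⋃ t ∈ s, A t) :=
  Finset.measurableSet_biUnion s h

theorem toENNReal_eq_tsum (T : ℕ∞) :
    (T : ℝ≥0∞) = ∑' j : ℕ, {S : ℕ∞ | (j : ℕ∞) < S}.indicator (1 : ℕ∞ → ℝ≥0∞) T := by
  induction T using ENat.recTopCoe with
  | top =>
    have : ∀ j : ℕ, {S : ℕ∞ | (j : ℕ∞) < S}.indicator (1 : ℕ∞ → ℝ≥0∞) ⊤ = 1 := by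
      intro j
      simp
    simp only [this]
    rw [ENNReal.tsum_const_eq_top_of_ne_zero one_ne_zero]
    rfl
  | coe n =>
    rw [tsum_eq_sum (s := Finset.range n)]
    · have : ∀ j ∈ Finset.range n, {S : ℕ∞ | (j : ℕ∞) < S}.indicator (1 : ℕ∞ → ℝ≥0∞) n = 1 := by
        intro j hj
        have : (j : ℕ∞) < n := by exact_mod_cast Finset.mem_range.mp hj
        simp [this]
      rw [Finset.sum_congr rfl this]
      simp
    · intro j hj
      have : ¬ (j : ℕ∞) < n := by
        rw [Finset.mem_range] at hj
        exact_mod_cast hj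
      simp [this]

theorem lintegral_eq_tsum {Ω : Type*} [MeasurableSpace Ω] (P : Measure Ω) {T : Ω → ℕ∞}
    (hT : ∀ j : ℕ, MeasurableSet {ω | (j : ℕ∞) < T ω}) :
    ∫⁻ ω, (T ω : ℝ≥0∞) ∂P = ∑' j : ℕ, P {ω | (j : ℕ∞) < T ω} := by
  have h : ∀ ω, (T ω : ℝ≥0∞) = ∑' j : ℕ, {ω | (j : ℕ∞) < T ω}.indicator 1 ω :=
    fun ω => toENNReal_eq_tsum (T ω)
  simp only [h]
  rw [lintegral_tsum fun j => (measurable_one.indicator (hT j)).aemeasurable]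
  exact tsum_congr fun j => lintegral_indicator_one (hT j)

theorem latent_mono_left {p p' u : ℕ → ℝ} (h : ∀ t, p t ≤ p' t) (t : ℕ)
    (ht : latent p u t = true) : latent p' u t = true := by
  induction t with
  | zero =>
    simp only [latent, decide_eq_true_eq] at ht ⊢
    exact ht.trans (h 0)
  | succ t ih =>
    simp only [latent, Bool.or_eq_true, decide_eq_true_eq] at ht ⊢
    exact ht.imp ih fun h' => h'.trans (h (t + 1))

/-- With the same noise, larger transition probabilities bring the change earlier. -/
theorem changePoint_anti {p p' : ℕ → ℝ} (u : ℕ → ℝ) (h : ∀ t, p t ≤ p' t) :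
    changePoint p' u ≤ changePoint p u := by
  refine ENat.forall_natCast_le_iff_le.mp fun n hn => ?_
  by_contra hlt
  have h1 : changePoint p u < n := not_le.mp hlt
  obtain ⟨m, hm⟩ := ENat.ne_top_iff_exists.mp h1.ne_top
  have h2 : changePoint p' u ≤ m :=
    (changePoint_le_iff _ _ m).mpr (latent_mono_left h m ((changePoint_le_iff _ _ m).mp hm.symm.le))
  exact hlt (hn.trans (h2.trans hm.le))

theorem le_maxTransition {k : ℕ} (π : Transition k) (t : ℕ) (z : Fin t → Fin (k + 1)) :
    π t z ≤ maxTransition π t :=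
  le_ciSup (f := fun z => π t z) (Set.finite_range _).bddAbove z

/-- A geometric tail and a bound for the probability of an event combine, through
`min a b ≤ √(a b)`, to a bound for an expectation on this event. -/
theorem tsum_le_of_geometric {a : ℕ → ℝ≥0∞} {α ζ : ℝ} (hα : 0 ≤ α) (hζ : 0 < ζ) (hζ1 : ζ ≤ 1)
    (h1 : ∀ j, a j ≤ ENNReal.ofReal α) (h2 : ∀ j, a j ≤ ENNReal.ofReal ((1 - ζ) ^ j)) :
    ∑' j, a j ≤ ENNReal.ofReal (2 * √α / ζ) := by
  have h0 : 0 ≤ 1 - ζ := by linarith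
  have hr : √(1 - ζ) ≤ 1 - ζ / 2 := Real.sqrt_le_iff.mpr ⟨by linarith, by nlinarith⟩
  have hr0 : 0 ≤ √(1 - ζ) := Real.sqrt_nonneg _
  have hr1 : √(1 - ζ) < 1 := by linarith
  have h3 : ∀ j, a j ≤ ENNReal.ofReal (√α * √(1 - ζ) ^ j) := by
    intro j
    refine (le_min (h1 j) (h2 j)).trans ?_
    rw [← ENNReal.ofReal_min]
    apply ENNReal.ofReal_le_ofReal
    have hp : 0 ≤ √(1 - ζ) ^ j := by positivity
    have e : (1 - ζ) ^ j = (√(1 - ζ) ^ j) ^ 2 := by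
      rw [← pow_mul, mul_comm j 2, pow_mul, Real.sq_sqrt h0]
    rcases le_total (√α) (√(1 - ζ) ^ j) with h | h
    · refine (min_le_left _ _).trans ?_
      calc α = √α * √α := (Real.mul_self_sqrt hα).symm
        _ ≤ _ := mul_le_mul_of_nonneg_left h (Real.sqrt_nonneg _)
    · refine (min_le_right _ _).trans ?_
      rw [e, sq]
      exact mul_le_mul_of_nonneg_right h hp
  have hs : HasSum (fun j => √α * √(1 - ζ) ^ j) (√α * (1 - √(1 - ζ))⁻¹) :=
    (hasSum_geometric_of_lt_one hr0 hr1).mul_left _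
  refine (ENNReal.tsum_le_tsum h3).trans ?_
  rw [← ENNReal.ofReal_tsum_of_nonneg (fun j => by positivity) hs.summable, hs.tsum_eq]
  apply ENNReal.ofReal_le_ofReal
  rw [mul_comm 2, mul_div_assoc]
  refine mul_le_mul_of_nonneg_left ?_ (Real.sqrt_nonneg _)
  rw [inv_eq_one_div, div_le_div_iff₀ (by linarith) hζ]
  linarith

namespace System

variable {k : ℕ} {Y : Type*} [mY : MeasurableSpace Y] {R : ResponseModel k Y}
  {Ω : Type*} [mΩ : MeasurableSpace Ω] {S : System R Ω} {π : Transition k}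
  {X : ℕ → Ω → Fin (k + 1)}

/-- The term `|log (1 - Π_t)|` by which the passage of time alone, without a change, raises the log
posterior odds. -/
def hazard (π : Transition k) (X : ℕ → Ω → Fin (k + 1)) (t : ℕ) (ω : Ω) : ℝ :=
  -Real.log (1 - transitionProb π X t ω)

omit mΩ in
theorem exp_hazard (hπ : ∀ t z, π t z ∈ Set.Ico (0 : ℝ) 1) (t : ℕ) (ω : Ω) :
    Real.exp (hazard π X t ω) = (1 - transitionProb π X t ω)⁻¹ := by
  have h : 0 < 1 - transitionProb π X t ω := sub_pos.mpr (hπ _ _).2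
  rw [hazard, Real.exp_neg, Real.exp_log h]

omit mΩ in
theorem hazard_nonneg (hπ : ∀ t z, π t z ∈ Set.Ico (0 : ℝ) 1) (t : ℕ) (ω : Ω) :
    0 ≤ hazard π X t ω := by
  have h := hπ t (fun i => X (i + 1) ω)
  rw [hazard, neg_nonneg]
  exact Real.log_nonpos (sub_nonneg.mpr h.2.le) (by rw [transitionProb]; linarith [h.1])

omit mΩ in
theorem hazard_le {δ : ℝ} (hδ : 0 < δ) (hπδ : ∀ t z, π t z ≤ 1 - δ) (t : ℕ) (ω : Ω) :
    hazard π X t ω ≤ -Real.log δ := by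
  rw [hazard, neg_le_neg_iff]
  exact Real.log_le_log hδ (by linarith [hπδ t (fun i => X (i + 1) ω), transitionProb.eq_1 π X t ω])

theorem exp_llr {x : Fin (k + 1)} {y : Y} (h : 0 < R.f x y ∧ 0 < R.g x y) :
    Real.exp (R.llr true x y) = R.g x y / R.f x y := by
  simp only [ResponseModel.llr, if_true]
  exact Real.exp_log (div_pos h.2 h.1)

theorem ratio_singleton_of_lt {s t : ℕ} (h : t < s) (ω : Ω) : S.ratio π {s} X t ω = 0 := by
  induction t with
  | zero => simp [ratio, h.ne]
  | succ t ih => simp [ratio, h.ne, ih (by omega)]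

/-- The likelihood ratio of a change at time `s` is at most the product of the factors collected
since time `s`. -/
theorem ratio_singleton_le (hπ : ∀ t z, π t z ∈ Set.Ico (0 : ℝ) 1) {ω : Ω}
    (hω : ∀ t, 1 ≤ t →
      0 < R.f (X t ω) (S.response π X t ω) ∧ 0 < R.g (X t ω) (S.response π X t ω))
    {s t : ℕ} (hst : s ≤ t) :
    S.ratio π {s} X t ω ≤ Real.exp (∑ j ∈ Finset.Icc s t,
      ((if 1 ≤ j then R.llr true (X j ω) (S.response π X j ω) else 0) + hazard π X j ω)) := by
  have h01 := fun t => hπ t (fun i => X (i + 1) ω)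
  have hstep : ∀ t (r q : ℝ), 0 ≤ r → r ≤ q →
      r / (1 - transitionProb π X (t + 1) ω) *
        (R.g (X (t + 1) ω) (S.response π X (t + 1) ω) / R.f (X (t + 1) ω) (S.response π X (t + 1) ω)) ≤
      q * Real.exp ((if 1 ≤ t + 1 then R.llr true (X (t + 1) ω) (S.response π X (t + 1) ω) else 0) +
        hazard π X (t + 1) ω) := by
    intro t r q hr hrq
    rw [if_pos (by omega), Real.exp_add, exp_hazard hπ, exp_llr (hω _ (by omega)), div_eq_mul_inv,
      mul_assoc, mul_comm (1 - _)⁻¹]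
    have h1 : 0 ≤ (1 - transitionProb π X (t + 1) ω)⁻¹ := inv_nonneg.mpr (sub_nonneg.mpr (h01 _).2.le)
    have h2 := div_nonneg (hω (t + 1) (by omega)).2.le (hω (t + 1) (by omega)).1.le
    exact mul_le_mul_of_nonneg_right hrq (mul_nonneg h2 h1)
  induction t, hst using Nat.le_induction with
  | base =>
    rw [Finset.Icc_self, Finset.sum_singleton]
    rcases s with _ | s
    · simp only [ratio, Set.mem_singleton_iff, if_true]
      rw [if_neg (by omega), zero_add, exp_hazard hπ, div_eq_mul_inv]
      exact mul_le_of_le_one_left (inv_nonneg.mpr (sub_nonneg.mpr (h01 0).2.le)) (h01 0).2.le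
    · have h := hstep s _ 1 (h01 (s + 1)).1 (h01 (s + 1)).2.le
      rw [one_mul] at h
      simpa [ratio, ratio_singleton_of_lt (Nat.lt_succ_self s), transitionProb] using h
  | succ t hst ih =>
    rw [Finset.sum_Icc_succ_top (by omega), Real.exp_add]
    have h := hstep t _ _ (ratio_nonneg (A := {s}) hπ t ω) ih
    have hne : t + 1 ≠ s := by omega
    simpa [ratio, hne] using h

section

variable (hX : ∀ t, Measurable[S.obs π X t] (X (t + 1)))
include hX

theorem measurableSet_Θ_eq {s t : ℕ} (h : s ≤ t) : MeasurableSet[S.curr t] {ω | S.Θ π X ω = s} := by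
  have e : {ω | S.Θ π X ω = s} = S.changedIn π {s} X t := by
    ext ω
    simp only [changedIn, Set.mem_singleton_iff, Set.mem_ofPred_eq]
    exact ⟨fun h' => ⟨s, rfl, h, h'⟩, fun ⟨r, hr, _, h'⟩ => hr ▸ h'⟩
  rw [e]
  exact measurableSet_changedIn_curr hX t

/-- The probability of an alarm less than `n` time units after a change at time `s`. If the
likelihood ratio of this change is at most `exp c` at the time of the alarm, then the change of measure
leads to a false alarm at this time. Otherwise, the sum of the centered log-likelihood ratios exceeds
the difference between `c` and a bound for the total drift, and Chebyshev's inequality applies. -/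
theorem measure_window_le (hπ : ∀ t z, π t z ∈ Set.Ico (0 : ℝ) 1) (hR : R.Regular) {δ : ℝ}
    (hδ : 0 < δ) (hπδ : ∀ t z, π t z ≤ 1 - δ) {T : Ω → ℕ∞}
    (hT : ∀ t : ℕ, MeasurableSet[S.obs π X t] {ω | T ω = t})
    {Dm : ℝ} (hDm : ∀ x, R.I x ≤ Dm) {t₀ : ℕ} (ht₀ : 1 ≤ t₀)
    (hdrift : ∀ j ≥ t₀, ∀ ω, R.I (X j ω) + hazard π X j ω ≤ Dm)
    {n : ℕ} {c : ℝ} (hc : n * Dm + t₀ * (-Real.log δ) < c) (s : ℕ) :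
    S.P {ω | S.Θ π X ω = s ∧ (s : ℕ∞) ≤ T ω ∧ T ω < (s + n : ℕ)} ≤
      ENNReal.ofReal (Real.exp c) * ∑ i ∈ Finset.range n,
        S.P {ω | T ω = (s + i : ℕ) ∧ T ω < S.Θ π X ω} +
      ENNReal.ofReal (R.secondMoment * n / (c - (n * Dm + t₀ * (-Real.log δ))) ^ 2) *
        S.P {ω | S.Θ π X ω = s} := by
  set κ := -Real.log δ with hκdef
  set a := n * Dm + t₀ * κ with ha
  have hκ : 0 ≤ κ := neg_nonneg.mpr (Real.log_nonpos hδ.le (by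
    have h1 := hπδ 0 (fun i => i.elim0)
    have h2 := (hπ 0 (fun i => i.elim0)).1
    linarith))
  have hDm0 : 0 ≤ Dm := (hR.I_pos 0).le.trans (hDm 0)
  have hTle : ∀ j, MeasurableSet[S.curr j] {ω | (j : ℕ∞) ≤ T ω} := by
    intro j
    have e : {ω | (j : ℕ∞) ≤ T ω}ᶜ = ⋃ t ∈ Finset.range j, {ω | T ω = (t : ℕ)} := by
      ext ω
      simp only [Set.mem_compl_iff, Set.mem_ofPred_eq, not_le, Set.mem_iUnion, Finset.mem_range,
        exists_prop]
      constructor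
      · intro h
        obtain ⟨m, hm⟩ := ENat.ne_top_iff_exists.mp h.ne_top
        exact ⟨m, by rw [← hm] at h; exact_mod_cast h, hm.symm⟩
      · rintro ⟨t, ht, h⟩
        rw [h]; exact_mod_cast ht
    refine MeasurableSet.of_compl ?_
    rw [e]
    refine measurableSet_finset_biUnion _ fun t ht => ?_
    have h1 : S.obs π X t ≤ S.curr j := (obs_le_prev hX t).trans
      ((S.prev_mono (Finset.mem_range.mp ht)).trans (S.prev_le_curr j))
    exact h1 _ (hT t)
  -- time `j` is a post-change step, before or at the alarm; there is no response at time `0`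
  let C : ℕ → Set Ω := fun j =>
    if s ≤ j ∧ j < s + n ∧ 1 ≤ j then {ω | S.Θ π X ω = s} ∩ {ω | (j : ℕ∞) ≤ T ω} else ∅
  have hC : ∀ j, MeasurableSet[S.curr j] (C j) := by
    intro j
    simp only [C]
    split_ifs with h
    · exact MeasurableSet.inter (measurableSet_Θ_eq hX h.1) (hTle j)
    · exact @MeasurableSet.empty _ (S.curr j)
  have hC0 : C 0 = ∅ := by simp [C]
  have hCi : ∀ j, ∀ ω ∈ C j, S.L π X j ω = true := by
    intro j ω hω
    simp only [C] at hω
    split_ifs at hω with h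
    · have h1 : S.Θ π X ω = s := hω.1
      rw [← Θ_le_iff, h1]
      exact_mod_cast h.1
    · exact hω.elim
  let M : Ω → ℝ := fun ω => ∑ j ∈ Finset.range (s + n), (C j).indicator
    (fun ω => R.llr true (X j ω) (S.response π X j ω) - R.KL true (X j ω)) ω
  obtain ⟨hML, hM2⟩ : MemLp M 2 S.P ∧ ∫ ω, M ω ^ 2 ∂S.P ≤
      R.secondMoment * ∑ j ∈ Finset.range (s + n), S.P.real (C j) :=
    integral_centered_sum_sq_le hX hR true hC hC0 hCi (s + n)
  have hΘm : MeasurableSet {ω | S.Θ π X ω = s} := S.curr_le s _ (measurableSet_Θ_eq hX le_rfl)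
  -- the number of steps is at most `n`
  have hCsum : ∑ j ∈ Finset.range (s + n), S.P.real (C j) ≤ n * S.P.real {ω | S.Θ π X ω = s} := by
    rw [← Finset.sum_subset (s₁ := Finset.Ico s (s + n))]
    · refine (Finset.sum_le_card_nsmul _ _ (S.P.real {ω | S.Θ π X ω = s}) fun j hj => ?_).trans ?_
      · refine measureReal_mono ?_
        simp only [C]
        split_ifs
        exacts [Set.inter_subset_left, Set.empty_subset _]
      · simp
    · intro j hj
      rw [Finset.mem_Ico] at hj
      exact Finset.mem_range.mpr hj.2
    · intro j hj hj'
      rw [Finset.mem_range] at hj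
      rw [Finset.mem_Ico] at hj'
      have : ¬ (s ≤ j ∧ j < s + n ∧ 1 ≤ j) := fun h => hj' ⟨h.1, h.2.1⟩
      simp [C, this]
  -- the centered log-likelihood ratios have a large sum
  let F : Set Ω := {ω | (c - a) ^ 2 ≤ M ω ^ 2}
  have hca : 0 < c - a := sub_pos.mpr hc
  have hF : S.P F ≤ ENNReal.ofReal (R.secondMoment * n / (c - a) ^ 2) * S.P {ω | S.Θ π X ω = s} := by
    have h1 := mul_meas_ge_le_integral_of_nonneg (μ := S.P) (f := fun ω => M ω ^ 2)
      (Eventually.of_forall fun ω => sq_nonneg _) hML.integrable_sq ((c - a) ^ 2)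
    rw [← ofReal_measureReal (s := F), ← ofReal_measureReal (s := {ω | S.Θ π X ω = s}),
      ← ENNReal.ofReal_mul (div_nonneg (mul_nonneg R.secondMoment_nonneg (Nat.cast_nonneg n)) (sq_nonneg _))]
    apply ENNReal.ofReal_le_ofReal
    rw [div_mul_eq_mul_div, le_div_iff₀ (by positivity), mul_comm]
    refine h1.trans (hM2.trans ?_)
    rw [mul_assoc]
    exact mul_le_mul_of_nonneg_left hCsum R.secondMoment_nonneg
  -- an alarm at time `s + i` with a small likelihood ratio
  let B : ℕ → Set Ω := fun i =>
    {ω | S.Θ π X ω = s ∧ T ω = (s + i : ℕ) ∧ S.ratio π {s} X (s + i) ω ≤ Real.exp c}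
  have hB : ∀ i, S.P (B i) ≤ ENNReal.ofReal (Real.exp c) *
      S.P {ω | T ω = (s + i : ℕ) ∧ T ω < S.Θ π X ω} := by
    intro i
    let G : Set Ω := {ω | T ω = (s + i : ℕ)} ∩ {ω | S.ratio π {s} X (s + i) ω ≤ Real.exp c}
    have hG : MeasurableSet[S.obs π X (s + i)] G :=
      MeasurableSet.inter (hT _) (measurableSet_le_of (measurable_ratio_obs hX _)
        (@measurable_const _ _ _ (S.obs π X (s + i)) _))
    have hG' := obs_le hX _ _ hG
    have h := changeOfMeasure (A := {s}) hX hπ hR (s + i) (Z := G.indicator 1)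
      (Measurable.indicator (@measurable_const _ _ _ (S.obs π X (s + i)) 1) hG)
    have hL0 := measurableSet_L hX (s + i) false
    have e1 : B i = G ∩ S.changedIn π {s} X (s + i) := by
      ext ω
      simp only [B, G, changedIn, Set.mem_singleton_iff, Set.mem_inter_iff, Set.mem_ofPred_eq]
      constructor
      · rintro ⟨h1, h2, h3⟩
        exact ⟨⟨h2, h3⟩, s, rfl, by omega, h1⟩
      · rintro ⟨⟨h2, h3⟩, r, rfl, _, h1⟩
        exact ⟨h1, h2, h3⟩
    rw [lintegral_indicator_one hG', Measure.restrict_apply hG', ← e1] at h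
    rw [h]
    have hTm : MeasurableSet {ω | T ω = (s + i : ℕ)} := obs_le hX _ _ (hT (s + i))
    have e2 : {ω | T ω = (s + i : ℕ) ∧ T ω < S.Θ π X ω} =
        {ω | T ω = (s + i : ℕ)} ∩ {ω | S.L π X (s + i) ω = false} := by
      ext ω
      simp only [Set.mem_inter_iff, Set.mem_ofPred_eq, ← lt_Θ_iff]
      exact and_congr_right fun h => by rw [h]
    rw [e2, ← Measure.restrict_apply hTm, ← lintegral_indicator_one hTm, ← lintegral_const_mul' _ _ (by simp)]
    refine lintegral_mono fun ω => ?_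
    by_cases hω : ω ∈ G
    · rw [Set.indicator_of_mem hω, Set.indicator_of_mem hω.1]
      simp only [Pi.one_apply, one_mul, mul_one]
      exact ENNReal.ofReal_le_ofReal hω.2
    · rw [Set.indicator_of_notMem hω]
      simp
  have hcover : {ω | S.Θ π X ω = s ∧ (s : ℕ∞) ≤ T ω ∧ T ω < (s + n : ℕ)} ≤ᵐ[S.P]
      ((⋃ i ∈ Finset.range n, B i) ∪ F : Set Ω) := by
    filter_upwards [ae_response_pos (S := S) (π := π) (X := X) hR] with ω hω hW
    obtain ⟨h1, h2, h3⟩ := hW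
    obtain ⟨t, ht⟩ := ENat.ne_top_iff_exists.mp h3.ne_top
    rw [← ht] at h2 h3
    have h2' : s ≤ t := by exact_mod_cast h2
    have h3' : t < s + n := by exact_mod_cast h3
    obtain ⟨i, rfl⟩ := Nat.exists_eq_add_of_le h2'
    by_cases hr : S.ratio π {s} X (s + i) ω ≤ Real.exp c
    · left
      exact Set.mem_biUnion (x := i) (Finset.mem_coe.mpr (Finset.mem_range.mpr (by omega)))
        (show ω ∈ B i from ⟨h1, ht.symm, hr⟩)
    · right
      have hsum := (not_le.mp hr).trans_le (ratio_singleton_le hπ hω (s := s) (t := s + i) (by omega))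
      rw [Real.exp_lt_exp] at hsum
      have hMω : M ω = ∑ j ∈ Finset.Icc s (s + i), if 1 ≤ j then
          R.llr true (X j ω) (S.response π X j ω) - R.I (X j ω) else 0 := by
        simp only [M]
        rw [← Finset.sum_subset (s₁ := Finset.Icc s (s + i))]
        · refine Finset.sum_congr rfl fun j hj => ?_
          rw [Finset.mem_Icc] at hj
          split_ifs with hj1
          · rw [Set.indicator_of_mem]
            · rfl
            · simp only [C]
              rw [if_pos ⟨hj.1, by omega, hj1⟩]
              exact ⟨h1, by rw [Set.mem_ofPred_eq, ← ht]; exact_mod_cast hj.2⟩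
          · rw [Set.indicator_of_notMem]
            simp [C, hj1]
        · intro j hj
          rw [Finset.mem_Icc] at hj
          exact Finset.mem_range.mpr (by omega)
        · intro j hj hj'
          rw [Finset.mem_range] at hj
          rw [Finset.mem_Icc] at hj'
          rw [Set.indicator_of_notMem]
          simp only [C]
          split_ifs with h
          · intro hmem
            have : (j : ℕ∞) ≤ T ω := hmem.2
            rw [← ht] at this
            exact hj' ⟨h.1, by exact_mod_cast this⟩
          · exact Set.notMem_empty _
      have hle : ∑ j ∈ Finset.Icc s (s + i),
          ((if 1 ≤ j then R.llr true (X j ω) (S.response π X j ω) else 0) + hazard π X j ω) ≤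
          M ω + a := by
        rw [hMω]
        have h4 : ∀ j ∈ Finset.Icc s (s + i),
            (if 1 ≤ j then R.llr true (X j ω) (S.response π X j ω) else 0) + hazard π X j ω ≤
            (if 1 ≤ j then R.llr true (X j ω) (S.response π X j ω) - R.I (X j ω) else 0) +
              (Dm + if j < t₀ then κ else 0) := by
          intro j _
          have h5 := hazard_le (X := X) hδ hπδ j ω
          have h6 := hDm (X j ω)
          by_cases hj : j < t₀
          · simp only [hj, if_true]
            split_ifs <;> linarith
          · have h7 := hdrift j (not_lt.mp hj) ω
            rw [if_pos (show 1 ≤ j by omega), if_pos (show 1 ≤ j by omega), if_neg hj]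
            linarith
        refine (Finset.sum_le_sum h4).trans ?_
        rw [Finset.sum_add_distrib, Finset.sum_add_distrib]
        have h5 : ∑ j ∈ Finset.Icc s (s + i), Dm ≤ n * Dm := by
          rw [Finset.sum_const, Nat.card_Icc, nsmul_eq_mul]
          refine mul_le_mul_of_nonneg_right ?_ hDm0
          exact_mod_cast (by omega : s + i + 1 - s ≤ n)
        have h6 : ∑ j ∈ Finset.Icc s (s + i), (if j < t₀ then κ else 0) ≤ t₀ * κ := by
          rw [← Finset.sum_filter, Finset.sum_const, nsmul_eq_mul]
          refine mul_le_mul_of_nonneg_right ?_ hκ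
          have : ((Finset.Icc s (s + i)).filter (· < t₀)).card ≤ (Finset.range t₀).card :=
            Finset.card_le_card fun j hj => Finset.mem_range.mpr (Finset.mem_filter.mp hj).2
          rw [Finset.card_range] at this
          exact_mod_cast this
        linarith
      have hge : c - a ≤ M ω := by linarith
      exact pow_le_pow_left₀ hca.le hge 2
  calc S.P {ω | S.Θ π X ω = s ∧ (s : ℕ∞) ≤ T ω ∧ T ω < (s + n : ℕ)}
      ≤ S.P ((⋃ i ∈ Finset.range n, B i) ∪ F) := measure_mono_ae hcover
    _ ≤ S.P (⋃ i ∈ Finset.range n, B i) + S.P F := measure_union_le _ _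
    _ ≤ ∑ i ∈ Finset.range n, S.P (B i) + S.P F := by
        gcongr
        exact measure_biUnion_finset_le _ _
    _ ≤ _ := by
        refine add_le_add ?_ hF
        rw [Finset.mul_sum]
        exact Finset.sum_le_sum fun i _ => hB i

/-- The change-point has a geometric tail if each time step brings the change with probability at
least `ζ`. -/
theorem measure_noChange_le (hπ : ∀ t z, π t z ∈ Set.Icc (0 : ℝ) 1) {ζ : ℝ} (hζ1 : ζ ≤ 1)
    (hζ : ∀ t ω, ζ ≤ transitionProb π X (t + 1) ω) (t : ℕ) :
    S.P {ω | S.L π X t ω = false} ≤ ENNReal.ofReal ((1 - ζ) ^ t) := by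
  induction t with
  | zero => simpa using prob_le_one
  | succ t ih =>
    have hL0 := measurableSet_L_prev hX t false
    have hU : MeasurableSet {ω | transitionProb π X (t + 1) ω < S.U (t + 1) ω} :=
      measurableSet_lt ((measurable_transitionProb_prev hX _).mono (S.prev_le _) le_rfl)
        (S.measurable_U _)
    have e : {ω | S.L π X (t + 1) ω = false} = {ω | S.L π X t ω = false} ∩
        {ω | transitionProb π X (t + 1) ω < S.U (t + 1) ω} := by
      ext ω; exact L_succ_false_iff t ω
    have h := lintegral_lt_U hX hπ (t := t + 1) (Z := {ω | S.L π X t ω = false}.indicator 1)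
      (Measurable.indicator (@measurable_const _ _ _ (S.prev (t + 1)) 1) hL0)
    rw [lintegral_indicator_one (measurableSet_L hX t false),
      Measure.restrict_apply (measurableSet_L hX t false), ← e] at h
    rw [h]
    calc ∫⁻ ω, {ω | S.L π X t ω = false}.indicator 1 ω *
          ENNReal.ofReal (1 - transitionProb π X (t + 1) ω) ∂S.P
        ≤ ∫⁻ ω, {ω | S.L π X t ω = false}.indicator 1 ω * ENNReal.ofReal (1 - ζ) ∂S.P := by
          gcongr with ω
          exact hζ t ω
      _ = S.P {ω | S.L π X t ω = false} * ENNReal.ofReal (1 - ζ) := by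
          rw [lintegral_mul_const' _ _ (by simp), lintegral_indicator_one (measurableSet_L hX t false)]
      _ ≤ ENNReal.ofReal ((1 - ζ) ^ t) * ENNReal.ofReal (1 - ζ) := by gcongr
      _ = ENNReal.ofReal ((1 - ζ) ^ (t + 1)) := by
          rw [← ENNReal.ofReal_mul (pow_nonneg (by linarith) t), pow_succ]

theorem measurableSet_lt_Θ (j : ℕ) : MeasurableSet {ω | (j : ℕ∞) < S.Θ π X ω} := by
  simp only [lt_Θ_iff]
  exact measurableSet_L hX j false

end

theorem measurableSet_of_stopping {T : Ω → ℕ∞}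
    (hT : ∀ t : ℕ, MeasurableSet {ω | T ω = t}) : Measurable T :=
  measurable_to_countable' fun t => by
    induction t using ENat.recTopCoe with
    | coe n => exact hT n
    | top =>
      have : T ⁻¹' {⊤} = (⋃ n : ℕ, {ω | T ω = n})ᶜ := by
        ext ω
        simp only [Set.mem_preimage, Set.mem_singleton_iff, Set.mem_compl_iff, Set.mem_iUnion,
          Set.mem_ofPred_eq]
        constructor
        · rintro h ⟨n, hn⟩
          rw [h] at hn
          exact ENat.top_ne_natCast n hn
        · intro h
          by_contra hne
          obtain ⟨n, hn⟩ := ENat.ne_top_iff_exists.mp hne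
          exact h ⟨n, hn.symm⟩
      rw [this]
      exact (MeasurableSet.iUnion fun n => hT n).compl

theorem adapted_const (x : Fin (k + 1)) (t : ℕ) :
    Measurable[S.obs π (fun _ _ => x) t] (fun _ : Ω => x) := measurable_const

/-- The change-point with the maximal transition probabilities has a small integral over an event of
small probability: it is at most the change-point under the constant treatment `0`, which has a
geometric tail. -/
theorem lintegral_maxChangePoint_le (hπ : ∀ t z, π t z ∈ Set.Icc (0 : ℝ) 1) {ζ : ℝ} (hζ0 : 0 < ζ)
    (hζ : ∀ t, ζ ≤ π (t + 1) fun _ => 0) {A : Set Ω} {α : ℝ}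
    (hα : 0 ≤ α) (hAα : S.P A ≤ ENNReal.ofReal α) :
    ∫⁻ ω in A, (changePoint (maxTransition π) (fun s => S.U s ω) : ℝ≥0∞) ∂S.P ≤
      ENNReal.ofReal (2 * √α / ζ) := by
  have hX : ∀ t, Measurable[S.obs π (fun _ _ => (0 : Fin (k + 1))) t] (fun _ : Ω => (0 : Fin (k + 1))) :=
    adapted_const 0
  have hle : ∀ ω, changePoint (maxTransition π) (fun s => S.U s ω) ≤ S.Θ π (fun _ _ => 0) ω := fun ω =>
    changePoint_anti _ fun t => le_maxTransition π t _
  refine (lintegral_mono (g := fun ω => (S.Θ π (fun _ _ => 0) ω : ℝ≥0∞)) fun ω => ?_).trans ?_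
  · exact ENat.toENNReal_mono (hle ω)
  rw [lintegral_eq_tsum _ (fun j => measurableSet_lt_Θ hX j)]
  refine tsum_le_of_geometric hα hζ0 ((hζ 0).trans (hπ _ _).2) (fun j => ?_) (fun j => ?_)
  · refine le_trans ?_ hAα
    rw [Measure.restrict_apply (measurableSet_lt_Θ hX j)]
    exact measure_mono Set.inter_subset_right
  · refine (Measure.restrict_apply_le _ _).trans ?_
    have h := measure_noChange_le hX hπ ((hζ 0).trans (hπ _ _).2) (fun t ω => hζ t) j
    simpa only [lt_Θ_iff] using h

/-- The lower bound for a pair in the class `C_α`: the expected sample size is at least `λ_* + n`, up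
to the loss due to a false alarm or to an alarm within `n` time units after the change. -/
theorem InClass.lower_bound (hπ : ∀ t z, π t z ∈ Set.Ico (0 : ℝ) 1) (hR : R.Regular) {δ : ℝ}
    (hδ : 0 < δ) (hπδ : ∀ t z, π t z ≤ 1 - δ) {ζ : ℝ} (hζ0 : 0 < ζ)
    (hζ : ∀ t, ζ ≤ π (t + 1) fun _ => 0) {α : ℝ} (hα : 0 ≤ α) {T : Ω → ℕ∞}
    (h : S.InClass π α T X) {Dm : ℝ} (hDm : ∀ x, R.I x ≤ Dm) {t₀ : ℕ} (ht₀ : 1 ≤ t₀)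
    (hdrift : ∀ j ≥ t₀, ∀ ω, R.I (X j ω) + hazard π X j ω ≤ Dm)
    {n : ℕ} {c : ℝ} (hc : n * Dm + t₀ * (-Real.log δ) < c) :
    S.lamStar π + n ≤ expect S.P T + ENNReal.ofReal (2 * √α / ζ) +
      n * ENNReal.ofReal (α + Real.exp c * (n * α) +
        R.secondMoment * n / (c - (n * Dm + t₀ * (-Real.log δ))) ^ 2) := by
  have hX := h.admissible.adapted
  have hT := h.admissible.stopping
  have hI : ∀ t z, π t z ∈ Set.Icc (0 : ℝ) 1 := fun t z => ⟨(hπ t z).1, (hπ t z).2.le⟩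
  have hTm : Measurable T := measurableSet_of_stopping fun t => obs_le hX t _ (hT t)
  have hΘm : Measurable (S.Θ π X) := measurableSet_of_stopping fun t =>
    S.curr_le t _ (measurableSet_Θ_eq hX le_rfl)
  let Θs : Ω → ℕ∞ := fun ω => changePoint (maxTransition π) (fun s => S.U s ω)
  have hΘs : ∀ ω, Θs ω ≤ S.Θ π X ω := fun ω => changePoint_anti _ fun t => le_maxTransition π t _
  have hΘsm : Measurable fun ω => (Θs ω : ℝ≥0∞) := by
    have h1 : Measurable Θs := by
      refine measurableSet_of_stopping fun t => ?_
      have h2 : ∀ j : ℕ, MeasurableSet {ω | Θs ω ≤ j} := by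
        intro j
        simp only [Θs, changePoint_le_iff]
        exact (measurable_latent (p := fun s _ => maxTransition π s) (fun _ _ => measurable_const)
          fun s _ => S.measurable_U s) (measurableSet_singleton true)
      have e : {ω | Θs ω = t} = {ω | Θs ω ≤ t} \ ⋃ j ∈ Finset.range t, {ω | Θs ω ≤ j} := by
        ext ω
        simp only [Set.mem_ofPred_eq, Set.mem_sdiff, Set.mem_iUnion, Finset.mem_range, exists_prop,
          not_exists, not_and, not_le]
        constructor
        · intro h; rw [h]
          exact ⟨le_rfl, fun j hj => by exact_mod_cast hj⟩
        · rintro ⟨h1, h2⟩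
          obtain ⟨m, hm⟩ := ENat.ne_top_iff_exists.mp (ne_top_of_le_ne_top (ENat.natCast_ne_top t) h1)
          rw [← hm] at h1 h2 ⊢
          have h3 : m ≤ t := by exact_mod_cast h1
          by_contra hne
          have h4 : m < t := lt_of_le_of_ne h3 fun h => hne (by rw [h])
          exact lt_irrefl _ (h2 m h4)
      rw [e]
      exact (h2 t).diff (Finset.measurableSet_biUnion _ fun j _ => h2 j)
    exact (Measurable.of_discrete (f := fun m : ℕ∞ => (m : ℝ≥0∞))).comp h1
  -- the alarm is false, it comes soon after the change, or it comes late
  let A : Set Ω := {ω | T ω < S.Θ π X ω}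
  let W : Set Ω := ⋃ s : ℕ, {ω | S.Θ π X ω = s ∧ (s : ℕ∞) ≤ T ω ∧ T ω < (s + n : ℕ)}
  let G : Set Ω := {ω | S.Θ π X ω + n ≤ T ω}
  have hAm : MeasurableSet A := (hTm.prodMk hΘm)
    (MeasurableSet.of_discrete (s := {q : ℕ∞ × ℕ∞ | q.1 < q.2}))
  have hGm : MeasurableSet G := by
    have h1 : Measurable fun ω => S.Θ π X ω + n :=
      (Measurable.of_discrete (f := fun m : ℕ∞ => m + n)).comp hΘm
    exact (h1.prodMk hTm) (MeasurableSet.of_discrete (s := {q : ℕ∞ × ℕ∞ | q.1 ≤ q.2}))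
  set V' := R.secondMoment * n / (c - (n * Dm + t₀ * (-Real.log δ))) ^ 2 with hV'
  have hV'0 : 0 ≤ V' := div_nonneg (mul_nonneg R.secondMoment_nonneg (Nat.cast_nonneg n)) (sq_nonneg _)
  have hW : S.P W ≤ ENNReal.ofReal (Real.exp c * (n * α) + V') := by
    have h1 : ∑' s : ℕ, S.P {ω | S.Θ π X ω = s} ≤ 1 := by
      rw [← measure_iUnion]
      · exact prob_le_one
      · intro i j hij
        rw [Function.onFun, Set.disjoint_left]
        intro ω h1 h2
        rw [Set.mem_ofPred_eq] at h1 h2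
        rw [h1] at h2
        exact hij (by exact_mod_cast h2)
      · exact fun s => S.curr_le s _ (measurableSet_Θ_eq hX le_rfl)
    have h2 : ∀ i, ∑' s : ℕ, S.P {ω | T ω = (s + i : ℕ) ∧ T ω < S.Θ π X ω} ≤ ENNReal.ofReal α := by
      intro i
      refine le_trans ?_ h.falseAlarm
      rw [← measure_iUnion]
      · refine measure_mono (Set.iUnion_subset fun s ω hω => hω.2)
      · intro s s' hij
        rw [Function.onFun, Set.disjoint_left]
        rintro ω ⟨h1, _⟩ ⟨h2, _⟩
        rw [h1] at h2
        have : s + i = s' + i := by exact_mod_cast h2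
        omega
      · exact fun s => (obs_le hX _ _ (hT (s + i))).inter hAm
    calc S.P W ≤ ∑' s : ℕ, S.P {ω | S.Θ π X ω = s ∧ (s : ℕ∞) ≤ T ω ∧ T ω < (s + n : ℕ)} :=
          measure_iUnion_le _
      _ ≤ ∑' s : ℕ, (ENNReal.ofReal (Real.exp c) * ∑ i ∈ Finset.range n,
            S.P {ω | T ω = (s + i : ℕ) ∧ T ω < S.Θ π X ω} +
            ENNReal.ofReal V' * S.P {ω | S.Θ π X ω = s}) :=
          ENNReal.tsum_le_tsum fun s => measure_window_le hX hπ hR hδ hπδ hT hDm ht₀ hdrift hc s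
      _ = ENNReal.ofReal (Real.exp c) * ∑ i ∈ Finset.range n,
            ∑' s : ℕ, S.P {ω | T ω = (s + i : ℕ) ∧ T ω < S.Θ π X ω} +
            ENNReal.ofReal V' * ∑' s : ℕ, S.P {ω | S.Θ π X ω = s} := by
          rw [ENNReal.tsum_add, ENNReal.tsum_mul_left, ENNReal.tsum_mul_left,
            Summable.tsum_finsetSum fun _ _ => ENNReal.summable]
      _ ≤ ENNReal.ofReal (Real.exp c) * ∑ i ∈ Finset.range n, ENNReal.ofReal α +
            ENNReal.ofReal V' * 1 := by
          gcongr with i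
          exact h2 i
      _ = ENNReal.ofReal (Real.exp c * (n * α) + V') := by
          rw [Finset.sum_const, Finset.card_range, nsmul_eq_mul, mul_one,
            ENNReal.ofReal_add (by positivity) hV'0, ENNReal.ofReal_mul (Real.exp_pos c).le,
            ENNReal.ofReal_mul (Nat.cast_nonneg n), ENNReal.ofReal_natCast]
  have hcov : (1 : ℝ≥0∞) ≤ S.P G + ENNReal.ofReal (α + Real.exp c * (n * α) + V') := by
    have h1 : Set.univ ⊆ G ∪ (A ∪ W) := by
      intro ω _
      by_cases hA : T ω < S.Θ π X ω
      · exact Or.inr (Or.inl hA)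
      by_cases hG : S.Θ π X ω + n ≤ T ω
      · exact Or.inl hG
      refine Or.inr (Or.inr ?_)
      rw [not_lt] at hA
      rw [not_le] at hG
      have hne : S.Θ π X ω ≠ ⊤ := by
        intro htop
        rw [htop, top_le_iff] at hA
        rw [htop, hA] at hG
        simp at hG
      obtain ⟨s, hs⟩ := ENat.ne_top_iff_exists.mp hne
      rw [← hs] at hA hG
      exact Set.mem_iUnion.mpr ⟨s, hs.symm, hA, by exact_mod_cast hG⟩
    calc (1 : ℝ≥0∞) = S.P Set.univ := measure_univ.symm
      _ ≤ S.P (G ∪ (A ∪ W)) := measure_mono h1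
      _ ≤ S.P G + (S.P A + S.P W) := (measure_union_le _ _).trans (by gcongr; exact measure_union_le _ _)
      _ ≤ S.P G + (ENNReal.ofReal α + ENNReal.ofReal (Real.exp c * (n * α) + V')) := by
          gcongr
          exact h.falseAlarm
      _ = _ := by rw [← ENNReal.ofReal_add hα (by positivity), ← add_assoc α]
  have hpath : ∀ ω, (Θs ω : ℝ≥0∞) + n * G.indicator 1 ω ≤
      T ω + A.indicator (fun ω => (Θs ω : ℝ≥0∞)) ω := by
    intro ω
    have hΘsE : (Θs ω : ℝ≥0∞) ≤ (S.Θ π X ω : ℝ≥0∞) := by exact_mod_cast hΘs ω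
    by_cases hA : ω ∈ A
    · have hG : ω ∉ G := by
        intro hG
        have h1 : S.Θ π X ω + n ≤ T ω := hG
        exact absurd hA (not_lt.mpr (le_self_add.trans h1))
      rw [Set.indicator_of_mem hA, Set.indicator_of_notMem hG, mul_zero, add_zero]
      exact le_add_self
    · have hle : S.Θ π X ω ≤ T ω := not_lt.mp hA
      rw [Set.indicator_of_notMem hA, add_zero]
      by_cases hG : ω ∈ G
      · have h1 : S.Θ π X ω + n ≤ T ω := hG
        rw [Set.indicator_of_mem hG, Pi.one_apply, mul_one]
        calc (Θs ω : ℝ≥0∞) + n ≤ (S.Θ π X ω : ℝ≥0∞) + n := by gcongr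
          _ = ((S.Θ π X ω + n : ℕ∞) : ℝ≥0∞) := by push_cast; rfl
          _ ≤ _ := by exact_mod_cast h1
      · rw [Set.indicator_of_notMem hG, mul_zero, add_zero]
        exact hΘsE.trans (by exact_mod_cast hle)
  have hint := lintegral_mono (μ := S.P) hpath
  rw [lintegral_add_left hΘsm, lintegral_const_mul' _ _ (by simp), lintegral_indicator_one hGm,
    lintegral_add_right _ (hΘsm.indicator hAm), lintegral_indicator hAm] at hint
  have hsmall := lintegral_maxChangePoint_le (S := S) hI hζ0 hζ hα h.falseAlarm
  calc S.lamStar π + n = S.lamStar π + n * 1 := by rw [mul_one]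
    _ ≤ S.lamStar π + n * (S.P G + ENNReal.ofReal (α + Real.exp c * (n * α) + V')) := by gcongr
    _ = (S.lamStar π + n * S.P G) + n * ENNReal.ofReal (α + Real.exp c * (n * α) + V') := by
        rw [mul_add, ← add_assoc]
    _ ≤ (expect S.P T + ENNReal.ofReal (2 * √α / ζ)) +
          n * ENNReal.ofReal (α + Real.exp c * (n * α) + V') := by
        refine add_le_add_left (hint.trans ?_) _
        exact add_le_add_right hsmall _

end System

end

end ChangeAccel

namespace ChangeAccel

noncomputable section

/-! ### Stages and cycles of the mastery-learning procedure -/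

theorem lt_firstTime {q : ℕ → Prop} {r : ℕ} : (r : ℕ∞) < firstTime q ↔ ∀ s ≤ r, ¬ q s := by
  rw [← not_le, firstTime_le]
  push Not
  rfl

theorem firstTime_eq {q : ℕ → Prop} {r : ℕ} (h : firstTime q = r) : q r ∧ ∀ s < r, ¬ q s := by
  obtain ⟨s, hs, hq⟩ := firstTime_le.mp h.le
  have hlt : ∀ s < r, ¬ q s := by
    intro s hs hq
    have h1 : firstTime q ≤ s := firstTime_le.mpr ⟨s, le_rfl, hq⟩
    rw [h] at h1
    exact absurd hs (not_lt.mpr (by exact_mod_cast h1))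
  rcases hs.lt_or_eq with h1 | rfl
  · exact absurd hq (hlt s h1)
  · exact ⟨hq, hlt⟩

theorem one_le_firstTime {q : ℕ → Prop} (h : ∀ s, q s → 1 ≤ s) : 1 ≤ firstTime q :=
  le_iInf₂ fun t ht => by exact_mod_cast h t ht

theorem natCast_succ_le_iff {n : ℕ} {m : ℕ∞} : ((n + 1 : ℕ) : ℕ∞) ≤ m ↔ (n : ℕ∞) < m := by
  rw [Nat.cast_succ, ENat.add_one_le_iff (ENat.natCast_ne_top n)]

theorem lt_natCast_succ_iff {n : ℕ} {m : ℕ∞} : m < ((n + 1 : ℕ) : ℕ∞) ↔ m ≤ n := by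
  rw [← not_le, natCast_succ_le_iff, not_lt]

theorem measurableSet_const_le {Ω : Type*} {m : MeasurableSpace Ω} {f : Ω → ℝ} (hf : Measurable f)
    (b : ℝ) : MeasurableSet {ω | b ≤ f ω} := measurableSet_le measurable_const hf

namespace System

variable {k : ℕ} {Y : Type*} [mY : MeasurableSpace Y] {R : ResponseModel k Y}
  {Ω : Type*} [mΩ : MeasurableSpace Ω] (S : System R Ω) (π : Transition k)
  (X : ℕ → Ω → Fin (k + 1)) (b₁ bK d : ℝ)

/-- Time `j` belongs to the `n`-th stage of the procedure, counted from `0`: the even stages are the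
training stages and the odd ones the assessment stages. -/
def inStage (n j : ℕ) : Set Ω :=
  {ω | S.stageEnd π X b₁ bK d ω n < j ∧ j ≤ S.stageEnd π X b₁ bK d ω (n + 1)}

/-- The assessment stage of the `m`-th cycle, counted from `0`, ends with a detection. -/
def success (m : ℕ) : Set Ω :=
  {ω | S.sigma π X bK (S.stageEnd π X b₁ bK d ω (2 * m + 1)).toNat ω ≤
    S.tau π X d (S.stageEnd π X b₁ bK d ω (2 * m + 1)).toNat ω}

/-- The `m`-th cycle, counted from `0`, is started by the procedure: the earlier cycles have all
ended, without a detection. -/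
def alive (m : ℕ) : Set Ω :=
  {ω | S.stageEnd π X b₁ bK d ω (2 * m) < ⊤ ∧ ∀ i < m, ω ∉ S.success π X b₁ bK d i}

variable {S π X b₁ bK d}

theorem one_le_sigma (b : ℝ) (t : ℕ) (ω : Ω) : 1 ≤ S.sigma π X b t ω :=
  one_le_firstTime fun _ h => h.1

theorem one_le_tau (d : ℝ) (t : ℕ) (ω : Ω) : 1 ≤ S.tau π X d t ω :=
  one_le_firstTime fun _ h => h.1

theorem stageEnd_even (ω : Ω) (m : ℕ) : S.stageEnd π X b₁ bK d ω (2 * m + 1) =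
    S.stageEnd π X b₁ bK d ω (2 * m) +
      S.sigma π X b₁ (S.stageEnd π X b₁ bK d ω (2 * m)).toNat ω := by
  rw [stageEnd, if_pos (by simp)]

theorem stageEnd_odd (ω : Ω) (m : ℕ) : S.stageEnd π X b₁ bK d ω (2 * m + 2) =
    S.stageEnd π X b₁ bK d ω (2 * m + 1) +
      min (S.sigma π X bK (S.stageEnd π X b₁ bK d ω (2 * m + 1)).toNat ω)
        (S.tau π X d (S.stageEnd π X b₁ bK d ω (2 * m + 1)).toNat ω) := by
  rw [stageEnd, if_neg (by simp [Nat.odd_add_one])]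

theorem stageEnd_add_one_le (ω : Ω) (n : ℕ) :
    S.stageEnd π X b₁ bK d ω n + 1 ≤ S.stageEnd π X b₁ bK d ω (n + 1) := by
  rw [stageEnd]
  gcongr
  split_ifs
  · exact one_le_sigma _ _ _
  · exact le_min (one_le_sigma _ _ _) (one_le_tau _ _ _)

theorem le_stageEnd (ω : Ω) (n : ℕ) : (n : ℕ∞) ≤ S.stageEnd π X b₁ bK d ω n := by
  induction n with
  | zero => simp
  | succ n ih =>
    refine le_trans ?_ (stageEnd_add_one_le ω n)
    push_cast
    gcongr

/-- Every time after `0` belongs to some stage. -/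
theorem exists_inStage (ω : Ω) {j : ℕ} (hj : 1 ≤ j) : ∃ n, ω ∈ S.inStage π X b₁ bK d n j := by
  classical
  have h : ∃ n, (j : ℕ∞) ≤ S.stageEnd π X b₁ bK d ω n := ⟨j, le_stageEnd ω j⟩
  rcases hn : Nat.find h with _ | n
  · have h1 := Nat.find_spec h
    rw [hn] at h1
    simp only [stageEnd, nonpos_iff_eq_zero, Nat.cast_eq_zero] at h1
    omega
  · refine ⟨n, ?_, ?_⟩
    · exact not_le.mp (Nat.find_min h (by omega))
    · have h1 := Nat.find_spec h
      rwa [hn] at h1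

/-- The start of a stage that has a time in it, with the time counted from there. -/
theorem exists_start_of_inStage {ω : Ω} {n j : ℕ} (h : ω ∈ S.inStage π X b₁ bK d n j) :
    ∃ a : ℕ, S.stageEnd π X b₁ bK d ω n = a ∧ a < j := by
  obtain ⟨a, ha⟩ := ENat.ne_top_iff_exists.mp h.1.ne_top
  refine ⟨a, ha.symm, ?_⟩
  have := h.1
  rw [← ha] at this
  exact_mod_cast this

/-- During a training stage the posterior odds are below `b₁`. -/
theorem odds_lt_of_inStage_even {ω : Ω} {m j a : ℕ} (h : ω ∈ S.inStage π X b₁ bK d (2 * m) j)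
    (ha : S.stageEnd π X b₁ bK d ω (2 * m) = a) {i : ℕ} (hai : a < i) (hij : i < j) :
    S.odds π X i ω < b₁ := by
  have h2 := h.2
  rw [stageEnd_even, ha, ENat.toNat_natCast] at h2
  obtain ⟨s, rfl⟩ := Nat.exists_eq_add_of_lt hai
  by_contra hge
  have h3 : S.sigma π X b₁ a ω ≤ (s + 1 : ℕ) :=
    firstTime_le.mpr ⟨s + 1, le_rfl, by omega, by rw [← add_assoc]; exact not_lt.mp hge⟩
  have h4 : (j : ℕ∞) ≤ ((a + (s + 1) : ℕ) : ℕ∞) := h2.trans (by push_cast at h3 ⊢; gcongr)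
  have : j ≤ a + (s + 1) := by exact_mod_cast h4
  omega

theorem odds_ge_of_stageEnd_even {ω : Ω} {m a : ℕ}
    (ha : S.stageEnd π X b₁ bK d ω (2 * m + 1) = a) : b₁ ≤ S.odds π X a ω := by
  rw [stageEnd_even] at ha
  have h1 : S.stageEnd π X b₁ bK d ω (2 * m) ≠ ⊤ := by
    intro h; rw [h, top_add] at ha; exact ENat.top_ne_natCast a ha
  have h2 : S.sigma π X b₁ (S.stageEnd π X b₁ bK d ω (2 * m)).toNat ω ≠ ⊤ := by
    intro h; rw [h, add_top] at ha; exact ENat.top_ne_natCast a ha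
  obtain ⟨c, hc⟩ := ENat.ne_top_iff_exists.mp h1
  obtain ⟨s, hs⟩ := ENat.ne_top_iff_exists.mp h2
  have h3 := (firstTime_eq (show firstTime _ = (s : ℕ∞) from hs.symm)).1.2
  rw [← hs, ← hc] at ha
  rw [← hc, ENat.toNat_natCast] at h3
  have : c + s = a := by exact_mod_cast ha
  rwa [this] at h3

theorem lt_of_inStage_odd {ω : Ω} {m j a : ℕ} (h : ω ∈ S.inStage π X b₁ bK d (2 * m + 1) j)
    (ha : S.stageEnd π X b₁ bK d ω (2 * m + 1) = a) {s : ℕ} (hs : 1 ≤ s) (hij : a + s < j) :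
    S.odds π X (a + s) ω < bK ∧ ∏ i ∈ Finset.Icc 1 s,
      R.f (Fin.last k) (S.response π X (a + i) ω) / R.g (Fin.last k) (S.response π X (a + i) ω) < d := by
  have h2 := h.2
  rw [stageEnd_odd, ha, ENat.toNat_natCast] at h2
  constructor <;> by_contra hge
  · have h3 : S.sigma π X bK a ω ≤ (s : ℕ) := firstTime_le.mpr ⟨s, le_rfl, hs, not_lt.mp hge⟩
    have h4 : (j : ℕ∞) ≤ ((a + s : ℕ) : ℕ∞) := h2.trans (by
      push_cast
      gcongr
      exact (min_le_left _ _).trans h3)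
    have : j ≤ a + s := by exact_mod_cast h4
    omega
  · have h3 : S.tau π X d a ω ≤ (s : ℕ) := firstTime_le.mpr ⟨s, le_rfl, hs, not_lt.mp hge⟩
    have h4 : (j : ℕ∞) ≤ ((a + s : ℕ) : ℕ∞) := h2.trans (by
      push_cast
      gcongr
      exact (min_le_right _ _).trans h3)
    have : j ≤ a + s := by exact_mod_cast h4
    omega

section Measurability

theorem measurable_odds (t : ℕ) : Measurable[S.obs π X t] (S.odds π X t) :=
  (stronglyMeasurable_condExp.measurable).div stronglyMeasurable_condExp.measurable

theorem measurableSet_sigma_le (b : ℝ) (t r : ℕ) :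
    MeasurableSet[S.obs π X (t + r)] {ω | S.sigma π X b t ω ≤ r} := by
  have e : {ω | S.sigma π X b t ω ≤ r} =
      ⋃ s ∈ Finset.Icc 1 r, {ω | b ≤ S.odds π X (t + s) ω} := by
    ext ω
    simp only [sigma, firstTime_le, Set.mem_ofPred_eq, Set.mem_iUnion, Finset.mem_Icc, exists_prop]
    exact exists_congr fun s => by tauto
  rw [e]
  refine measurableSet_finset_biUnion (m := S.obs π X (t + r)) _ fun s hs => ?_
  rw [Finset.mem_Icc] at hs
  exact measurableSet_const_le ((measurable_odds (t + s)).mono (obs_mono (by omega)) le_rfl) b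

theorem measurableSet_tau_le (d : ℝ) (t r : ℕ) :
    MeasurableSet[S.obs π X (t + r)] {ω | S.tau π X d t ω ≤ r} := by
  have e : {ω | S.tau π X d t ω ≤ r} = ⋃ s ∈ Finset.Icc 1 r, {ω | d ≤ ∏ j ∈ Finset.Icc 1 s,
      R.f (Fin.last k) (S.response π X (t + j) ω) / R.g (Fin.last k) (S.response π X (t + j) ω)} := by
    ext ω
    simp only [tau, firstTime_le, Set.mem_ofPred_eq, Set.mem_iUnion, Finset.mem_Icc, exists_prop]
    exact exists_congr fun s => by tauto
  rw [e]
  refine measurableSet_finset_biUnion (m := S.obs π X (t + r)) _ fun s hs => ?_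
  rw [Finset.mem_Icc] at hs
  refine measurableSet_const_le (m := S.obs π X (t + r)) (Finset.measurable_fun_prod _ fun j hj => ?_) d
  rw [Finset.mem_Icc] at hj
  exact ((R.measurable_f _).div (R.measurable_g _)).comp
    (measurable_response_obs (by omega) (by omega))

theorem measurableSet_stageEnd_le (n t : ℕ) :
    MeasurableSet[S.obs π X t] {ω | S.stageEnd π X b₁ bK d ω n ≤ t} := by
  induction n generalizing t with
  | zero =>
    have : {ω : Ω | S.stageEnd π X b₁ bK d ω 0 ≤ t} = Set.univ := by ext ω; simp [stageEnd]
    rw [this]; exact MeasurableSet.univ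
  | succ n ih =>
    have heq : ∀ a ≤ t, MeasurableSet[S.obs π X t] {ω | S.stageEnd π X b₁ bK d ω n = a} := by
      intro a ha
      rcases a with _ | a
      · have : {ω : Ω | S.stageEnd π X b₁ bK d ω n = (0 : ℕ)} =
            {ω | S.stageEnd π X b₁ bK d ω n ≤ (0 : ℕ)} := by
          ext ω; simp
        rw [this]; exact obs_mono ha _ (ih 0)
      · have : {ω : Ω | S.stageEnd π X b₁ bK d ω n = (a + 1 : ℕ)} =
            {ω | S.stageEnd π X b₁ bK d ω n ≤ (a + 1 : ℕ)} \ {ω | S.stageEnd π X b₁ bK d ω n ≤ a} := by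
          ext ω
          simp only [Set.mem_ofPred_eq, Set.mem_sdiff, not_le, ← natCast_succ_le_iff]
          exact le_antisymm_iff
        rw [this]
        exact MeasurableSet.diff (obs_mono ha _ (ih (a + 1))) (obs_mono (by omega) _ (ih a))
    have e : {ω | S.stageEnd π X b₁ bK d ω (n + 1) ≤ t} = ⋃ a ∈ Finset.range (t + 1),
        {ω | S.stageEnd π X b₁ bK d ω n = a} ∩
          (if Odd (n + 1) then {ω | S.sigma π X b₁ a ω ≤ (t - a : ℕ)} else
            {ω | S.sigma π X bK a ω ≤ (t - a : ℕ)} ∪ {ω | S.tau π X d a ω ≤ (t - a : ℕ)}) := by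
      ext ω
      simp only [Set.mem_ofPred_eq, Set.mem_iUnion, Finset.mem_range, exists_prop, Set.mem_inter_iff]
      have key : ∀ (a : ℕ) (u : ℕ∞), a ≤ t → ((a : ℕ∞) + u ≤ t ↔ u ≤ (t - a : ℕ)) := by
        intro a u ha
        obtain ⟨c, rfl⟩ := Nat.exists_eq_add_of_le ha
        rw [Nat.add_sub_cancel_left]
        push_cast
        exact ENat.add_le_add_iff_left (ENat.natCast_ne_top a)
      constructor
      · intro h
        have h1 := (stageEnd_mono X b₁ bK d ω (Nat.le_succ n)).trans h
        obtain ⟨a, ha⟩ := ENat.ne_top_iff_exists.mp (ne_top_of_le_ne_top (ENat.natCast_ne_top t) h1)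
        rw [← ha] at h1
        have h2 : a ≤ t := by exact_mod_cast h1
        refine ⟨a, by omega, ha.symm, ?_⟩
        rw [stageEnd, ← ha, ENat.toNat_natCast, key a _ h2] at h
        split_ifs at h ⊢ with hodd
        · exact h
        · exact min_le_iff.mp h
      · rintro ⟨a, h2, ha, h⟩
        rw [stageEnd, ha, ENat.toNat_natCast, key a _ (by omega)]
        split_ifs at h ⊢ with hodd
        · exact h
        · exact min_le_iff.mpr h
    rw [e]
    refine measurableSet_finset_biUnion (m := S.obs π X t) _ fun a ha => ?_
    have ha' : a ≤ t := Nat.lt_succ_iff.mp (Finset.mem_range.mp ha)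
    refine MeasurableSet.inter (heq a ha') ?_
    have hs := fun b => measurableSet_sigma_le (S := S) (π := π) (X := X) b a (t - a)
    have ht := measurableSet_tau_le (S := S) (π := π) (X := X) d a (t - a)
    rw [Nat.add_sub_cancel' ha'] at hs ht
    split_ifs
    · exact hs b₁
    · exact MeasurableSet.union (hs bK) ht

theorem measurableSet_stageEnd_eq {n a t : ℕ} (hat : a ≤ t) :
    MeasurableSet[S.obs π X t] {ω | S.stageEnd π X b₁ bK d ω n = a} := by
  have h : {ω : Ω | S.stageEnd π X b₁ bK d ω n = a} = {ω | S.stageEnd π X b₁ bK d ω n ≤ a} \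
      ⋃ i ∈ Finset.range a, {ω | S.stageEnd π X b₁ bK d ω n ≤ i} := by
    ext ω
    simp only [Set.mem_ofPred_eq, Set.mem_sdiff, Set.mem_iUnion, Finset.mem_range, exists_prop,
      not_exists, not_and, not_le]
    constructor
    · intro h; rw [h]; exact ⟨le_rfl, fun i hi => by exact_mod_cast hi⟩
    · rintro ⟨h1, h2⟩
      obtain ⟨c, hc⟩ := ENat.ne_top_iff_exists.mp (ne_top_of_le_ne_top (ENat.natCast_ne_top a) h1)
      rw [← hc] at h1 h2 ⊢
      have h3 : c ≤ a := by exact_mod_cast h1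
      by_contra hne
      exact lt_irrefl _ (h2 c (lt_of_le_of_ne h3 fun h => hne (by rw [h])))
  rw [h]
  refine MeasurableSet.diff (obs_mono hat _ (measurableSet_stageEnd_le n a)) ?_
  refine measurableSet_finset_biUnion (m := S.obs π X t) _ fun i hi => ?_
  rw [Finset.mem_range] at hi
  exact obs_mono (by omega) _ (measurableSet_stageEnd_le n i)

theorem measurableSet_inStage (n t : ℕ) :
    MeasurableSet[S.obs π X t] (S.inStage π X b₁ bK d n (t + 1)) := by
  have e : S.inStage π X b₁ bK d n (t + 1) = {ω | S.stageEnd π X b₁ bK d ω n ≤ t} \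
      {ω | S.stageEnd π X b₁ bK d ω (n + 1) ≤ t} := by
    ext ω
    simp only [inStage, Set.mem_ofPred_eq, Set.mem_sdiff, not_le, lt_natCast_succ_iff,
      natCast_succ_le_iff]
  rw [e]
  exact MeasurableSet.diff (measurableSet_stageEnd_le n t) (measurableSet_stageEnd_le (n + 1) t)

theorem measurableSet_success (m t : ℕ) : MeasurableSet[S.obs π X t]
    ({ω | S.stageEnd π X b₁ bK d ω (2 * m + 2) = t} ∩ S.success π X b₁ bK d m) := by
  have e : {ω | S.stageEnd π X b₁ bK d ω (2 * m + 2) = t} ∩ S.success π X b₁ bK d m =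
      ⋃ a ∈ Finset.range (t + 1), {ω | S.stageEnd π X b₁ bK d ω (2 * m + 2) = t} ∩
        ({ω | S.stageEnd π X b₁ bK d ω (2 * m + 1) = a} ∩ {ω | S.sigma π X bK a ω ≤ (t - a : ℕ)}) := by
    ext ω
    simp only [success, Set.mem_ofPred_eq, Set.mem_iUnion, Finset.mem_range, exists_prop, Set.mem_inter_iff]
    have key : ∀ a : ℕ, S.stageEnd π X b₁ bK d ω (2 * m + 2) = t →
        S.stageEnd π X b₁ bK d ω (2 * m + 1) = a → a ≤ t ∧
        min (S.sigma π X bK a ω) (S.tau π X d a ω) = (t - a : ℕ) := by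
      intro a h1 h2
      rw [stageEnd_odd, h2, ENat.toNat_natCast] at h1
      have h3 : a ≤ t := by
        have : (a : ℕ∞) ≤ t := by rw [← h1]; exact le_self_add
        exact_mod_cast this
      refine ⟨h3, ?_⟩
      obtain ⟨c, rfl⟩ := Nat.exists_eq_add_of_le h3
      rw [Nat.add_sub_cancel_left]
      push_cast at h1
      exact le_antisymm ((ENat.add_le_add_iff_left (ENat.natCast_ne_top a)).mp h1.le)
        ((ENat.add_le_add_iff_left (ENat.natCast_ne_top a)).mp h1.ge)
    constructor
    · rintro ⟨h1, h2⟩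
      have h3 : S.stageEnd π X b₁ bK d ω (2 * m + 1) ≤ t := by
        rw [← h1]; exact stageEnd_mono X b₁ bK d ω (Nat.le_succ _)
      obtain ⟨a, ha⟩ := ENat.ne_top_iff_exists.mp (ne_top_of_le_ne_top (ENat.natCast_ne_top t) h3)
      obtain ⟨h4, h5⟩ := key a h1 ha.symm
      rw [← ha, ENat.toNat_natCast] at h2
      refine ⟨a, by omega, h1, ha.symm, ?_⟩
      rw [min_eq_left h2] at h5
      exact h5.le
    · rintro ⟨a, ha, h1, h2, h3⟩
      refine ⟨h1, ?_⟩
      rw [h2, ENat.toNat_natCast]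
      obtain ⟨h4, h5⟩ := key a h1 h2
      rw [← h5] at h3
      exact h3.trans (min_le_right _ _)
  rw [e]
  refine measurableSet_finset_biUnion (m := S.obs π X t) _ fun a ha => ?_
  have ha' : a ≤ t := Nat.lt_succ_iff.mp (Finset.mem_range.mp ha)
  have hs := measurableSet_sigma_le (S := S) (π := π) (X := X) bK a (t - a)
  rw [Nat.add_sub_cancel' ha'] at hs
  exact MeasurableSet.inter (measurableSet_stageEnd_eq le_rfl)
    (MeasurableSet.inter (measurableSet_stageEnd_eq ha') hs)

theorem measurableSet_alive_start (m t : ℕ) : MeasurableSet[S.obs π X t]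
    (S.alive π X b₁ bK d m ∩ {ω | S.stageEnd π X b₁ bK d ω (2 * m) = t}) := by
  induction m generalizing t with
  | zero =>
    have : S.alive π X b₁ bK d 0 ∩ {ω | S.stageEnd π X b₁ bK d ω (2 * 0) = t} =
        {ω | S.stageEnd π X b₁ bK d ω 0 = t} := by
      ext ω; simp [alive, stageEnd]
    rw [this]
    exact measurableSet_stageEnd_eq le_rfl
  | succ m ih =>
    have e : S.alive π X b₁ bK d (m + 1) ∩ {ω | S.stageEnd π X b₁ bK d ω (2 * (m + 1)) = t} =
        (⋃ a ∈ Finset.range (t + 1),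
          S.alive π X b₁ bK d m ∩ {ω | S.stageEnd π X b₁ bK d ω (2 * m) = a}) ∩
        ({ω | S.stageEnd π X b₁ bK d ω (2 * m + 2) = t} \
          ({ω | S.stageEnd π X b₁ bK d ω (2 * m + 2) = t} ∩ S.success π X b₁ bK d m)) := by
      ext ω
      simp only [alive, Set.mem_inter_iff, Set.mem_ofPred_eq, Set.mem_iUnion, Finset.mem_range,
        exists_prop, Set.mem_sdiff, not_and, mul_add, mul_one]
      constructor
      · rintro ⟨⟨h1, h2⟩, h3⟩
        have h4 : S.stageEnd π X b₁ bK d ω (2 * m) ≤ t := by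
          rw [← h3]; exact stageEnd_mono X b₁ bK d ω (by omega)
        obtain ⟨a, ha⟩ := ENat.ne_top_iff_exists.mp (ne_top_of_le_ne_top (ENat.natCast_ne_top t) h4)
        have h5 : a ≤ t := by rw [← ha] at h4; exact_mod_cast h4
        refine ⟨⟨a, by omega, ⟨?_, fun i hi => h2 i (by omega)⟩, ha.symm⟩, h3, fun _ => h2 m (by omega)⟩
        rw [← ha]; exact ENat.natCast_lt_top a
      · rintro ⟨⟨a, ha, ⟨h1, h2⟩, h3⟩, h4, h5⟩
        refine ⟨⟨?_, fun i hi => ?_⟩, h4⟩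
        · rw [h4]; exact ENat.natCast_lt_top t
        · rcases Nat.lt_succ_iff_lt_or_eq.mp hi with h | rfl
          exacts [h2 i h, h5 h4]
    rw [e]
    refine MeasurableSet.inter ?_ (MeasurableSet.diff (measurableSet_stageEnd_eq le_rfl)
      (measurableSet_success m t))
    refine measurableSet_finset_biUnion (m := S.obs π X t) _ fun a ha => ?_
    exact obs_mono (Nat.lt_succ_iff.mp (Finset.mem_range.mp ha)) _ (ih a)

theorem measurableSet_alive_inStage {m n t : ℕ} (hn : 2 * m ≤ n) : MeasurableSet[S.obs π X t]
    (S.alive π X b₁ bK d m ∩ S.inStage π X b₁ bK d n (t + 1)) := by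
  have e : S.alive π X b₁ bK d m ∩ S.inStage π X b₁ bK d n (t + 1) =
      (⋃ a ∈ Finset.range (t + 1),
          S.alive π X b₁ bK d m ∩ {ω | S.stageEnd π X b₁ bK d ω (2 * m) = a}) ∩
        S.inStage π X b₁ bK d n (t + 1) := by
    ext ω
    simp only [Set.mem_inter_iff, Set.mem_ofPred_eq, Set.mem_iUnion, Finset.mem_range, exists_prop]
    constructor
    · rintro ⟨h1, h2⟩
      obtain ⟨a, ha⟩ := ENat.ne_top_iff_exists.mp h1.1.ne
      refine ⟨⟨a, ?_, h1, ha.symm⟩, h2⟩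
      have h3 := (stageEnd_mono X b₁ bK d ω hn).trans_lt h2.1
      rw [← ha] at h3
      exact_mod_cast h3
    · rintro ⟨⟨a, _, h1, _⟩, h2⟩
      exact ⟨h1, h2⟩
  rw [e]
  refine MeasurableSet.inter ?_ (measurableSet_inStage n t)
  refine measurableSet_finset_biUnion (m := S.obs π X t) _ fun a ha => ?_
  exact obs_mono (Nat.lt_succ_iff.mp (Finset.mem_range.mp ha)) _ (measurableSet_alive_start m a)

end Measurability

end System

end

end ChangeAccel

namespace ChangeAccel

noncomputable section

namespace System

variable {k : ℕ} {Y : Type*} [mY : MeasurableSpace Y] {R : ResponseModel k Y}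
  {Ω : Type*} [mΩ : MeasurableSpace Ω] {S : System R Ω} {π : Transition k}
  {X : ℕ → Ω → Fin (k + 1)} {b₁ bK d : ℝ}

/-! ### Treatments assigned by a mastery rule -/

theorem IsMasteryRule.treatment_even (h : S.IsMasteryRule π X b₁ bK d) {ω : Ω} {m j : ℕ}
    (hj : ω ∈ S.inStage π X b₁ bK d (2 * m) j) : X j ω = 0 := by
  have h1 := (h ω (m + 1) j (by omega)).1
  rw [show 2 * (m + 1) - 2 = 2 * m by omega, show 2 * (m + 1) - 1 = 2 * m + 1 by omega] at h1
  exact h1 hj.1 hj.2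

theorem IsMasteryRule.treatment_odd (h : S.IsMasteryRule π X b₁ bK d) {ω : Ω} {m j : ℕ}
    (hj : ω ∈ S.inStage π X b₁ bK d (2 * m + 1) j) : X j ω = Fin.last k := by
  have h1 := (h ω (m + 1) j (by omega)).2
  rw [show 2 * (m + 1) - 1 = 2 * m + 1 by omega] at h1
  exact h1 hj.1 hj.2

theorem IsMasteryRule.adapted (h : S.IsMasteryRule π X b₁ bK d) (t : ℕ) :
    Measurable[S.obs π X t] (X (t + 1)) := by
  classical
  have e : X (t + 1) = fun ω => if ω ∈ ⋃ m, S.inStage π X b₁ bK d (2 * m) (t + 1) then 0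
      else Fin.last k := by
    ext1 ω
    split_ifs with hω
    · obtain ⟨m, hm⟩ := Set.mem_iUnion.mp hω
      exact h.treatment_even hm
    · obtain ⟨n, hn⟩ := exists_inStage (S := S) (π := π) (X := X) (b₁ := b₁) (bK := bK) (d := d) ω
        (show 1 ≤ t + 1 by omega)
      rcases Nat.even_or_odd' n with ⟨m, rfl | rfl⟩
      · exact absurd (Set.mem_iUnion.mpr ⟨m, hn⟩) hω
      · exact h.treatment_odd hn
  rw [e]
  exact Measurable.ite (MeasurableSet.iUnion fun m => measurableSet_inStage (2 * m) t)
    measurable_const measurable_const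

/-! ### The stopping time -/

theorem masteryTime_of_success {ω : Ω} {m : ℕ} (h : ω ∈ S.success π X b₁ bK d m)
    (hm : ∀ i < m, ω ∉ S.success π X b₁ bK d i) :
    S.masteryTime π X b₁ bK d ω = S.stageEnd π X b₁ bK d ω (2 * m + 2) := by
  have e : S.cycles π X b₁ bK d ω = (m + 1 : ℕ) := by
    apply le_antisymm
    · exact firstTime_le.mpr ⟨m + 1, le_rfl, by omega, h⟩
    · rw [natCast_succ_le_iff]
      refine lt_firstTime.mpr fun s hs hq => ?_
      obtain ⟨i, rfl⟩ := Nat.exists_eq_add_of_le' hq.1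
      exact hm i (by omega) hq.2
  rw [masteryTime, if_neg (by rw [e]; exact ENat.natCast_ne_top _), e, ENat.toNat_natCast]
  rfl

theorem exists_success_of_masteryTime_ne_top {ω : Ω} (h : S.masteryTime π X b₁ bK d ω ≠ ⊤) :
    ∃ m, ω ∈ S.success π X b₁ bK d m ∧ (∀ i < m, ω ∉ S.success π X b₁ bK d i) := by
  have hc : S.cycles π X b₁ bK d ω ≠ ⊤ := by
    intro hc
    rw [masteryTime, if_pos hc] at h
    exact h rfl
  obtain ⟨n, hn⟩ := ENat.ne_top_iff_exists.mp hc
  obtain ⟨⟨h1, h2⟩, h3⟩ := firstTime_eq (show firstTime _ = (n : ℕ∞) from hn.symm)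
  obtain ⟨m, rfl⟩ := Nat.exists_eq_add_of_le' h1
  exact ⟨m, h2, fun i hi hs => h3 (i + 1) (by omega) ⟨by omega, hs⟩⟩

theorem masteryTime_eq_iff (ω : Ω) (t : ℕ) : S.masteryTime π X b₁ bK d ω = t ↔
    ∃ m, ω ∈ S.alive π X b₁ bK d m ∧
      ω ∈ {ω | S.stageEnd π X b₁ bK d ω (2 * m + 2) = t} ∩ S.success π X b₁ bK d m := by
  constructor
  · intro h
    obtain ⟨m, h1, h2⟩ := exists_success_of_masteryTime_ne_top (h ▸ ENat.natCast_ne_top t)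
    rw [masteryTime_of_success h1 h2] at h
    refine ⟨m, ⟨?_, h2⟩, h, h1⟩
    exact lt_of_le_of_lt (stageEnd_mono X b₁ bK d ω (by omega)) (h ▸ ENat.natCast_lt_top t)
  · rintro ⟨m, h1, h2, h3⟩
    rw [masteryTime_of_success h3 h1.2]
    exact h2

/-- Up to the stopping time, every cycle that has a stage in progress has been started. -/
theorem mem_alive_of_le_masteryTime {ω : Ω} {j m n : ℕ} (hj : (j : ℕ∞) ≤ S.masteryTime π X b₁ bK d ω)
    (hn : ω ∈ S.inStage π X b₁ bK d n j) (hmn : 2 * m ≤ n) : ω ∈ S.alive π X b₁ bK d m := by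
  classical
  have hlt := (stageEnd_mono X b₁ bK d ω hmn).trans_lt hn.1
  refine ⟨hlt.trans (ENat.natCast_lt_top j), fun i hi hs => ?_⟩
  have hex : ∃ i, ω ∈ S.success π X b₁ bK d i := ⟨i, hs⟩
  have h1 := masteryTime_of_success (Nat.find_spec hex) fun i hi => Nat.find_min hex hi
  have h2 : Nat.find hex ≤ i := Nat.find_min' hex hs
  rw [h1] at hj
  have h3 := stageEnd_mono (S := S) (π := π) X b₁ bK d ω (show 2 * Nat.find hex + 2 ≤ 2 * m by omega)
  exact absurd hlt (not_lt.mpr (hj.trans h3))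

theorem odds_ge_of_masteryTime {ω : Ω} {t : ℕ} (h : S.masteryTime π X b₁ bK d ω = t) :
    bK ≤ S.odds π X t ω := by
  obtain ⟨m, h1, h2, h3⟩ := (masteryTime_eq_iff ω t).mp h
  have h4 : S.stageEnd π X b₁ bK d ω (2 * m + 1) ≤ t := by
    rw [← show _ = (t : ℕ∞) from h2]; exact stageEnd_mono X b₁ bK d ω (by omega)
  obtain ⟨a, ha⟩ := ENat.ne_top_iff_exists.mp (ne_top_of_le_ne_top (ENat.natCast_ne_top t) h4)
  have h5 : S.sigma π X bK a ω ≤ S.tau π X d a ω := by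
    have : S.sigma π X bK (S.stageEnd π X b₁ bK d ω (2 * m + 1)).toNat ω ≤
      S.tau π X d (S.stageEnd π X b₁ bK d ω (2 * m + 1)).toNat ω := h3
    rwa [← ha, ENat.toNat_natCast] at this
  have h6 : S.stageEnd π X b₁ bK d ω (2 * m + 2) = t := h2
  rw [stageEnd_odd, ← ha, ENat.toNat_natCast, min_eq_left h5] at h6
  have h7 : S.sigma π X bK a ω ≠ ⊤ := by
    intro h8; rw [h8, add_top] at h6; exact ENat.top_ne_natCast t h6
  obtain ⟨s, hs⟩ := ENat.ne_top_iff_exists.mp h7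
  have h8 := (firstTime_eq (show firstTime _ = (s : ℕ∞) from hs.symm)).1.2
  rw [← hs] at h6
  have : a + s = t := by exact_mod_cast h6
  rwa [this] at h8

theorem measurableSet_masteryTime (t : ℕ) :
    MeasurableSet[S.obs π X t] {ω | S.masteryTime π X b₁ bK d ω = t} := by
  have e : {ω | S.masteryTime π X b₁ bK d ω = t} = ⋃ m,
      (⋃ a ∈ Finset.range (t + 1),
        S.alive π X b₁ bK d m ∩ {ω | S.stageEnd π X b₁ bK d ω (2 * m) = a}) ∩
      ({ω | S.stageEnd π X b₁ bK d ω (2 * m + 2) = t} ∩ S.success π X b₁ bK d m) := by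
    ext ω
    simp only [Set.mem_iUnion, Set.mem_inter_iff, Finset.mem_range, exists_prop]
    rw [Set.mem_ofPred_eq, masteryTime_eq_iff]
    refine exists_congr fun m => ⟨fun ⟨h1, h2⟩ => ⟨?_, h2⟩, fun ⟨⟨a, _, h1, _⟩, h2⟩ => ⟨h1, h2⟩⟩
    have h3 : S.stageEnd π X b₁ bK d ω (2 * m) ≤ t := by
      rw [← show _ = (t : ℕ∞) from h2.1]; exact stageEnd_mono X b₁ bK d ω (by omega)
    obtain ⟨a, ha⟩ := ENat.ne_top_iff_exists.mp (ne_top_of_le_ne_top (ENat.natCast_ne_top t) h3)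
    rw [← ha] at h3
    have h4 : a ≤ t := by exact_mod_cast h3
    exact ⟨a, by omega, h1, ha.symm⟩
  rw [e]
  refine MeasurableSet.iUnion fun m => MeasurableSet.inter ?_ (measurableSet_success m t)
  refine measurableSet_finset_biUnion (m := S.obs π X t) _ fun a ha => ?_
  exact obs_mono (Nat.lt_succ_iff.mp (Finset.mem_range.mp ha)) _ (measurableSet_alive_start m a)

/-! ### Posterior odds and error probabilities -/

section

variable (hX : ∀ t, Measurable[S.obs π X t] (X (t + 1)))
include hX

theorem measure_eq_add (t : ℕ) {A : Set Ω} :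
    S.P A = S.P (A ∩ {ω | S.L π X t ω = false}) + S.P (A ∩ {ω | S.L π X t ω = true}) := by
  rw [← measure_inter_add_sdiff A (measurableSet_L hX t false)]
  congr 2
  ext ω
  simp

theorem measure_inter_changed_eq (hπ : ∀ t z, π t z ∈ Set.Ico (0 : ℝ) 1) (hR : R.Regular) {t : ℕ}
    {A : Set Ω} (hA : MeasurableSet[S.obs π X t] A) :
    S.P (A ∩ {ω | S.L π X t ω = true}) =
      ∫⁻ ω in A ∩ {ω | S.L π X t ω = false}, ENNReal.ofReal (S.ratio π Set.univ X t ω) ∂S.P := by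
  have hA' := obs_le hX t _ hA
  have h := changeOfMeasure (A := Set.univ) hX hπ hR t (Z := A.indicator 1)
    (Measurable.indicator (@measurable_const _ _ _ (S.obs π X t) 1) hA)
  rw [changedIn_univ, lintegral_indicator_one hA', Measure.restrict_apply hA'] at h
  rw [h, ← Measure.restrict_restrict hA', ← lintegral_indicator hA']
  refine lintegral_congr fun ω => ?_
  by_cases hω : ω ∈ A <;> simp [hω]

/-- If the posterior odds are at least `b` on an event, then it is at least `b` times as likely to
occur after the change as before it. -/
theorem ofReal_mul_measure_le (hπ : ∀ t z, π t z ∈ Set.Ico (0 : ℝ) 1) (hR : R.Regular) {t : ℕ}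
    {A : Set Ω} (hA : MeasurableSet[S.obs π X t] A) {b : ℝ} (hb : 0 ≤ b)
    (hAb : ∀ ω ∈ A, b ≤ S.odds π X t ω) :
    ENNReal.ofReal (1 + b) * S.P (A ∩ {ω | S.L π X t ω = false}) ≤ S.P A := by
  have hA0 := (obs_le hX t _ hA).inter (measurableSet_L hX t false)
  have h1 : ENNReal.ofReal b * S.P (A ∩ {ω | S.L π X t ω = false}) ≤
      S.P (A ∩ {ω | S.L π X t ω = true}) := by
    rw [measure_inter_changed_eq hX hπ hR hA, ← setLIntegral_const]
    refine setLIntegral_mono_ae' hA0 ?_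
    filter_upwards [odds_ae_eq hX hπ hR t] with ω hω hmem
    rw [← hω]
    exact ENNReal.ofReal_le_ofReal (hAb ω hmem.1)
  rw [ENNReal.ofReal_add zero_le_one hb, ENNReal.ofReal_one, add_mul, one_mul,
    measure_eq_add hX t (A := A)]
  gcongr

/-- If the posterior odds are at most `b` on an event, then it is at most `b` times as likely to
occur after the change as before it. -/
theorem measure_le_ofReal_mul (hπ : ∀ t z, π t z ∈ Set.Ico (0 : ℝ) 1) (hR : R.Regular) {t : ℕ}
    {A : Set Ω} (hA : MeasurableSet[S.obs π X t] A) {b : ℝ} (hb : 0 ≤ b)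
    (hAb : ∀ ω ∈ A, S.odds π X t ω ≤ b) :
    S.P A ≤ ENNReal.ofReal (1 + b) * S.P (A ∩ {ω | S.L π X t ω = false}) := by
  have hA0 := (obs_le hX t _ hA).inter (measurableSet_L hX t false)
  have h1 : S.P (A ∩ {ω | S.L π X t ω = true}) ≤
      ENNReal.ofReal b * S.P (A ∩ {ω | S.L π X t ω = false}) := by
    rw [measure_inter_changed_eq hX hπ hR hA, ← setLIntegral_const]
    refine setLIntegral_mono_ae' hA0 ?_
    filter_upwards [odds_ae_eq hX hπ hR t] with ω hω hmem
    rw [← hω]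
    exact ENNReal.ofReal_le_ofReal (hAb ω hmem.1)
  rw [ENNReal.ofReal_add zero_le_one hb, ENNReal.ofReal_one, add_mul, one_mul,
    measure_eq_add hX t (A := A)]
  gcongr

/-- The change happens at most once: if each of the steps `C j`, taken before the change, brings the
change with probability at least `ζ`, then their expected number is at most `1 / ζ`. -/
theorem sum_measure_le_of_transition (hπ : ∀ t z, π t z ∈ Set.Icc (0 : ℝ) 1) {C : ℕ → Set Ω}
    (hC : ∀ j, MeasurableSet[S.prev (j + 1)] (C j)) (hC0 : ∀ j, ∀ ω ∈ C j, S.L π X j ω = false)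
    {E : Set Ω} (hCE : ∀ j, C j ⊆ E) {ζ : ℝ} (hζ0 : 0 < ζ)
    (hζ : ∀ j, ∀ ω ∈ C j, ζ ≤ transitionProb π X (j + 1) ω) :
    ∑' j, S.P (C j) ≤ ENNReal.ofReal (1 / ζ) * S.P E := by
  have hU : ∀ j, MeasurableSet {ω | S.U j ω ≤ transitionProb π X j ω} := fun j =>
    measurableSet_le (S.measurable_U _)
      ((measurable_transitionProb_prev hX _).mono (S.prev_le _) le_rfl)
  have hCm : ∀ j, MeasurableSet (C j) := fun j => S.prev_le _ _ (hC j)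
  have h1 : ∀ j, ENNReal.ofReal ζ * S.P (C j) ≤
      S.P (C j ∩ {ω | S.U (j + 1) ω ≤ transitionProb π X (j + 1) ω}) := by
    intro j
    have h := lintegral_U_le hX hπ (t := j + 1) (Z := (C j).indicator 1)
      (Measurable.indicator (@measurable_const _ _ _ (S.prev (j + 1)) 1) (hC j))
    rw [lintegral_indicator_one (hCm j), Measure.restrict_apply (hCm j)] at h
    rw [h, ← lintegral_indicator_one (hCm j), ← lintegral_const_mul' _ _ (by simp)]
    refine lintegral_mono fun ω => ?_
    by_cases hω : ω ∈ C j
    · simp only [Set.indicator_of_mem hω, Pi.one_apply, mul_one, one_mul]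
      exact ENNReal.ofReal_le_ofReal (hζ j ω hω)
    · simp [hω]
  -- the steps that bring the change are disjoint events
  have h2 : ∑' j, S.P (C j ∩ {ω | S.U (j + 1) ω ≤ transitionProb π X (j + 1) ω}) ≤ S.P E := by
    rw [← measure_iUnion]
    · exact measure_mono (Set.iUnion_subset fun j => Set.inter_subset_left.trans (hCE j))
    · intro i j hij
      rw [Function.onFun, Set.disjoint_left]
      rintro ω ⟨h3, h4⟩ ⟨h5, h6⟩
      have e1 := (Θ_eq_succ_iff (S := S) (π := π) (X := X) i ω).mpr ⟨hC0 i ω h3, h4⟩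
      have e2 := (Θ_eq_succ_iff (S := S) (π := π) (X := X) j ω).mpr ⟨hC0 j ω h5, h6⟩
      rw [e1] at e2
      have : i + 1 = j + 1 := by exact_mod_cast e2
      omega
    · exact fun j => (hCm j).inter (hU (j + 1))
  have h3 : ENNReal.ofReal ζ * ∑' j, S.P (C j) ≤ S.P E := by
    rw [← ENNReal.tsum_mul_left]
    exact (ENNReal.tsum_le_tsum h1).trans h2
  have h4 : ENNReal.ofReal (1 / ζ) * ENNReal.ofReal ζ = 1 := by
    rw [← ENNReal.ofReal_mul (by positivity), one_div_mul_cancel hζ0.ne', ENNReal.ofReal_one]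
  calc ∑' j, S.P (C j) = ENNReal.ofReal (1 / ζ) * (ENNReal.ofReal ζ * ∑' j, S.P (C j)) := by
        rw [← mul_assoc, h4, one_mul]
    _ ≤ _ := by gcongr

end

/-! ### Growth of the posterior odds -/

/-- The posterior odds grow at least by the factors collected since time `s`. -/
theorem mul_exp_le_ratio (hπ : ∀ t z, π t z ∈ Set.Ico (0 : ℝ) 1) {ω : Ω}
    (hω : ∀ t, 1 ≤ t →
      0 < R.f (X t ω) (S.response π X t ω) ∧ 0 < R.g (X t ω) (S.response π X t ω))
    {s t : ℕ} (hst : s ≤ t) {x : ℝ}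
    (hx : x ≤ S.ratio π Set.univ X s ω + transitionProb π X (s + 1) ω) :
    x * Real.exp (∑ j ∈ Finset.Icc (s + 1) (t + 1),
      (R.llr true (X j ω) (S.response π X j ω) + hazard π X j ω)) ≤
      S.ratio π Set.univ X (t + 1) ω := by
  have h01 := fun t => hπ t (fun i => X (i + 1) ω)
  have hstep : ∀ t (r q : ℝ), r ≤ q →
      r * Real.exp (R.llr true (X (t + 1) ω) (S.response π X (t + 1) ω) +
        hazard π X (t + 1) ω) ≤ q / (1 - transitionProb π X (t + 1) ω) *
        (R.g (X (t + 1) ω) (S.response π X (t + 1) ω) /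
          R.f (X (t + 1) ω) (S.response π X (t + 1) ω)) := by
    intro t r q hrq
    rw [Real.exp_add, exp_hazard hπ, exp_llr (hω _ (by omega)), div_eq_mul_inv q,
      mul_assoc, mul_comm (1 - _)⁻¹]
    have h1 : 0 ≤ (1 - transitionProb π X (t + 1) ω)⁻¹ := inv_nonneg.mpr (sub_nonneg.mpr (h01 _).2.le)
    have h2 := div_nonneg (hω (t + 1) (by omega)).2.le (hω (t + 1) (by omega)).1.le
    exact mul_le_mul_of_nonneg_right hrq (mul_nonneg h2 h1)
  induction t, hst using Nat.le_induction with
  | base =>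
    rw [Finset.Icc_self, Finset.sum_singleton]
    simpa [ratio] using hstep s _ _ hx
  | succ t hst ih =>
    rw [Finset.sum_Icc_succ_top (by omega), Real.exp_add, ← mul_assoc]
    have h1 : x * Real.exp (∑ j ∈ Finset.Icc (s + 1) (t + 1),
      (R.llr true (X j ω) (S.response π X j ω) + hazard π X j ω)) ≤
      S.ratio π Set.univ X (t + 1) ω + transitionProb π X (t + 1 + 1) ω :=
      ih.trans (le_add_of_nonneg_right (h01 (t + 1 + 1)).1)
    simpa [ratio] using hstep (t + 1) _ _ h1

theorem sum_le_log_of_mul_exp_lt {x b : ℝ} (hx : 0 < x) {z : ℝ} (h : x * Real.exp z < b) :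
    z ≤ Real.log b - Real.log x := by
  have hb : 0 < b := lt_trans (mul_pos hx (Real.exp_pos _)) h
  have h1 := Real.log_lt_log (mul_pos hx (Real.exp_pos z)) h
  rw [Real.log_mul hx.ne' (Real.exp_pos z).ne', Real.log_exp] at h1
  linarith

omit mΩ in
open Classical in
/-- The sum over the steps of a stage that precede time `n` and are taken in the latent state `i`, as
a sum over an interval. -/
theorem sum_indicator_eq {C : ℕ → Set Ω} {ξ : ℕ → Ω → ℝ} {ω : Ω} {n : ℕ}
    (hup : ∀ i j, ω ∈ C i → i ≤ j → j ≤ n → ω ∈ C j) (hC0 : ω ∉ C 0) (hn : ω ∈ C n) :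
    ∃ s, ω ∈ C (s + 1) ∧ (∀ j ≤ s, ω ∉ C j) ∧ s + 1 ≤ n ∧
      ∑ j ∈ Finset.range n, (C j).indicator (ξ j) ω = ∑ j ∈ Finset.Ico (s + 1) n, ξ j ω := by
  have hex : ∃ j, ω ∈ C j := ⟨n, hn⟩
  have h0 : Nat.find hex ≠ 0 := fun h => hC0 (h ▸ Nat.find_spec hex)
  obtain ⟨s, hs⟩ := Nat.exists_eq_succ_of_ne_zero h0
  have hsn : s + 1 ≤ n := by
    have := Nat.find_min' hex hn
    omega
  have hmin : ∀ j ≤ s, ω ∉ C j := fun j hj => Nat.find_min hex (by omega)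
  have hmem : ω ∈ C (s + 1) := by
    have := Nat.find_spec hex
    rwa [hs] at this
  refine ⟨s, hmem, hmin, hsn, ?_⟩
  rw [← Finset.sum_subset (s₁ := Finset.Ico (s + 1) n)]
  · refine Finset.sum_congr rfl fun j hj => ?_
    rw [Finset.mem_Ico] at hj
    exact Set.indicator_of_mem (hup _ _ hmem hj.1 hj.2.le) _
  · intro j hj
    exact Finset.mem_range.mpr (Finset.mem_Ico.mp hj).2
  · intro j hj hj'
    rw [Finset.mem_range] at hj
    rw [Finset.mem_Ico] at hj'
    exact Set.indicator_of_notMem (hmin j (by omega)) _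

end System

end

end ChangeAccel

namespace ChangeAccel

noncomputable section

/-! ### Pre-change and post-change steps of a stage -/

theorem sum_Ico_shift {M : Type*} [AddCommMonoid M] (F : ℕ → M) (a r : ℕ) :
    ∑ j ∈ Finset.Ico (a + 1) (a + 1 + r), F j = ∑ i ∈ Finset.Icc 1 r, F (a + i) := by
  induction r with
  | zero => simp
  | succ r ih =>
    rw [← add_assoc, Finset.sum_Ico_succ_top (by omega), ih, Finset.sum_Icc_succ_top (by omega)]
    congr 2
    omega

theorem measurableSet_inter_of {Ω : Type*} {m : MeasurableSpace Ω} {s t : Set Ω}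
    (hs : MeasurableSet s) (ht : MeasurableSet t) : MeasurableSet (s ∩ t) := hs.inter ht

namespace System

variable {k : ℕ} {Y : Type*} [mY : MeasurableSpace Y] {R : ResponseModel k Y}
  {Ω : Type*} [mΩ : MeasurableSpace Ω] {S : System R Ω} {π : Transition k}
  {X : ℕ → Ω → Fin (k + 1)} {b₁ bK d : ℝ}

variable (S π X b₁ bK d) in
/-- On the event `K`, time `j` belongs to the `n`-th stage and the latent state is `i`. -/
def run (K : Set Ω) (n : ℕ) (i : Bool) (j : ℕ) : Set Ω :=
  K ∩ S.inStage π X b₁ bK d n j ∩ {ω | S.L π X j ω = i}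

theorem run_zero (K : Set Ω) (n : ℕ) (i : Bool) : S.run π X b₁ bK d K n i 0 = ∅ := by
  ext ω
  simp [run, inStage]

theorem run_up {K : Set Ω} {n : ℕ} {i : Bool} {ω : Ω} {r t : ℕ}
    (ht : ω ∈ S.run π X b₁ bK d K n i t) (hr : ω ∈ S.run π X b₁ bK d K n i r) {j : ℕ}
    (hrj : r ≤ j) (hjt : j ≤ t) : ω ∈ S.run π X b₁ bK d K n i j := by
  refine ⟨⟨hr.1.1, hr.1.2.1.trans_le (by exact_mod_cast hrj), le_trans (by exact_mod_cast hjt) ht.1.2.2⟩, ?_⟩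
  have h1 : S.L π X r ω = i := hr.2
  have h2 : S.L π X t ω = i := ht.2
  change S.L π X j ω = i
  cases i
  · by_contra h
    rw [Bool.not_eq_false] at h
    rw [L_mono hjt h] at h2
    exact absurd h2 (by simp)
  · exact L_mono hrj h1

theorem measurableSet_run (hX : ∀ t, Measurable[S.obs π X t] (X (t + 1))) {K : Set Ω} {n : ℕ}
    (hK : ∀ t, MeasurableSet[S.curr (t + 1)] (K ∩ S.inStage π X b₁ bK d n (t + 1))) (i : Bool) (j : ℕ) :
    MeasurableSet[S.curr j] (S.run π X b₁ bK d K n i j) := by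
  rcases j with _ | j
  · rw [run_zero]; exact @MeasurableSet.empty _ (S.curr 0)
  · exact measurableSet_inter_of (hK j) (measurableSet_L_curr hX (j + 1) i)

section

variable (hX : ∀ t, Measurable[S.obs π X t] (X (t + 1)))
include hX

/-- The expected number of post-change steps in a stage that ends when the posterior odds reach the
threshold `b`, if the odds are at least `x` when these steps begin. -/
theorem sum_measure_run_true_le (hπ : ∀ t z, π t z ∈ Set.Ico (0 : ℝ) 1) (hR : R.Regular) {δ : ℝ}
    (hδ : 0 < δ) (hπδ : ∀ t z, π t z ≤ 1 - δ) {K : Set Ω} (hKm : MeasurableSet K) {n : ℕ}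
    (hK : ∀ t, MeasurableSet[S.curr (t + 1)] (K ∩ S.inStage π X b₁ bK d n (t + 1))) {x b : ℝ}
    (hx : 0 < x)
    (hthr : ∀ ω j i a, ω ∈ S.inStage π X b₁ bK d n j → S.stageEnd π X b₁ bK d ω n = (a : ℕ) →
      a < i → i < j → S.odds π X i ω < b)
    (hstart : ∀ᵐ ω ∂S.P, ∀ s j, ω ∈ S.run π X b₁ bK d K n true (s + 1) →
      (∀ i ≤ s, ω ∉ S.run π X b₁ bK d K n true i) → s + 1 ≤ j →
      ω ∈ S.run π X b₁ bK d K n true j → x ≤ S.odds π X s ω + transitionProb π X (s + 1) ω)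
    {m c : ℝ} (hc : 0 < c) (hm : R.secondMoment / (4 * c) < m) {t₀ : ℕ}
    (hdrift : ∀ j ≥ t₀, ∀ ω ∈ S.inStage π X b₁ bK d n j, m ≤ R.I (X j ω) + hazard π X j ω) :
    ∑' j, S.P (S.run π X b₁ bK d K n true j) ≤
      ENNReal.ofReal ((max 0 (Real.log b - Real.log x) + c + -Real.log δ + m * t₀) /
        (m - R.secondMoment / (4 * c))) * S.P K := by
  have hhm : ∀ j, Measurable fun ω => max 0 (hazard π X j ω) := fun j =>
    measurable_const.max (Real.measurable_log.comp (measurable_const.sub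
      ((measurable_transitionProb_prev hX j).mono (S.prev_le j) le_rfl))).neg
  have hhaz : ∀ j ω, max 0 (hazard π X j ω) = hazard π X j ω := fun j ω =>
    max_eq_right (hazard_nonneg hπ j ω)
  simp only [hhaz] at hhm
  refine sum_measure_le_of_drift hX hR true (fun j => measurableSet_run hX hK true j) (run_zero K n true)
    (fun j ω hω => hω.2) hhm (fun j ω => hazard_nonneg hπ j ω) (fun j ω => hazard_le hδ hπδ j ω)
    hKm (fun j => Set.inter_subset_left.trans Set.inter_subset_left) (le_max_left _ _) ?_ hc hm
    (t₀ := t₀) (fun j hj ω hω => hdrift j hj ω hω.1.2)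
  have hodds : ∀ᵐ ω ∂S.P, ∀ t, S.odds π X t ω = S.ratio π Set.univ X t ω :=
    ae_all_iff.mpr fun t => odds_ae_eq hX hπ hR t
  filter_upwards [hstart, hodds, ae_response_pos (S := S) (π := π) (X := X) hR] with ω h1 h2 h3 j hj
  obtain ⟨s, hs1, hs2, hs3, hsum⟩ := sum_indicator_eq
    (ξ := fun j ω => R.llr true (X j ω) (S.response π X j ω) + hazard π X j ω)
    (fun i r hi hir hrj => run_up hj hi hir hrj) (by rw [run_zero]; exact Set.notMem_empty ω) hj
  rw [hsum]
  rcases hs3.eq_or_lt with rfl | hlt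
  · simp
  · obtain ⟨t, rfl⟩ := Nat.exists_eq_add_of_lt hlt
    refine le_trans ?_ (le_max_right _ _)
    have hst := h1 s _ hs1 hs2 hs3 hj
    rw [h2 s] at hst
    have h4 := mul_exp_le_ratio hπ h3 (show s ≤ s + t by omega) hst
    obtain ⟨a, ha, haj⟩ := exists_start_of_inStage hj.1.2
    have has : a < s + 1 := by
      have := hs1.1.2.1
      rw [ha] at this
      exact_mod_cast this
    have h5 := hthr ω _ (s + t + 1) a hj.1.2 ha (by omega) (by omega)
    rw [h2] at h5
    have h6 := sum_le_log_of_mul_exp_lt hx (h4.trans_lt h5)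
    rw [show s + 1 + t + 1 = s + t + 1 + 1 by omega, Finset.Ico_add_one_right_eq_Icc]
    exact h6

/-- The expected number of pre-change steps in an assessment stage. -/
theorem IsMasteryRule.sum_measure_run_odd_false_le (h : S.IsMasteryRule π X b₁ bK d)
    (hR : R.Regular) {K : Set Ω} (hKm : MeasurableSet K) {m : ℕ}
    (hK : ∀ t, MeasurableSet[S.curr (t + 1)] (K ∩ S.inStage π X b₁ bK d (2 * m + 1) (t + 1)))
    {c : ℝ} (hc : 0 < c) (hm : R.secondMoment / (4 * c) < R.J (Fin.last k)) :
    ∑' j, S.P (S.run π X b₁ bK d K (2 * m + 1) false j) ≤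
      ENNReal.ofReal ((max 0 (Real.log d) + c) /
        (R.J (Fin.last k) - R.secondMoment / (4 * c))) * S.P K := by
  have key := sum_measure_le_of_drift hX hR false (q := fun _ _ => 0) (κ := 0) (m := R.J (Fin.last k))
    (t₀ := 0) (c := c) (b := max 0 (Real.log d)) (E := K)
    (fun j => measurableSet_run hX hK false j) (run_zero K (2 * m + 1) false)
    (fun j ω hω => hω.2) (fun j => measurable_const) (fun _ _ => le_rfl) (fun _ _ => le_rfl)
    hKm (fun j => Set.inter_subset_left.trans Set.inter_subset_left) (le_max_left _ _) ?_ hc hm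
    (fun j _ ω hω => by rw [h.treatment_odd hω.1.2, add_zero]; exact le_rfl)
  · simpa using key
  filter_upwards [ae_response_pos (S := S) (π := π) (X := X) hR] with ω h3 j hj
  obtain ⟨s, hs1, hs2, hs3, hsum⟩ := sum_indicator_eq
    (ξ := fun j ω => R.llr false (X j ω) (S.response π X j ω) + 0)
    (fun i r hi hir hrj => run_up hj hi hir hrj) (by rw [run_zero]; exact Set.notMem_empty ω) hj
  rw [hsum]
  obtain ⟨a, ha, haj⟩ := exists_start_of_inStage hj.1.2
  have has : a < s + 1 := by
    have := hs1.1.2.1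
    rw [ha] at this
    exact_mod_cast this
  have hsa : s = a := by
    by_contra hne
    refine hs2 s le_rfl ⟨⟨hj.1.1, ?_, ?_⟩, ?_⟩
    · rw [ha]; exact_mod_cast (by omega : a < s)
    · exact le_trans (by exact_mod_cast (by omega : s ≤ j)) hj.1.2.2
    · change S.L π X s ω = false
      by_contra hL
      rw [Bool.not_eq_false] at hL
      have := L_mono (show s ≤ j by omega) hL
      rw [show S.L π X j ω = false from hj.2] at this
      simp at this
  subst hsa
  rcases hs3.eq_or_lt with rfl | hlt
  · simp
  · obtain ⟨r, rfl⟩ := Nat.exists_eq_add_of_lt hlt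
    refine le_trans ?_ (le_max_right _ _)
    have h4 := (lt_of_inStage_odd hj.1.2 ha (s := r + 1) (by omega) (by omega)).2
    have hpos : ∀ i ∈ Finset.Icc 1 (r + 1), 0 < R.f (Fin.last k) (S.response π X (s + i) ω) /
        R.g (Fin.last k) (S.response π X (s + i) ω) ∧ X (s + i) ω = Fin.last k := by
      intro i hi
      rw [Finset.mem_Icc] at hi
      have h5 : X (s + i) ω = Fin.last k := h.treatment_odd
        (run_up hj hs1 (j := s + i) (by omega) (by omega)).1.2
      have h6 := h3 (s + i) (by omega)
      rw [h5] at h6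
      exact ⟨div_pos h6.1 h6.2, h5⟩
    have h5 := Real.log_lt_log (Finset.prod_pos fun i hi => (hpos i hi).1) h4
    rw [Real.log_prod fun i hi => (hpos i hi).1.ne'] at h5
    rw [show s + 1 + r + 1 = s + 1 + (r + 1) by omega, sum_Ico_shift]
    refine le_trans (le_of_eq ?_) h5.le
    refine Finset.sum_congr rfl fun i hi => ?_
    rw [(hpos i hi).2]
    simp [ResponseModel.llr]

/-- The expected number of post-change steps in a training stage. The first of them, whether it
brings the change or not, is taken with a transition probability of at least `ζ`. -/
theorem IsMasteryRule.sum_measure_run_even_true_le (h : S.IsMasteryRule π X b₁ bK d)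
    (hπ : ∀ t z, π t z ∈ Set.Ico (0 : ℝ) 1) (hR : R.Regular) {δ : ℝ}
    (hδ : 0 < δ) (hπδ : ∀ t z, π t z ≤ 1 - δ) {ζ : ℝ} (hζ0 : 0 < ζ)
    (hζ : ∀ t ω, X (t + 1) ω = 0 → ζ ≤ transitionProb π X (t + 1) ω)
    {K : Set Ω} (hKm : MeasurableSet K) {n : ℕ}
    (hK : ∀ t, MeasurableSet[S.curr (t + 1)] (K ∩ S.inStage π X b₁ bK d (2 * n) (t + 1)))
    {m c : ℝ} (hc : 0 < c) (hm : R.secondMoment / (4 * c) < m) {t₀ : ℕ}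
    (hdrift : ∀ j ≥ t₀, ∀ ω, X j ω = 0 → m ≤ R.I 0 + hazard π X j ω) :
    ∑' j, S.P (S.run π X b₁ bK d K (2 * n) true j) ≤
      ENNReal.ofReal ((max 0 (Real.log b₁ - Real.log ζ) + c + -Real.log δ + m * t₀) /
        (m - R.secondMoment / (4 * c))) * S.P K := by
  refine sum_measure_run_true_le hX hπ hR hδ hπδ hKm hK hζ0
    (fun ω j i a h1 h2 h3 h4 => odds_lt_of_inStage_even h1 h2 h3 h4) ?_ hc hm
    (fun j hj ω hω => ?_)
  · filter_upwards [ae_all_iff.mpr fun t => odds_ae_eq hX hπ hR t] with ω h1 s j hs _ _ _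
    rw [h1]
    exact (hζ s ω (h.treatment_even hs.1.2)).trans
      (le_add_of_nonneg_left (ratio_nonneg hπ s ω))
  · have h1 := h.treatment_even hω
    rw [h1]
    exact hdrift j hj ω h1

/-- The expected number of post-change steps in an assessment stage. If the change happens during the
stage, then the posterior odds at that time are still at least `b₁ / d`: they were at least `b₁` at
the start of the stage, and the product in the test has stayed below `d`. -/
theorem IsMasteryRule.sum_measure_run_odd_true_le (h : S.IsMasteryRule π X b₁ bK d)
    (hπ : ∀ t z, π t z ∈ Set.Ico (0 : ℝ) 1) (hR : R.Regular) {δ : ℝ}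
    (hδ : 0 < δ) (hπδ : ∀ t z, π t z ≤ 1 - δ) (hb₁ : 0 < b₁) (hd : 1 ≤ d)
    {K : Set Ω} (hKm : MeasurableSet K) {n : ℕ}
    (hK : ∀ t, MeasurableSet[S.curr (t + 1)] (K ∩ S.inStage π X b₁ bK d (2 * n + 1) (t + 1)))
    {m c : ℝ} (hc : 0 < c) (hm : R.secondMoment / (4 * c) < m) {t₀ : ℕ}
    (hdrift : ∀ j ≥ t₀, ∀ ω, X j ω = Fin.last k → m ≤ R.I (Fin.last k) + hazard π X j ω) :
    ∑' j, S.P (S.run π X b₁ bK d K (2 * n + 1) true j) ≤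
      ENNReal.ofReal ((max 0 (Real.log bK - Real.log (b₁ / d)) + c + -Real.log δ + m * t₀) /
        (m - R.secondMoment / (4 * c))) * S.P K := by
  have hd0 : 0 < d := by linarith
  refine sum_measure_run_true_le hX hπ hR hδ hπδ hKm hK (div_pos hb₁ hd0)
    (fun ω j i a h1 h2 h3 h4 => ?_) ?_ hc hm (fun j hj ω hω => ?_)
  · obtain ⟨s, rfl⟩ := Nat.exists_eq_add_of_lt h3
    exact (lt_of_inStage_odd h1 h2 (s := s + 1) (by omega) (by omega)).1
  · filter_upwards [ae_all_iff.mpr fun t => odds_ae_eq hX hπ hR t,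
      ae_response_pos (S := S) (π := π) (X := X) hR] with ω h1 h3 s j hs _ hsj hj
    refine le_trans ?_ (le_add_of_nonneg_right (hπ _ _).1)
    obtain ⟨a, ha, has⟩ := exists_start_of_inStage hs.1.2
    have h4 := odds_ge_of_stageEnd_even ha
    rcases (Nat.lt_succ_iff.mp has).eq_or_lt with rfl | hlt
    · exact (div_le_self hb₁.le hd).trans h4
    · obtain ⟨r, rfl⟩ := Nat.exists_eq_add_of_lt hlt
      have h5 := (lt_of_inStage_odd hs.1.2 ha (s := r + 1) (by omega) (by omega)).2
      rw [h1] at h4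
      have h6 := mul_exp_le_ratio (S := S) (X := X) hπ h3 (show a ≤ a + r by omega)
        (h4.trans (le_add_of_nonneg_right (hπ _ _).1))
      have hpos : ∀ i ∈ Finset.Icc 1 (r + 1), (0 < R.f (Fin.last k) (S.response π X (a + i) ω) ∧
          0 < R.g (Fin.last k) (S.response π X (a + i) ω)) ∧ X (a + i) ω = Fin.last k := by
        intro i hi
        rw [Finset.mem_Icc] at hi
        have h5 : X (a + i) ω = Fin.last k := h.treatment_odd (m := n)
          ⟨by rw [ha]; exact_mod_cast (by omega : a < a + i),
            le_trans (by exact_mod_cast (by omega : a + i ≤ a + r + 1 + 1)) hs.1.2.2⟩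
        have h6 := h3 (a + i) (by omega)
        rw [h5] at h6
        exact ⟨h6, h5⟩
      rw [h1]
      refine le_trans ?_ h6
      -- the odds at the start of the stage are divided at most by the product in the test
      have h7 : -Real.log d ≤ ∑ j ∈ Finset.Icc (a + 1) (a + r + 1),
          (R.llr true (X j ω) (S.response π X j ω) + hazard π X j ω) := by
        have h8 := Real.log_lt_log
          (Finset.prod_pos fun i hi => div_pos (hpos i hi).1.1 (hpos i hi).1.2) h5
        rw [Real.log_prod fun i hi => (div_pos (hpos i hi).1.1 (hpos i hi).1.2).ne'] at h8
        rw [← Finset.Ico_add_one_right_eq_Icc, show a + r + 1 + 1 = a + 1 + (r + 1) by omega,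
          sum_Ico_shift]
        have h9 : ∑ i ∈ Finset.Icc 1 (r + 1), -Real.log (R.f (Fin.last k) (S.response π X (a + i) ω) /
            R.g (Fin.last k) (S.response π X (a + i) ω)) ≤ ∑ i ∈ Finset.Icc 1 (r + 1),
            (R.llr true (X (a + i) ω) (S.response π X (a + i) ω) + hazard π X (a + i) ω) := by
          refine Finset.sum_le_sum fun i hi => ?_
          have h10 := hazard_nonneg (X := X) hπ (a + i) ω
          rw [(hpos i hi).2, ← Real.log_inv, inv_div]
          simp only [ResponseModel.llr, if_true]
          linarith
        rw [Finset.sum_neg_distrib] at h9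
        linarith
      rw [div_eq_mul_inv]
      refine mul_le_mul_of_nonneg_left ?_ hb₁.le
      rw [← Real.exp_log hd0, ← Real.exp_neg, Real.exp_le_exp]
      exact h7
  · have h1 := h.treatment_odd hω
    rw [h1]
    exact hdrift j hj ω h1

/-- The expected number of post-change steps in an assessment stage that starts after the change, and
hence with posterior odds of at least `b₁`. -/
theorem IsMasteryRule.sum_measure_run_odd_true_le_of_changed (h : S.IsMasteryRule π X b₁ bK d)
    (hπ : ∀ t z, π t z ∈ Set.Ico (0 : ℝ) 1) (hR : R.Regular) {δ : ℝ}
    (hδ : 0 < δ) (hπδ : ∀ t z, π t z ≤ 1 - δ) (hb₁ : 0 < b₁)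
    {K : Set Ω} (hKm : MeasurableSet K) {n : ℕ}
    (hKL : ∀ ω ∈ K, ∀ a : ℕ, S.stageEnd π X b₁ bK d ω (2 * n + 1) = a → S.L π X a ω = true)
    (hK : ∀ t, MeasurableSet[S.curr (t + 1)] (K ∩ S.inStage π X b₁ bK d (2 * n + 1) (t + 1)))
    {m c : ℝ} (hc : 0 < c) (hm : R.secondMoment / (4 * c) < m) {t₀ : ℕ}
    (hdrift : ∀ j ≥ t₀, ∀ ω, X j ω = Fin.last k → m ≤ R.I (Fin.last k) + hazard π X j ω) :
    ∑' j, S.P (S.run π X b₁ bK d K (2 * n + 1) true j) ≤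
      ENNReal.ofReal ((max 0 (Real.log bK - Real.log b₁) + c + -Real.log δ + m * t₀) /
        (m - R.secondMoment / (4 * c))) * S.P K := by
  refine sum_measure_run_true_le hX hπ hR hδ hπδ hKm hK hb₁
    (fun ω j i a h1 h2 h3 h4 => ?_) (Eventually.of_forall fun ω s j hs hs2 hsj hj => ?_) hc hm
    (fun j hj ω hω => ?_)
  · obtain ⟨s, rfl⟩ := Nat.exists_eq_add_of_lt h3
    exact (lt_of_inStage_odd h1 h2 (s := s + 1) (by omega) (by omega)).1
  · refine le_trans ?_ (le_add_of_nonneg_right (hπ _ _).1)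
    obtain ⟨a, ha, has⟩ := exists_start_of_inStage hs.1.2
    have hsa : s = a := by
      by_contra hne
      have h1 := L_mono (show a ≤ s by omega) (hKL ω hs.1.1 a ha)
      refine hs2 s le_rfl ⟨⟨hs.1.1, ?_, ?_⟩, h1⟩
      · rw [ha]; exact_mod_cast (by omega : a < s)
      · exact le_trans (by exact_mod_cast (by omega : s ≤ s + 1)) hs.1.2.2
    rw [hsa]
    exact odds_ge_of_stageEnd_even ha
  · have h1 := h.treatment_odd hω
    rw [h1]
    exact hdrift j hj ω h1

end

end System

end

end ChangeAccel

namespace ChangeAccel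

noncomputable section

/-! ### Admissibility of the mastery-learning procedure -/

theorem zeta_le {k : ℕ} {π : Transition k} (hπ : ∀ t z, 0 ≤ π t z) (x : Fin (k + 1)) (t : ℕ)
    (z : Fin t → Fin (k + 1)) :
    zeta π x ≤ π (t + 1) (Fin.snoc (α := fun _ => Fin (k + 1)) z x) := by
  refine (ciInf_le ⟨0, ?_⟩ t).trans (ciInf_le ⟨0, ?_⟩ z)
  · rintro _ ⟨t, rfl⟩
    exact Real.iInf_nonneg fun z => hπ _ _
  · rintro _ ⟨z, rfl⟩
    exact hπ _ _

theorem transitionProb_eq_snoc {k : ℕ} {Ω : Type*} {π : Transition k} {X : ℕ → Ω → Fin (k + 1)}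
    {t : ℕ} {ω : Ω} {x : Fin (k + 1)} (h : X (t + 1) ω = x) :
    transitionProb π X (t + 1) ω =
      π (t + 1) (Fin.snoc (α := fun _ => Fin (k + 1)) (fun i : Fin t => X (i + 1) ω) x) := by
  unfold transitionProb
  congr 1
  funext i
  refine Fin.lastCases ?_ (fun i => ?_) i
  · simp [h]
  · simp

theorem zeta_le_transitionProb {k : ℕ} {Ω : Type*} {π : Transition k} (hπ : ∀ t z, 0 ≤ π t z)
    {X : ℕ → Ω → Fin (k + 1)} {t : ℕ} {ω : Ω} {x : Fin (k + 1)} (h : X (t + 1) ω = x) :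
    zeta π x ≤ transitionProb π X (t + 1) ω := by
  rw [transitionProb_eq_snoc h]
  exact zeta_le hπ x t _

namespace System

variable {k : ℕ} {Y : Type*} [mY : MeasurableSpace Y] {R : ResponseModel k Y}
  {Ω : Type*} [mΩ : MeasurableSpace Ω] {S : System R Ω} {π : Transition k}
  {X : ℕ → Ω → Fin (k + 1)} {b₁ bK d : ℝ}

theorem masteryTime_le_of_success {ω : Ω} {m : ℕ} (h : ω ∈ S.success π X b₁ bK d m) :
    S.masteryTime π X b₁ bK d ω ≤ S.stageEnd π X b₁ bK d ω (2 * m + 2) := by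
  classical
  have hex : ∃ i, ω ∈ S.success π X b₁ bK d i := ⟨m, h⟩
  rw [masteryTime_of_success (Nat.find_spec hex) fun i hi => Nat.find_min hex hi]
  have h2 : Nat.find hex ≤ m := Nat.find_min' hex h
  exact stageEnd_mono X b₁ bK d ω (by omega)

/-- The procedure stops by the time the posterior odds reach `bK` in an assessment stage. -/
theorem masteryTime_le_of_inStage_odd {ω : Ω} {m n : ℕ} (h : ω ∈ S.inStage π X b₁ bK d (2 * m + 1) n)
    (hn : bK ≤ S.odds π X n ω) : S.masteryTime π X b₁ bK d ω ≤ n := by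
  obtain ⟨a, ha, han⟩ := exists_start_of_inStage h
  obtain ⟨s, rfl⟩ := Nat.exists_eq_add_of_lt han
  have h2 := h.2
  rw [stageEnd_odd, ha, ENat.toNat_natCast] at h2
  have h3 : S.sigma π X bK a ω ≤ (s + 1 : ℕ) :=
    firstTime_le.mpr ⟨s + 1, le_rfl, by omega, by rwa [← add_assoc]⟩
  have h4 : ((s + 1 : ℕ) : ℕ∞) ≤ min (S.sigma π X bK a ω) (S.tau π X d a ω) := by
    refine (ENat.add_le_add_iff_left (ENat.natCast_ne_top a)).mp (le_trans (le_of_eq ?_) h2)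
    push_cast
    rw [add_assoc]
  have h5 : S.sigma π X bK a ω ≤ S.tau π X d a ω := h3.trans (h4.trans (min_le_right _ _))
  have h6 : ω ∈ S.success π X b₁ bK d m := by
    change S.sigma π X bK (S.stageEnd π X b₁ bK d ω (2 * m + 1)).toNat ω ≤
      S.tau π X d (S.stageEnd π X b₁ bK d ω (2 * m + 1)).toNat ω
    rwa [ha, ENat.toNat_natCast]
  refine (masteryTime_le_of_success h6).trans ?_
  rw [stageEnd_odd, ha, ENat.toNat_natCast, min_eq_left h5]
  calc (a : ℕ∞) + S.sigma π X bK a ω ≤ a + (s + 1 : ℕ) := by gcongr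
    _ = _ := by push_cast; rw [add_assoc]

/-- The procedure stops when the posterior odds are large at two consecutive times: the first of
these ends a training stage or the procedure, the second one ends the procedure. -/
theorem masteryTime_le_of_odds_ge {ω : Ω} {n : ℕ} (hn : 1 ≤ n) {b : ℝ} (hb₁ : b₁ ≤ b) (hbK : bK ≤ b)
    (h1 : b ≤ S.odds π X n ω) (h2 : b ≤ S.odds π X (n + 1) ω) :
    S.masteryTime π X b₁ bK d ω ≤ (n + 1 : ℕ) := by
  obtain ⟨i, hi⟩ := exists_inStage (S := S) (π := π) (X := X) (b₁ := b₁) (bK := bK) (d := d) ω hn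
  rcases Nat.even_or_odd' i with ⟨m, rfl | rfl⟩
  · refine masteryTime_le_of_inStage_odd (m := m) ⟨?_, ?_⟩ (hbK.trans h2)
    · rw [lt_natCast_succ_iff]
      by_contra hlt
      obtain ⟨a, ha, han⟩ := exists_start_of_inStage hi
      have h3 : ω ∈ S.inStage π X b₁ bK d (2 * m) (n + 1) :=
        ⟨hi.1.trans (by exact_mod_cast Nat.lt_succ_self n), natCast_succ_le_iff.mpr (not_le.mp hlt)⟩
      exact absurd (odds_lt_of_inStage_even h3 ha han (Nat.lt_succ_self n)) (not_lt.mpr (hb₁.trans h1))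
    · refine le_trans ?_ (stageEnd_add_one_le ω (2 * m + 1))
      push_cast
      gcongr
      exact hi.2
  · exact (masteryTime_le_of_inStage_odd hi (hbK.trans h1)).trans (by exact_mod_cast Nat.le_succ n)

section

variable (hX : ∀ t, Measurable[S.obs π X t] (X (t + 1)))
include hX

/-- The procedure stops with posterior odds of at least `bK`, so that it rarely stops before the
change. -/
theorem measure_masteryTime_lt_changePoint_le (hπ : ∀ t z, π t z ∈ Set.Ico (0 : ℝ) 1)
    (hR : R.Regular) (hb : 0 ≤ bK) :
    S.P {ω | S.masteryTime π X b₁ bK d ω < S.Θ π X ω} ≤ ENNReal.ofReal (1 / (1 + bK)) := by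
  have hP := S.isProb
  have e : {ω | S.masteryTime π X b₁ bK d ω < S.Θ π X ω} ⊆
      ⋃ t : ℕ, {ω | S.masteryTime π X b₁ bK d ω = t} ∩ {ω | S.L π X t ω = false} := by
    intro ω hω
    obtain ⟨t, ht⟩ := ENat.ne_top_iff_exists.mp (ne_top_of_lt hω)
    refine Set.mem_iUnion.mpr ⟨t, ht.symm, ?_⟩
    have h1 : S.masteryTime π X b₁ bK d ω < S.Θ π X ω := hω
    rw [← ht, lt_Θ_iff] at h1
    exact h1
  have h1 : ENNReal.ofReal (1 + bK) * ∑' t : ℕ,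
      S.P ({ω | S.masteryTime π X b₁ bK d ω = t} ∩ {ω | S.L π X t ω = false}) ≤ 1 := by
    rw [← ENNReal.tsum_mul_left]
    refine (ENNReal.tsum_le_tsum fun t => ofReal_mul_measure_le hX hπ hR (measurableSet_masteryTime t)
      hb fun ω hω => odds_ge_of_masteryTime hω).trans ?_
    rw [← measure_iUnion]
    · exact prob_le_one
    · intro i j hij
      rw [Function.onFun, Set.disjoint_left]
      intro ω hi hj
      rw [Set.mem_ofPred_eq] at hi hj
      rw [hi] at hj
      exact hij (by exact_mod_cast hj)
    · exact fun t => obs_le hX t _ (measurableSet_masteryTime t)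
  have h4 : ENNReal.ofReal (1 / (1 + bK)) * ENNReal.ofReal (1 + bK) = 1 := by
    rw [← ENNReal.ofReal_mul (by positivity), one_div_mul_cancel (by positivity), ENNReal.ofReal_one]
  calc S.P _ ≤ ∑' t : ℕ, S.P ({ω | S.masteryTime π X b₁ bK d ω = t} ∩ {ω | S.L π X t ω = false}) :=
        (measure_mono e).trans (measure_iUnion_le _)
    _ = ENNReal.ofReal (1 / (1 + bK)) * (ENNReal.ofReal (1 + bK) * ∑' t : ℕ,
      S.P ({ω | S.masteryTime π X b₁ bK d ω = t} ∩ {ω | S.L π X t ω = false})) := by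
        rw [← mul_assoc, h4, one_mul]
    _ ≤ _ := by
        conv_rhs => rw [← mul_one (ENNReal.ofReal _)]
        gcongr

/-- The change happens almost surely: otherwise the assessment stages would all be finite, hence
infinitely many training steps would be taken, each of which may bring the change. -/
theorem IsMasteryRule.ae_changePoint_lt_top (h : S.IsMasteryRule π X b₁ bK d)
    (hπ : ∀ t z, π t z ∈ Set.Ico (0 : ℝ) 1) (hR : R.Regular) {ζ : ℝ} (hζ0 : 0 < ζ)
    (hζ : ∀ t ω, X (t + 1) ω = 0 → ζ ≤ transitionProb π X (t + 1) ω) :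
    ∀ᵐ ω ∂S.P, S.Θ π X ω < ⊤ := by
  have hP := S.isProb
  have hI : ∀ t z, π t z ∈ Set.Icc (0 : ℝ) 1 := fun t z => ⟨(hπ t z).1, (hπ t z).2.le⟩
  -- there are finitely many training steps before the change
  have h1 : ∀ᵐ ω ∂S.P, {j | ω ∈ (⋃ m, S.inStage π X b₁ bK d (2 * m) (j + 1)) ∩
      {ω | S.L π X j ω = false}}.Finite := by
    refine ae_finite_setOfPred_mem (ne_top_of_le_ne_top ?_ (sum_measure_le_of_transition hX hI
      (E := Set.univ) (fun j => ?_) (fun j ω hω => hω.2) (fun j => Set.subset_univ _) hζ0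
      (fun j ω hω => ?_)))
    · exact ENNReal.mul_ne_top ENNReal.ofReal_ne_top (measure_ne_top _ _)
    · refine measurableSet_inter_of (m := S.prev (j + 1)) (MeasurableSet.iUnion fun m => ?_)
        (measurableSet_L_prev hX j false)
      exact obs_le_prev hX j _ (measurableSet_inStage (2 * m) j)
    · obtain ⟨m, hm⟩ := Set.mem_iUnion.mp hω.1
      exact hζ j ω (h.treatment_even hm)
  -- the overshoot takes only a part of the drift `J` of the test
  obtain ⟨c, hc, hcm⟩ : ∃ c : ℝ, 0 < c ∧ R.secondMoment / (4 * c) < R.J (Fin.last k) := by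
    have hJ := hR.J_pos (Fin.last k)
    have hV := R.secondMoment_nonneg
    refine ⟨(R.secondMoment + 1) / (4 * R.J (Fin.last k)), by positivity, ?_⟩
    rw [div_lt_iff₀ (by positivity)]
    field_simp
    linarith
  -- every assessment stage has finitely many pre-change steps
  have h2 : ∀ᵐ ω ∂S.P, ∀ m, {j | ω ∈ S.run π X b₁ bK d Set.univ (2 * m + 1) false j}.Finite := by
    refine ae_all_iff.mpr fun m => ae_finite_setOfPred_mem (ne_top_of_le_ne_top ?_
      (h.sum_measure_run_odd_false_le hX hR MeasurableSet.univ (fun t => ?_) hc hcm))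
    · exact ENNReal.mul_ne_top ENNReal.ofReal_ne_top (measure_ne_top _ _)
    · rw [Set.univ_inter]
      exact obs_le_curr hX t _ (measurableSet_inStage _ t)
  filter_upwards [h1, h2] with ω hω1 hω2
  by_contra hΘ
  have hL : ∀ j, S.L π X j ω = false := fun j => by
    rw [← lt_Θ_iff, not_lt_top_iff.mp hΘ]
    exact ENat.natCast_lt_top j
  obtain ⟨N, hN⟩ := hω1.bddAbove
  have hodd : ∀ j ≥ N + 1, ∀ m, ω ∉ S.inStage π X b₁ bK d (2 * m) (j + 1) := by
    intro j hj m hm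
    have : j ≤ N := hN ⟨Set.mem_iUnion.mpr ⟨m, hm⟩, hL j⟩
    omega
  obtain ⟨i, hi⟩ := exists_inStage (S := S) (π := π) (X := X) (b₁ := b₁) (bK := bK) (d := d) ω
    (show 1 ≤ N + 1 + 1 by omega)
  rcases Nat.even_or_odd' i with ⟨m, rfl | rfl⟩
  · exact hodd (N + 1) le_rfl m hi
  · have hfin : S.stageEnd π X b₁ bK d ω (2 * m + 1 + 1) ≠ ⊤ := by
      intro htop
      refine (Set.Ici_infinite (N + 1 + 1)) ((hω2 m).subset fun j hj => ?_)
      refine ⟨⟨Set.mem_univ _, hi.1.trans_le (by exact_mod_cast hj), ?_⟩, hL j⟩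
      rw [htop]; exact le_top
    obtain ⟨b, hb⟩ := ENat.ne_top_iff_exists.mp hfin
    have hbN : N + 1 + 1 ≤ b := by
      have := hi.2
      rw [← hb] at this
      exact_mod_cast this
    refine hodd b (by omega) (m + 1) ⟨?_, ?_⟩
    · rw [show 2 * (m + 1) = 2 * m + 1 + 1 by ring, ← hb]
      exact_mod_cast Nat.lt_succ_self b
    · refine le_trans ?_ (stageEnd_add_one_le ω _)
      rw [show 2 * (m + 1) = 2 * m + 1 + 1 by ring, ← hb]
      push_cast
      exact le_rfl

/-- The procedure stops almost surely: the probability of posterior odds below `b` at time `n` is at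
most `1 + b` times the probability of no change by time `n`, and hence small for large `n`. -/
theorem ae_masteryTime_lt_top (hπ : ∀ t z, π t z ∈ Set.Ico (0 : ℝ) 1)
    (hR : R.Regular) (hΘ : ∀ᵐ ω ∂S.P, S.Θ π X ω < ⊤) :
    ∀ᵐ ω ∂S.P, S.masteryTime π X b₁ bK d ω < ⊤ := by
  have hP := S.isProb
  set b := max 0 (max b₁ bK) with hbdef
  have hb0 : 0 ≤ b := le_max_left _ _
  have hL : Tendsto (fun n => S.P {ω | S.L π X n ω = false}) atTop (𝓝 0) := by
    have hmono : Antitone fun n => {ω | S.L π X n ω = false} := by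
      intro i j hij ω hω
      by_contra h1
      rw [Set.mem_ofPred_eq, Bool.not_eq_false] at h1
      have := L_mono hij h1
      rw [show S.L π X j ω = false from hω] at this
      simp at this
    have h1 := tendsto_measure_iInter_atTop (μ := S.P)
      (fun n => (measurableSet_L hX n false).nullMeasurableSet) hmono ⟨0, measure_ne_top _ _⟩
    have h2 : S.P (⋂ n, {ω | S.L π X n ω = false}) = 0 := by
      refine measure_mono_null ?_ (ae_iff.mp hΘ)
      intro ω hω
      rw [Set.mem_ofPred_eq, not_lt, top_le_iff]
      by_contra h3
      obtain ⟨n, hn⟩ := ENat.ne_top_iff_exists.mp h3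
      have h4 : S.L π X n ω = false := Set.mem_iInter.mp hω n
      rw [← lt_Θ_iff, ← hn] at h4
      exact lt_irrefl _ h4
    rwa [h2] at h1
  have hodds : ∀ n, S.P {ω | S.odds π X n ω < b} ≤
      ENNReal.ofReal (1 + b) * S.P {ω | S.L π X n ω = false} := by
    intro n
    have hA : MeasurableSet[S.obs π X n] {ω | S.odds π X n ω < b} := by
      have := measurableSet_const_le (measurable_odds (S := S) (π := π) (X := X) n) b
      have h2 := MeasurableSet.compl this
      convert h2 using 1
      ext ω
      simp
    refine (measure_le_ofReal_mul hX hπ hR hA hb0 fun ω hω => (le_of_lt hω)).trans ?_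
    gcongr
    exact Set.inter_subset_right
  have key : ∀ n, S.P {ω | ¬ S.masteryTime π X b₁ bK d ω < ⊤} ≤
      ENNReal.ofReal (1 + b) * S.P {ω | S.L π X (n + 1) ω = false} +
      ENNReal.ofReal (1 + b) * S.P {ω | S.L π X (n + 2) ω = false} := by
    intro n
    refine le_trans ?_ (add_le_add (hodds (n + 1)) (hodds (n + 2)))
    refine le_trans (measure_mono fun ω hω => ?_) (measure_union_le _ _)
    by_contra hc
    rw [Set.mem_union, not_or, Set.mem_ofPred_eq, Set.mem_ofPred_eq, not_lt, not_lt] at hc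
    exact hω ((masteryTime_le_of_odds_ge (by omega) ((le_max_left _ _).trans (le_max_right _ _))
      ((le_max_right _ _).trans (le_max_right _ _)) hc.1 hc.2).trans_lt (ENat.natCast_lt_top _))
  have hlim : Tendsto (fun n => ENNReal.ofReal (1 + b) * S.P {ω | S.L π X (n + 1) ω = false} +
      ENNReal.ofReal (1 + b) * S.P {ω | S.L π X (n + 2) ω = false}) atTop (𝓝 0) := by
    have h1 := ENNReal.Tendsto.const_mul (a := ENNReal.ofReal (1 + b)) hL (Or.inr ENNReal.ofReal_ne_top)
    rw [mul_zero] at h1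
    have h2 := (h1.comp (tendsto_add_atTop_nat 1)).add (h1.comp (tendsto_add_atTop_nat 2))
    simpa using h2
  exact le_antisymm (ge_of_tendsto' hlim key) zero_le

end

/-- The mastery-learning procedure belongs to the class `C_α`, whatever the thresholds of its
training stages and of its tests. -/
theorem IsMasteryRule.inClass (h : S.IsMasteryRule π X b₁ bK d)
    (hπ : ∀ t z, π t z ∈ Set.Ico (0 : ℝ) 1) (hR : R.Regular) (hζ : 0 < zeta π 0) (hb : 0 ≤ bK)
    {α : ℝ} (hα : 1 / (1 + bK) ≤ α) : S.InClass π α (S.masteryTime π X b₁ bK d) X := by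
  have hP := S.isProb
  have hX := h.adapted
  have h1 := h.ae_changePoint_lt_top hX hπ hR hζ fun t ω =>
    zeta_le_transitionProb fun t z => (hπ t z).1
  have h2 := ae_masteryTime_lt_top (b₁ := b₁) (bK := bK) (d := d) hX hπ hR h1
  refine ⟨⟨hX, measurableSet_masteryTime⟩, ?_, ?_⟩
  · exact (measure_masteryTime_lt_changePoint_le hX hπ hR hb).trans (ENNReal.ofReal_le_ofReal hα)
  · rw [← measure_univ (μ := S.P)]
    exact measure_congr (eventuallyEq_univ.mpr (h2.and h1))

end System

end

end ChangeAccel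

namespace ChangeAccel

noncomputable section

/-! ### Unsuccessful cycles -/

theorem tsum_le_of_telescope {u v : ℕ → ℝ≥0∞} (h : ∀ n, u (n + 1) + v n ≤ u n) :
    ∑' n, v n ≤ u 0 := by
  have key : ∀ n, u n + ∑ i ∈ Finset.range n, v i ≤ u 0 := by
    intro n
    induction n with
    | zero => simp
    | succ n ih =>
      rw [Finset.sum_range_succ, add_comm (∑ i ∈ Finset.range n, v i), ← add_assoc]
      exact (add_le_add_left (h n) _).trans ih
  rw [ENNReal.tsum_eq_iSup_nat]
  exact iSup_le fun n => le_add_self.trans (key n)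

namespace System

variable {k : ℕ} {Y : Type*} [mY : MeasurableSpace Y] {R : ResponseModel k Y}
  {Ω : Type*} [mΩ : MeasurableSpace Ω] {S : System R Ω} {π : Transition k}
  {X : ℕ → Ω → Fin (k + 1)} {b₁ bK d : ℝ}

section

variable (hX : ∀ t, Measurable[S.obs π X t] (X (t + 1)))
include hX

/-- The test of an assessment stage that starts after the change ends the stage with probability at
most `1 / d`: the product in the test is then a nonnegative martingale. -/
theorem IsMasteryRule.measure_tau_lt_sigma_le (h : S.IsMasteryRule π X b₁ bK d) (hR : R.Regular)
    {m a : ℕ} {K : Set Ω} (hK : MeasurableSet[S.obs π X a] K)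
    (hKa : ∀ ω ∈ K, S.stageEnd π X b₁ bK d ω (2 * m + 1) = a) :
    ENNReal.ofReal d * S.P (K ∩ {ω | S.L π X a ω = true} ∩
      {ω | S.tau π X d a ω < S.sigma π X bK a ω}) ≤ S.P K := by
  have hP := S.isProb
  set M : ℕ → Ω → ℝ := fun n ω => ∏ i ∈ Finset.Icc 1 n,
    R.f (Fin.last k) (S.response π X (a + i) ω) / R.g (Fin.last k) (S.response π X (a + i) ω)
    with hM
  set K' : Set Ω := K ∩ {ω | S.L π X a ω = true} with hK'
  -- `n` steps of the stage have been taken without a decision, and another one follows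
  set G : ℕ → Set Ω := fun n => K' ∩ S.inStage π X b₁ bK d (2 * m + 1) (a + n + 1) with hG
  -- the test ends the stage with its step `n + 1`
  set F : ℕ → Set Ω := fun n =>
    K' ∩ ({ω | S.stageEnd π X b₁ bK d ω (2 * m + 2) = (a + n + 1 : ℕ)} ∩ {ω | d ≤ M (n + 1) ω}) with hF
  have hM0 : ∀ n ω, 0 ≤ M n ω := fun n ω =>
    Finset.prod_nonneg fun i _ => div_nonneg (R.f_nonneg _ _) (R.g_nonneg _ _)
  have hMs : ∀ n ω, M (n + 1) ω = M n ω * (R.f (Fin.last k) (S.response π X (a + n + 1) ω) /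
      R.g (Fin.last k) (S.response π X (a + n + 1) ω)) := fun n ω => by
    simp only [hM]
    rw [Finset.prod_Icc_succ_top (by omega)]
    rfl
  have hMm : ∀ n, Measurable[S.obs π X (a + n)] (M n) := fun n => by
    refine Finset.measurable_fun_prod (m := S.obs π X (a + n)) _ fun j hj => ?_
    rw [Finset.mem_Icc] at hj
    exact ((R.measurable_f _).div (R.measurable_g _)).comp
      (measurable_response_obs (by omega) (by omega))
  have hMm' : ∀ n, Measurable (M n) := fun n => (hMm n).mono (obs_le hX _) le_rfl
  have hK'm : MeasurableSet[S.prev (a + 1)] K' :=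
    measurableSet_inter_of (obs_le_prev hX a _ hK) (measurableSet_L_prev hX a true)
  have hGm : ∀ n, MeasurableSet[S.curr (a + n + 1)] (G n) := fun n =>
    measurableSet_inter_of
      (((S.prev_mono (by omega)).trans (S.prev_le_curr (a + n + 1))) _ hK'm)
      (obs_le_curr hX (a + n) _ (measurableSet_inStage _ _))
  have hFm : ∀ n, MeasurableSet (F n) := fun n =>
    (S.prev_le _ _ hK'm).inter ((obs_le hX (a + n + 1) _ (measurableSet_stageEnd_eq le_rfl)).inter
      (measurableSet_const_le (hMm' (n + 1)) d))
  have hGL : ∀ n, ∀ ω ∈ G n, S.L π X (a + n + 1) ω = true := fun n ω hω =>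
    L_mono (by omega) hω.1.2
  set u : ℕ → ℝ≥0∞ := fun n => ∫⁻ ω, (G n).indicator (fun ω => ENNReal.ofReal (M n ω)) ω ∂S.P with hu
  -- the factor added by a post-change response has conditional mean one
  have hint : ∀ n, ∫⁻ ω, (G n).indicator (fun ω => ENNReal.ofReal (M (n + 1) ω)) ω ∂S.P = u n := by
    intro n
    have h1 := lintegral_response hX (t := a + n + 1) (by omega)
      (Z := (G n).indicator fun ω => ENNReal.ofReal (M n ω))
      (Measurable.indicator (((hMm n).mono (obs_le_curr hX (a + n)) le_rfl).ennreal_ofReal) (hGm n))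
      (ψ := fun x y => ENNReal.ofReal (R.f x y / R.g x y))
      (fun x => ((R.measurable_f x).div (R.measurable_g x)).ennreal_ofReal) true
      (fun ω hω => hGL n ω (by by_contra h1; exact hω (Set.indicator_of_notMem h1 _)))
    simp only [hR.lintegral_inv_ratio, mul_one] at h1
    refine Eq.trans (lintegral_congr fun ω => ?_) h1
    by_cases hω : ω ∈ G n
    · rw [Set.indicator_of_mem hω, Set.indicator_of_mem hω, hMs, ENNReal.ofReal_mul (hM0 n ω),
        h.treatment_odd hω.2]
    · rw [Set.indicator_of_notMem hω, Set.indicator_of_notMem hω, zero_mul]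
  have hFG : ∀ n, F n ⊆ G n := fun n ω hω => by
    refine ⟨hω.1, ?_, ?_⟩
    · rw [hKa ω hω.1.1]
      exact_mod_cast (by omega : a < a + n + 1)
    · exact (show S.stageEnd π X b₁ bK d ω (2 * m + 1 + 1) = _ from hω.2.1).ge
  have hstep : ∀ n, u (n + 1) + ENNReal.ofReal d * S.P (F n) ≤ u n := by
    intro n
    rw [← hint n, hu, ← lintegral_indicator_const (hFm n), ← lintegral_add_right _
      (measurable_const.indicator (hFm n))]
    refine lintegral_mono fun ω => ?_
    by_cases hF' : ω ∈ F n
    · have h1 : ω ∉ G (n + 1) := by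
        intro h2
        have h3 := h2.2.2
        rw [show S.stageEnd π X b₁ bK d ω (2 * m + 1 + 1) = _ from hF'.2.1] at h3
        have : a + (n + 1) + 1 ≤ a + n + 1 := by exact_mod_cast h3
        omega
      rw [Set.indicator_of_notMem h1, Set.indicator_of_mem hF', Set.indicator_of_mem (hFG n hF'),
        zero_add]
      exact ENNReal.ofReal_le_ofReal hF'.2.2
    · rw [Set.indicator_of_notMem hF', add_zero]
      refine Set.indicator_le_indicator_of_subset (fun ω hω => ?_) (fun _ => zero_le) ω
      refine ⟨hω.1, ?_, le_trans (by exact_mod_cast (by omega : a + n + 1 ≤ a + (n + 1) + 1)) hω.2.2⟩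
      rw [hKa ω hω.1.1]
      exact_mod_cast (by omega : a < a + n + 1)
  have hsub : K ∩ {ω | S.L π X a ω = true} ∩ {ω | S.tau π X d a ω < S.sigma π X bK a ω} ⊆
      ⋃ n, F n := by
    rintro ω ⟨hω, hτ⟩
    obtain ⟨s, hs⟩ := ENat.ne_top_iff_exists.mp (ne_top_of_lt (show _ < _ from hτ))
    obtain ⟨⟨h1, h2⟩, -⟩ := firstTime_eq (show firstTime _ = (s : ℕ∞) from hs.symm)
    obtain ⟨n, rfl⟩ := Nat.exists_eq_add_of_le' h1
    refine Set.mem_iUnion.mpr ⟨n, hω, ?_, h2⟩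
    change S.stageEnd π X b₁ bK d ω (2 * m + 2) = _
    rw [stageEnd_odd, hKa ω hω.1, ENat.toNat_natCast, min_eq_right (le_of_lt hτ), ← hs]
    push_cast
    rw [add_assoc]
  calc _ ≤ ENNReal.ofReal d * ∑' n, S.P (F n) := by
        gcongr
        exact (measure_mono hsub).trans (measure_iUnion_le _)
    _ = ∑' n, ENNReal.ofReal d * S.P (F n) := ENNReal.tsum_mul_left.symm
    _ ≤ u 0 := tsum_le_of_telescope hstep
    _ ≤ ∫⁻ ω, K.indicator 1 ω ∂S.P := by
        refine lintegral_mono fun ω => ?_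
        by_cases hω : ω ∈ G 0
        · rw [Set.indicator_of_mem hω, Set.indicator_of_mem hω.1.1]
          simp [hM]
        · rw [Set.indicator_of_notMem hω]
          exact zero_le
    _ = S.P K := lintegral_indicator_one (obs_le hX a _ hK)

end

/-- Whether a cycle has been started, and its training stage ends at time `t`, is determined by the
responses up to time `t`. -/
theorem measurableSet_alive_stageEnd (m t : ℕ) : MeasurableSet[S.obs π X t]
    (S.alive π X b₁ bK d m ∩ {ω | S.stageEnd π X b₁ bK d ω (2 * m + 1) = t}) := by
  have e : S.alive π X b₁ bK d m ∩ {ω | S.stageEnd π X b₁ bK d ω (2 * m + 1) = t} =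
      (⋃ a ∈ Finset.range (t + 1),
          S.alive π X b₁ bK d m ∩ {ω | S.stageEnd π X b₁ bK d ω (2 * m) = a}) ∩
        {ω | S.stageEnd π X b₁ bK d ω (2 * m + 1) = t} := by
    ext ω
    simp only [Set.mem_inter_iff, Set.mem_ofPred_eq, Set.mem_iUnion, Finset.mem_range, exists_prop]
    constructor
    · rintro ⟨h1, h2⟩
      obtain ⟨a, ha⟩ := ENat.ne_top_iff_exists.mp h1.1.ne
      refine ⟨⟨a, ?_, h1, ha.symm⟩, h2⟩
      have h3 := stageEnd_mono (S := S) (π := π) X b₁ bK d ω (show 2 * m ≤ 2 * m + 1 by omega)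
      rw [← ha, h2] at h3
      have : a ≤ t := by exact_mod_cast h3
      omega
    · rintro ⟨⟨a, _, h1, _⟩, h2⟩
      exact ⟨h1, h2⟩
  rw [e]
  refine measurableSet_inter_of (m := S.obs π X t) ?_ (measurableSet_stageEnd_eq le_rfl)
  refine measurableSet_finset_biUnion (m := S.obs π X t) _ fun a ha => ?_
  exact obs_mono (Nat.lt_succ_iff.mp (Finset.mem_range.mp ha)) _ (measurableSet_alive_start m a)

section

variable (hX : ∀ t, Measurable[S.obs π X t] (X (t + 1)))
include hX

theorem sum_measure_alive_stageEnd_le (m : ℕ) :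
    ∑' a : ℕ, S.P (S.alive π X b₁ bK d m ∩ {ω | S.stageEnd π X b₁ bK d ω (2 * m + 1) = a}) ≤
      S.P (S.alive π X b₁ bK d m) := by
  rw [← measure_iUnion]
  · exact measure_mono (Set.iUnion_subset fun a => Set.inter_subset_left)
  · intro i j hij
    rw [Function.onFun, Set.disjoint_left]
    rintro ω ⟨_, hi⟩ ⟨_, hj⟩
    rw [Set.mem_ofPred_eq] at hi hj
    rw [hi] at hj
    exact hij (by exact_mod_cast hj)
  · exact fun t => obs_le hX t _ (measurableSet_alive_stageEnd m t)

/-- A training stage rarely ends before the change. -/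
theorem measure_alive_stageEnd_noChange_le (hπ : ∀ t z, π t z ∈ Set.Ico (0 : ℝ) 1)
    (hR : R.Regular) (hb₁ : 0 ≤ b₁) (m : ℕ) :
    S.P (⋃ a : ℕ, S.alive π X b₁ bK d m ∩ {ω | S.stageEnd π X b₁ bK d ω (2 * m + 1) = a} ∩
      {ω | S.L π X a ω = false}) ≤ ENNReal.ofReal (1 / (1 + b₁)) * S.P (S.alive π X b₁ bK d m) := by
  have h4 : ENNReal.ofReal (1 / (1 + b₁)) * ENNReal.ofReal (1 + b₁) = 1 := by
    rw [← ENNReal.ofReal_mul (by positivity), one_div_mul_cancel (by positivity), ENNReal.ofReal_one]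
  refine (measure_iUnion_le _).trans ?_
  refine le_trans ?_ (mul_le_mul_right (sum_measure_alive_stageEnd_le hX m) _)
  rw [← ENNReal.tsum_mul_left]
  refine ENNReal.tsum_le_tsum fun a => ?_
  have h1 := ofReal_mul_measure_le hX hπ hR (measurableSet_alive_stageEnd (b₁ := b₁) (bK := bK) (d := d) m a) hb₁
    fun ω hω => odds_ge_of_stageEnd_even hω.2
  calc _ = ENNReal.ofReal (1 / (1 + b₁)) * (ENNReal.ofReal (1 + b₁) * S.P _) := by
        rw [← mul_assoc, h4, one_mul]
    _ ≤ _ := by gcongr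

/-- A cycle is unsuccessful with small probability: its training stage ends before the change, or
its test rejects a change that has happened. -/
theorem IsMasteryRule.measure_alive_succ_le (h : S.IsMasteryRule π X b₁ bK d)
    (hπ : ∀ t z, π t z ∈ Set.Ico (0 : ℝ) 1) (hR : R.Regular) (hb₁ : 0 ≤ b₁) (hd : 0 < d) (m : ℕ) :
    S.P (S.alive π X b₁ bK d (m + 1)) ≤
      ENNReal.ofReal (1 / (1 + b₁) + 1 / d) * S.P (S.alive π X b₁ bK d m) := by
  set A : ℕ → Set Ω := fun a =>
    S.alive π X b₁ bK d m ∩ {ω | S.stageEnd π X b₁ bK d ω (2 * m + 1) = a} with hA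
  have hsub : S.alive π X b₁ bK d (m + 1) ⊆ (⋃ a : ℕ, A a ∩ {ω | S.L π X a ω = false}) ∪
      ⋃ a : ℕ, A a ∩ {ω | S.L π X a ω = true} ∩ {ω | S.tau π X d a ω < S.sigma π X bK a ω} := by
    rintro ω ⟨h1, h2⟩
    have h3 := (stageEnd_mono (S := S) (π := π) X b₁ bK d ω
      (show 2 * m + 1 ≤ 2 * (m + 1) by omega)).trans_lt h1
    obtain ⟨a, ha⟩ := ENat.ne_top_iff_exists.mp h3.ne
    have hωA : ω ∈ A a := ⟨⟨(stageEnd_mono (S := S) (π := π) X b₁ bK d ω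
      (show 2 * m ≤ 2 * (m + 1) by omega)).trans_lt h1, fun i hi => h2 i (by omega)⟩, ha.symm⟩
    have h4 : ¬ S.sigma π X bK (S.stageEnd π X b₁ bK d ω (2 * m + 1)).toNat ω ≤
      S.tau π X d (S.stageEnd π X b₁ bK d ω (2 * m + 1)).toNat ω := h2 m (by omega)
    rw [← ha, ENat.toNat_natCast, not_le] at h4
    by_cases hL : S.L π X a ω = true
    · exact Or.inr (Set.mem_iUnion.mpr ⟨a, ⟨hωA, hL⟩, h4⟩)
    · exact Or.inl (Set.mem_iUnion.mpr ⟨a, hωA, by simpa using hL⟩)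
  have h4 : ENNReal.ofReal (1 / d) * ENNReal.ofReal d = 1 := by
    rw [← ENNReal.ofReal_mul (by positivity), one_div_mul_cancel (by positivity), ENNReal.ofReal_one]
  refine (measure_mono hsub).trans ((measure_union_le _ _).trans ?_)
  rw [ENNReal.ofReal_add (by positivity) (by positivity), add_mul]
  refine add_le_add (measure_alive_stageEnd_noChange_le hX hπ hR hb₁ m) ?_
  refine (measure_iUnion_le _).trans ?_
  refine le_trans ?_ (mul_le_mul_right (sum_measure_alive_stageEnd_le hX m) _)
  rw [← ENNReal.tsum_mul_left]
  refine ENNReal.tsum_le_tsum fun a => ?_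
  have h1 := h.measure_tau_lt_sigma_le hX hR (measurableSet_alive_stageEnd (b₁ := b₁) (bK := bK) (d := d) m a)
    fun ω hω => hω.2
  calc _ = ENNReal.ofReal (1 / d) * (ENNReal.ofReal d * S.P _) := by
        rw [← mul_assoc, h4, one_mul]
    _ ≤ _ := by gcongr

end

end System

end

end ChangeAccel

namespace ChangeAccel

noncomputable section

/-! ### The expected duration of the mastery-learning procedure -/

/-- A bound for the expected number of steps until the sum of log-likelihood ratios and hazards
exceeds `b`, when the mean of each step is at least `m` from time `t₀` on.  The parameter `c` stems from
the bound `ξ ≤ c + ξ ^ 2 / (4 * c)` for the overshoot. -/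
def stepBound {k : ℕ} {Y : Type*} [MeasurableSpace Y] (R : ResponseModel k Y) (δ : ℝ) (t₀ : ℕ)
    (c m b : ℝ) : ℝ :=
  (max 0 b + c + -Real.log δ + m * t₀) / (m - R.secondMoment / (4 * c))

theorem stepBound_nonneg {k : ℕ} {Y : Type*} [MeasurableSpace Y] {R : ResponseModel k Y} {δ : ℝ}
    {t₀ : ℕ} {c m : ℝ} (b : ℝ) (hδ : 0 < δ) (hδ1 : δ ≤ 1) (hc : 0 < c)
    (hm : R.secondMoment / (4 * c) < m) : 0 ≤ stepBound R δ t₀ c m b := by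
  have h1 := Real.log_nonpos hδ.le hδ1
  have h2 : 0 ≤ R.secondMoment / (4 * c) := div_nonneg R.secondMoment_nonneg (by positivity)
  have h3 : 0 ≤ m * t₀ := mul_nonneg (h2.trans hm.le) (Nat.cast_nonneg _)
  have h4 := le_max_left 0 b
  exact div_nonneg (by linarith) (by linarith)

namespace System

variable {k : ℕ} {Y : Type*} [mY : MeasurableSpace Y] {R : ResponseModel k Y}
  {Ω : Type*} [mΩ : MeasurableSpace Ω] {S : System R Ω} {π : Transition k}
  {X : ℕ → Ω → Fin (k + 1)} {b₁ bK d : ℝ}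

theorem alive_zero : S.alive π X b₁ bK d 0 = Set.univ := by
  ext ω
  simp [alive, stageEnd]

theorem L_eq_of_treatment_eq {X' : ℕ → Ω → Fin (k + 1)} {ω : Ω} {n : ℕ}
    (h : ∀ s, 1 ≤ s → s ≤ n → X s ω = X' s ω) : S.L π X n ω = S.L π X' n ω := by
  have hp : ∀ s ≤ n, transitionProb π X s ω = transitionProb π X' s ω := by
    intro s hs
    unfold transitionProb
    congr 1
    funext i
    exact h (i + 1) (by omega) (by omega)
  have key : ∀ s ≤ n, S.L π X s ω = S.L π X' s ω := by
    intro s hs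
    unfold L
    induction s with
    | zero => simp only [latent, hp 0 hs]
    | succ s ih => simp only [latent, hp (s + 1) hs, ih (by omega)]
  exact key n le_rfl

section

variable (hX : ∀ t, Measurable[S.obs π X t] (X (t + 1)))
include hX

/-- The time until the procedure stops is the number of steps in the stages that it starts. -/
theorem expect_masteryTime_le_tsum : expect S.P (S.masteryTime π X b₁ bK d) ≤
    ∑' m, (∑' j, S.P (S.alive π X b₁ bK d m ∩ S.inStage π X b₁ bK d (2 * m) (j + 1)) +
      ∑' j, S.P (S.alive π X b₁ bK d m ∩ S.inStage π X b₁ bK d (2 * m + 1) (j + 1))) := by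
  have hT : Measurable (S.masteryTime π X b₁ bK d) :=
    measurableSet_of_stopping fun t => obs_le hX t _ (measurableSet_masteryTime t)
  rw [expect, lintegral_eq_tsum S.P fun j : ℕ => hT (t := Set.Ioi (j : ℕ∞)) MeasurableSet.of_discrete]
  have h1 : ∀ j : ℕ, S.P {ω | (j : ℕ∞) < S.masteryTime π X b₁ bK d ω} ≤
      ∑' m, (S.P (S.alive π X b₁ bK d m ∩ S.inStage π X b₁ bK d (2 * m) (j + 1)) +
        S.P (S.alive π X b₁ bK d m ∩ S.inStage π X b₁ bK d (2 * m + 1) (j + 1))) := by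
    intro j
    refine (measure_mono (t := ⋃ m,
      ((S.alive π X b₁ bK d m ∩ S.inStage π X b₁ bK d (2 * m) (j + 1)) ∪
      (S.alive π X b₁ bK d m ∩ S.inStage π X b₁ bK d (2 * m + 1) (j + 1)))) ?_).trans
      ((measure_iUnion_le _).trans (ENNReal.tsum_le_tsum fun m => measure_union_le _ _))
    intro ω hω
    have h2 : ((j + 1 : ℕ) : ℕ∞) ≤ S.masteryTime π X b₁ bK d ω := natCast_succ_le_iff.mpr hω
    obtain ⟨i, hi⟩ := exists_inStage (S := S) (π := π) (X := X) (b₁ := b₁) (bK := bK) (d := d) ω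
      (show 1 ≤ j + 1 by omega)
    rcases Nat.even_or_odd' i with ⟨m, rfl | rfl⟩
    · exact Set.mem_iUnion.mpr ⟨m, Or.inl ⟨mem_alive_of_le_masteryTime h2 hi le_rfl, hi⟩⟩
    · exact Set.mem_iUnion.mpr ⟨m, Or.inr ⟨mem_alive_of_le_masteryTime h2 hi (by omega), hi⟩⟩
  refine (ENNReal.tsum_le_tsum h1).trans ?_
  rw [ENNReal.tsum_comm]
  simp only [ENNReal.tsum_add]
  exact le_rfl

theorem tsum_measure_inStage_le_run (K : Set Ω) (n : ℕ) :
    ∑' j, S.P (K ∩ S.inStage π X b₁ bK d n (j + 1)) ≤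
      ∑' j, S.P (S.run π X b₁ bK d K n false j) + ∑' j, S.P (S.run π X b₁ bK d K n true j) := by
  rw [← ENNReal.tsum_add]
  refine le_trans (ENNReal.tsum_le_tsum fun j => ?_) (ENNReal.tsum_comp_le_tsum_of_injective
    (add_left_injective 1) _)
  rw [measure_eq_add hX (j + 1)]
  exact le_rfl

theorem measurableSet_alive_inStage_curr {m n t : ℕ} (hn : 2 * m ≤ n) :
    MeasurableSet[S.curr (t + 1)] (S.alive π X b₁ bK d m ∩ S.inStage π X b₁ bK d n (t + 1)) :=
  obs_le_curr hX t _ (measurableSet_alive_inStage hn)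

theorem measurableSet_alive (m : ℕ) : MeasurableSet (S.alive π X b₁ bK d m) := by
  have e : S.alive π X b₁ bK d m = ⋃ a : ℕ,
      S.alive π X b₁ bK d m ∩ {ω | S.stageEnd π X b₁ bK d ω (2 * m) = a} := by
    ext ω
    simp only [Set.mem_iUnion, Set.mem_inter_iff, exists_and_left]
    refine ⟨fun h => ⟨h, ?_⟩, fun h => h.1⟩
    obtain ⟨a, ha⟩ := ENat.ne_top_iff_exists.mp h.1.ne
    exact ⟨a, ha.symm⟩
  rw [e]
  exact MeasurableSet.iUnion fun a => obs_le hX a _ (measurableSet_alive_start m a)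

end

section

variable (h : S.IsMasteryRule π X b₁ bK d) (hπ : ∀ t z, π t z ∈ Set.Ico (0 : ℝ) 1)
  (hR : R.Regular) {δ : ℝ} (hδ : 0 < δ) (hδ1 : δ ≤ 1) (hπδ : ∀ t z, π t z ≤ 1 - δ)
  {c : ℝ} (hc : 0 < c) {t₀ : ℕ}
include h hπ hR hδ hπδ hc

/-- The number of steps in a training stage: those before the change and those after it. -/
theorem IsMasteryRule.tsum_measure_training_le {ζ : ℝ} (hζ0 : 0 < ζ)
    (hζ : ∀ t ω, X (t + 1) ω = 0 → ζ ≤ transitionProb π X (t + 1) ω)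
    {m₁ : ℝ} (hm : R.secondMoment / (4 * c) < m₁)
    (hdrift : ∀ j ≥ t₀, ∀ ω, X j ω = 0 → m₁ ≤ R.I 0 + hazard π X j ω) (m : ℕ) :
    ∑' j, S.P (S.alive π X b₁ bK d m ∩ S.inStage π X b₁ bK d (2 * m) (j + 1)) ≤
      ∑' j, S.P (S.alive π X b₁ bK d m ∩ S.inStage π X b₁ bK d (2 * m) (j + 1) ∩
        {ω | S.L π X j ω = false}) +
      ENNReal.ofReal (stepBound R δ t₀ c m₁ (Real.log b₁ - Real.log ζ)) *
        S.P (S.alive π X b₁ bK d m) := by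
  have hX := h.adapted
  refine le_trans ?_ (add_le_add_right (h.sum_measure_run_even_true_le hX hπ hR hδ hπδ hζ0 hζ
    (measurableSet_alive hX m) (fun t => measurableSet_alive_inStage_curr hX le_rfl) hc hm hdrift) _)
  refine le_trans ?_ (add_le_add_right (ENNReal.tsum_comp_le_tsum_of_injective
    (add_left_injective 1) _) _)
  rw [← ENNReal.tsum_add]
  refine ENNReal.tsum_le_tsum fun j => ?_
  rw [measure_eq_add hX j]
  gcongr
  intro ω hω
  exact ⟨hω.1, L_mono (Nat.le_succ j) hω.2⟩

/-- The number of steps in a training stage: on average, at most `1 / ζ` of them precede the change. -/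
theorem IsMasteryRule.tsum_measure_training_le' {ζ : ℝ} (hζ0 : 0 < ζ)
    (hζ : ∀ t ω, X (t + 1) ω = 0 → ζ ≤ transitionProb π X (t + 1) ω)
    {m₁ : ℝ} (hm : R.secondMoment / (4 * c) < m₁)
    (hdrift : ∀ j ≥ t₀, ∀ ω, X j ω = 0 → m₁ ≤ R.I 0 + hazard π X j ω) (m : ℕ) :
    ∑' j, S.P (S.alive π X b₁ bK d m ∩ S.inStage π X b₁ bK d (2 * m) (j + 1)) ≤
      (ENNReal.ofReal (1 / ζ) +
        ENNReal.ofReal (stepBound R δ t₀ c m₁ (Real.log b₁ - Real.log ζ))) *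
        S.P (S.alive π X b₁ bK d m) := by
  have hX := h.adapted
  refine (h.tsum_measure_training_le hπ hR hδ hπδ hc hζ0 hζ hm hdrift m).trans ?_
  rw [add_mul]
  refine add_le_add_left (sum_measure_le_of_transition hX (fun t z => ⟨(hπ t z).1, (hπ t z).2.le⟩)
    (fun j => ?_) (fun j ω hω => hω.2) (fun j => Set.inter_subset_left.trans Set.inter_subset_left)
    hζ0 fun j ω hω => hζ j ω (h.treatment_even hω.1.2)) _
  exact measurableSet_inter_of (m := S.prev (j + 1))
    (obs_le_prev hX j _ (measurableSet_alive_inStage le_rfl)) (measurableSet_L_prev hX j false)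

/-- In the first training stage, the change happens when it would happen under treatment `1`. -/
theorem IsMasteryRule.tsum_measure_first_training_le {ζ : ℝ} (hζ0 : 0 < ζ)
    (hζ : ∀ t ω, X (t + 1) ω = 0 → ζ ≤ transitionProb π X (t + 1) ω)
    {m₁ : ℝ} (hm : R.secondMoment / (4 * c) < m₁)
    (hdrift : ∀ j ≥ t₀, ∀ ω, X j ω = 0 → m₁ ≤ R.I 0 + hazard π X j ω) :
    ∑' j, S.P (S.alive π X b₁ bK d 0 ∩ S.inStage π X b₁ bK d (2 * 0) (j + 1)) ≤
      S.lam π 0 + ENNReal.ofReal (stepBound R δ t₀ c m₁ (Real.log b₁ - Real.log ζ)) := by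
  have hP := S.isProb
  refine (h.tsum_measure_training_le hπ hR hδ hπδ hc hζ0 hζ hm hdrift 0).trans ?_
  rw [alive_zero, measure_univ, mul_one]
  refine add_le_add_left ?_ _
  rw [lam, expect, lintegral_eq_tsum S.P fun j => measurableSet_lt_Θ (adapted_const 0) j]
  refine ENNReal.tsum_le_tsum fun j => measure_mono fun ω hω => ?_
  rw [Set.mem_ofPred_eq, lt_Θ_iff]
  rw [← L_eq_of_treatment_eq (X := X) fun s h1 hs => ?_]
  · exact hω.2
  · refine h.treatment_even (m := 0) ⟨?_, le_trans ?_ hω.1.2.2⟩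
    · simpa [stageEnd] using (by omega : 0 < s)
    · exact_mod_cast (by omega : s ≤ j + 1)

include hδ1 in
/-- The number of steps in an assessment stage: before the change the test drifts to its threshold,
and after it the posterior odds drift to theirs. -/
theorem IsMasteryRule.tsum_measure_assessment_le (hb₁ : 0 < b₁) (hd : 1 ≤ d)
    {mK : ℝ} (hm : R.secondMoment / (4 * c) < mK) (hJ : R.secondMoment / (4 * c) < R.J (Fin.last k))
    (hdrift : ∀ j ≥ t₀, ∀ ω, X j ω = Fin.last k → mK ≤ R.I (Fin.last k) + hazard π X j ω)
    {K : Set Ω} (hKm : MeasurableSet K) {n : ℕ}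
    (hK : ∀ t, MeasurableSet[S.curr (t + 1)] (K ∩ S.inStage π X b₁ bK d (2 * n + 1) (t + 1))) :
    ∑' j, S.P (K ∩ S.inStage π X b₁ bK d (2 * n + 1) (j + 1)) ≤
      (ENNReal.ofReal (stepBound R δ t₀ c (R.J (Fin.last k)) (Real.log d)) +
        ENNReal.ofReal (stepBound R δ t₀ c mK (Real.log bK - Real.log (b₁ / d)))) * S.P K := by
  have hX := h.adapted
  refine (tsum_measure_inStage_le_run hX K _).trans ?_
  rw [add_mul]
  refine add_le_add ?_ (h.sum_measure_run_odd_true_le hX hπ hR hδ hπδ hb₁ hd hKm hK hc hm hdrift)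
  refine (h.sum_measure_run_odd_false_le hX hR hKm hK hc hJ).trans ?_
  gcongr
  have h1 := Real.log_nonpos hδ.le hδ1
  have h3 : 0 ≤ R.J (Fin.last k) * t₀ := mul_nonneg (hR.J_pos _).le (Nat.cast_nonneg _)
  exact div_le_div_of_nonneg_right (by linarith) (by linarith)

include hδ1 in
/-- The first assessment stage most likely starts after the change, with posterior odds of at least
`b₁`. -/
theorem IsMasteryRule.tsum_measure_first_assessment_le (hb₁ : 0 < b₁) (hd : 1 ≤ d)
    {mK : ℝ} (hm : R.secondMoment / (4 * c) < mK) (hJ : R.secondMoment / (4 * c) < R.J (Fin.last k))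
    (hdrift : ∀ j ≥ t₀, ∀ ω, X j ω = Fin.last k → mK ≤ R.I (Fin.last k) + hazard π X j ω) :
    ∑' j, S.P (S.alive π X b₁ bK d 0 ∩ S.inStage π X b₁ bK d (2 * 0 + 1) (j + 1)) ≤
      ENNReal.ofReal (stepBound R δ t₀ c mK (Real.log bK - Real.log b₁)) +
      (ENNReal.ofReal (stepBound R δ t₀ c (R.J (Fin.last k)) (Real.log d)) +
        ENNReal.ofReal (stepBound R δ t₀ c mK (Real.log bK - Real.log (b₁ / d)))) *
        ENNReal.ofReal (1 / (1 + b₁)) := by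
  have hP := S.isProb
  have hX := h.adapted
  -- the latent state at the end of the training stage is `i`
  set K : Bool → Set Ω := fun i => ⋃ a : ℕ, S.alive π X b₁ bK d 0 ∩
    {ω | S.stageEnd π X b₁ bK d ω (2 * 0 + 1) = a} ∩ {ω | S.L π X a ω = i} with hKdef
  have hKm : ∀ i, MeasurableSet (K i) := fun i => MeasurableSet.iUnion fun a =>
    (obs_le hX a _ (measurableSet_alive_stageEnd 0 a)).inter (measurableSet_L hX a i)
  have hK : ∀ i t, MeasurableSet[S.curr (t + 1)]
      (K i ∩ S.inStage π X b₁ bK d (2 * 0 + 1) (t + 1)) := by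
    intro i t
    have e : K i ∩ S.inStage π X b₁ bK d (2 * 0 + 1) (t + 1) =
        (⋃ a ∈ Finset.range (t + 1), S.alive π X b₁ bK d 0 ∩
          {ω | S.stageEnd π X b₁ bK d ω (2 * 0 + 1) = a} ∩ {ω | S.L π X a ω = i}) ∩
        S.inStage π X b₁ bK d (2 * 0 + 1) (t + 1) := by
      ext ω
      simp only [hKdef, Set.mem_inter_iff, Set.mem_iUnion, Finset.mem_range, exists_prop]
      refine ⟨fun ⟨⟨a, ha⟩, h2⟩ => ⟨⟨a, ?_, ha⟩, h2⟩, fun ⟨⟨a, _, ha⟩, h2⟩ => ⟨⟨a, ha⟩, h2⟩⟩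
      have h3 := h2.1
      rw [show S.stageEnd π X b₁ bK d ω (2 * 0 + 1) = a from ha.1.2] at h3
      exact_mod_cast h3
    rw [e]
    refine measurableSet_inter_of (measurableSet_finset_biUnion _ fun a ha => ?_)
      (obs_le_curr hX t _ (measurableSet_inStage _ t))
    have hat : a + 1 ≤ t + 1 := Finset.mem_range.mp ha
    exact ((S.prev_mono hat).trans (S.prev_le_curr _)) _ (measurableSet_inter_of
      (obs_le_prev hX a _ (measurableSet_alive_stageEnd 0 a)) (measurableSet_L_prev hX a i))
  have hsplit : ∀ j, S.P (S.alive π X b₁ bK d 0 ∩ S.inStage π X b₁ bK d (2 * 0 + 1) (j + 1)) ≤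
      S.P (K true ∩ S.inStage π X b₁ bK d (2 * 0 + 1) (j + 1)) +
        S.P (K false ∩ S.inStage π X b₁ bK d (2 * 0 + 1) (j + 1)) := by
    intro j
    refine (measure_mono fun ω hω => ?_).trans (measure_union_le _ _)
    obtain ⟨a, ha, -⟩ := exists_start_of_inStage hω.2
    cases hL : S.L π X a ω
    · exact Or.inr ⟨Set.mem_iUnion.mpr ⟨a, ⟨hω.1, ha⟩, hL⟩, hω.2⟩
    · exact Or.inl ⟨Set.mem_iUnion.mpr ⟨a, ⟨hω.1, ha⟩, hL⟩, hω.2⟩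
  have hKL : ∀ ω ∈ K true, ∀ a : ℕ, S.stageEnd π X b₁ bK d ω (2 * 0 + 1) = a →
      S.L π X a ω = true := by
    intro ω hω a ha
    obtain ⟨a', ⟨_, ha'⟩, hL⟩ := Set.mem_iUnion.mp hω
    rw [Set.mem_ofPred_eq, ha] at ha'
    have : a = a' := by exact_mod_cast ha'
    rw [this]
    exact hL
  refine (ENNReal.tsum_le_tsum hsplit).trans ?_
  rw [ENNReal.tsum_add]
  refine add_le_add ?_ ?_
  · refine (tsum_measure_inStage_le_run hX (K true) _).trans ?_
    have h0 : ∀ j, S.run π X b₁ bK d (K true) (2 * 0 + 1) false j = ∅ := by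
      intro j
      refine Set.eq_empty_of_forall_notMem fun ω hω => ?_
      obtain ⟨a, ha, haj⟩ := exists_start_of_inStage hω.1.2
      have h1 := L_mono haj.le (hKL ω hω.1.1 a ha)
      rw [show S.L π X j ω = false from hω.2] at h1
      exact absurd h1 (by simp)
    simp only [h0, measure_empty, tsum_zero, zero_add]
    refine (h.sum_measure_run_odd_true_le_of_changed hX hπ hR hδ hπδ hb₁ (hKm true) hKL (hK true)
      hc hm hdrift).trans ?_
    conv_rhs => rw [← mul_one (ENNReal.ofReal _)]
    exact mul_le_mul_right prob_le_one _
  · refine (h.tsum_measure_assessment_le hπ hR hδ hδ1 hπδ hc hb₁ hd hm hJ hdrift (hKm false)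
      (hK false)).trans (mul_le_mul_right ?_ _)
    refine (measure_alive_stageEnd_noChange_le hX hπ hR hb₁.le 0).trans ?_
    conv_rhs => rw [← mul_one (ENNReal.ofReal _)]
    exact mul_le_mul_right prob_le_one _

include hδ1 in
/-- The expected duration of the procedure: the two stages of the first cycle, and a geometric series
with ratio `q` for the later ones. The factor `3` leaves room for the part of the first assessment stage
that has a factor `1 / (1 + b₁)`, and for the sum `q / (1 - q) ≤ 2 * q` of the series. -/
theorem IsMasteryRule.expect_masteryTime_le {ζ : ℝ} (hζ0 : 0 < ζ)
    (hζ : ∀ t ω, X (t + 1) ω = 0 → ζ ≤ transitionProb π X (t + 1) ω) (hb₁ : 0 < b₁) (hd : 1 ≤ d)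
    {m₁ mK : ℝ} (hm₁ : R.secondMoment / (4 * c) < m₁)
    (hmK : R.secondMoment / (4 * c) < mK) (hJ : R.secondMoment / (4 * c) < R.J (Fin.last k))
    (hdrift₁ : ∀ j ≥ t₀, ∀ ω, X j ω = 0 → m₁ ≤ R.I 0 + hazard π X j ω)
    (hdriftK : ∀ j ≥ t₀, ∀ ω, X j ω = Fin.last k → mK ≤ R.I (Fin.last k) + hazard π X j ω)
    {q : ℝ} (hq : 1 / (1 + b₁) + 1 / d ≤ q) (hq2 : q ≤ 1 / 2) :
    expect S.P (S.masteryTime π X b₁ bK d) ≤ S.lam π 0 +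
      ENNReal.ofReal (stepBound R δ t₀ c m₁ (Real.log b₁ - Real.log ζ) +
        stepBound R δ t₀ c mK (Real.log bK - Real.log b₁) +
        3 * q * (1 / ζ + stepBound R δ t₀ c m₁ (Real.log b₁ - Real.log ζ) +
          stepBound R δ t₀ c (R.J (Fin.last k)) (Real.log d) +
          stepBound R δ t₀ c mK (Real.log bK - Real.log (b₁ / d)))) := by
  have hP := S.isProb
  have hX := h.adapted
  have hd0 : 0 < d := by linarith
  have hb1 : 0 ≤ 1 / (1 + b₁) := by positivity
  have hd1 : 0 ≤ 1 / d := by positivity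
  have hq0 : 0 ≤ q := by linarith
  have n1 := stepBound_nonneg (R := R) (t₀ := t₀) (Real.log b₁ - Real.log ζ) hδ hδ1 hc hm₁
  have n2 := stepBound_nonneg (R := R) (t₀ := t₀) (Real.log bK - Real.log b₁) hδ hδ1 hc hmK
  have n3 := stepBound_nonneg (R := R) (t₀ := t₀) (Real.log d) hδ hδ1 hc hJ
  have n4 := stepBound_nonneg (R := R) (t₀ := t₀) (Real.log bK - Real.log (b₁ / d)) hδ hδ1 hc hmK
  set B₁ := stepBound R δ t₀ c m₁ (Real.log b₁ - Real.log ζ)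
  set B₂ := stepBound R δ t₀ c mK (Real.log bK - Real.log b₁)
  set B₃ := stepBound R δ t₀ c (R.J (Fin.last k)) (Real.log d)
  set B₄ := stepBound R δ t₀ c mK (Real.log bK - Real.log (b₁ / d))
  have hz : 0 ≤ 1 / ζ := by positivity
  set B := 1 / ζ + B₁ + B₃ + B₄ with hB
  have halive : ∀ m, S.P (S.alive π X b₁ bK d m) ≤ ENNReal.ofReal (q ^ m) := by
    intro m
    induction m with
    | zero => rw [pow_zero, ENNReal.ofReal_one]; exact prob_le_one
    | succ m ih =>
      refine (h.measure_alive_succ_le hX hπ hR hb₁.le hd0 m).trans ?_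
      rw [pow_succ', ENNReal.ofReal_mul hq0]
      exact mul_le_mul' (ENNReal.ofReal_le_ofReal hq) ih
  have hcycle : ∀ m, ∑' j, S.P (S.alive π X b₁ bK d m ∩ S.inStage π X b₁ bK d (2 * m) (j + 1)) +
      ∑' j, S.P (S.alive π X b₁ bK d m ∩ S.inStage π X b₁ bK d (2 * m + 1) (j + 1)) ≤
      ENNReal.ofReal B * ENNReal.ofReal (q ^ m) := by
    intro m
    refine (add_le_add (h.tsum_measure_training_le' hπ hR hδ hπδ hc hζ0 hζ hm₁ hdrift₁ m)
      (h.tsum_measure_assessment_le hπ hR hδ hδ1 hπδ hc hb₁ hd hmK hJ hdriftK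
        (measurableSet_alive hX m)
        fun t => measurableSet_alive_inStage_curr hX (Nat.le_succ _))).trans ?_
    rw [← add_mul, ← ENNReal.ofReal_add hz n1, ← ENNReal.ofReal_add n3 n4,
      ← ENNReal.ofReal_add (by positivity) (by positivity)]
    exact mul_le_mul' (ENNReal.ofReal_le_ofReal (by rw [hB]; linarith)) (halive m)
  have hfirst := add_le_add (h.tsum_measure_first_training_le hπ hR hδ hπδ hc hζ0 hζ hm₁ hdrift₁)
    (h.tsum_measure_first_assessment_le hπ hR hδ hδ1 hπδ hc hb₁ hd hmK hJ hdriftK)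
  refine (expect_masteryTime_le_tsum hX).trans ?_
  rw [tsum_eq_zero_add' ENNReal.summable]
  have hgeom : ∑' m : ℕ, ENNReal.ofReal B * ENNReal.ofReal (q ^ (m + 1)) ≤
      ENNReal.ofReal (2 * q * B) := by
    have hs : HasSum (fun m : ℕ => B * q ^ (m + 1)) (B * (q * (1 - q)⁻¹)) := by
      simp only [pow_succ']
      exact ((hasSum_geometric_of_lt_one hq0 (by linarith)).mul_left q).mul_left B
    have hBn : 0 ≤ B := by positivity
    simp only [← ENNReal.ofReal_mul hBn]
    rw [← ENNReal.ofReal_tsum_of_nonneg (fun m => by positivity) hs.summable, hs.tsum_eq]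
    apply ENNReal.ofReal_le_ofReal
    have h1 : (1 - q)⁻¹ ≤ 2 := by
      rw [inv_le_comm₀ (by linarith) (by norm_num)]
      linarith
    calc B * (q * (1 - q)⁻¹) ≤ B * (q * 2) := by gcongr
      _ = 2 * q * B := by ring
  refine (add_le_add hfirst ((ENNReal.tsum_le_tsum fun m => hcycle (m + 1)).trans hgeom)).trans ?_
  have h5 : (ENNReal.ofReal B₃ + ENNReal.ofReal B₄) * ENNReal.ofReal (1 / (1 + b₁)) ≤
      ENNReal.ofReal (q * B) := by
    rw [← ENNReal.ofReal_add n3 n4, ← ENNReal.ofReal_mul (by positivity)]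
    apply ENNReal.ofReal_le_ofReal
    rw [mul_comm]
    exact mul_le_mul (by linarith) (by rw [hB]; linarith) (by positivity) hq0
  calc _ ≤ S.lam π 0 + ENNReal.ofReal B₁ + (ENNReal.ofReal B₂ + ENNReal.ofReal (q * B)) +
        ENNReal.ofReal (2 * q * B) := by gcongr
    _ = S.lam π 0 + (ENNReal.ofReal B₁ + ENNReal.ofReal B₂ + (ENNReal.ofReal (q * B) +
        ENNReal.ofReal (2 * q * B))) := by ring
    _ = _ := by
        have hBn : 0 ≤ B := by positivity
        rw [← ENNReal.ofReal_add n1 n2, ← ENNReal.ofReal_add (by positivity) (by positivity),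
          ← ENNReal.ofReal_add (by positivity) (by positivity)]
        congr 2
        ring

end

end System

end

end ChangeAccel

namespace ChangeAccel

noncomputable section

/-! ### Asymptotics of the bounds -/

theorem abs_log_sub_log_le {δ a b : ℝ} (hδ : 0 < δ) (ha : δ ≤ a) (hb : δ ≤ b) :
    |Real.log a - Real.log b| ≤ |a - b| / δ := by
  wlog hab : b ≤ a generalizing a b
  · rw [abs_sub_comm, abs_sub_comm a b]
    exact this hb ha (le_of_not_ge hab)
  have hb0 : 0 < b := by linarith
  rw [abs_of_nonneg (sub_nonneg.mpr (Real.log_le_log hb0 hab)), abs_of_nonneg (sub_nonneg.mpr hab),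
    ← Real.log_div (by linarith) hb0.ne']
  calc Real.log (a / b) ≤ a / b - 1 := Real.log_le_sub_one_of_pos (div_pos (by linarith) hb0)
    _ = (a - b) / b := by field_simp
    _ ≤ (a - b) / δ := div_le_div_of_nonneg_left (by linarith) hδ hb

theorem tendsto_abs_log_atTop : Tendsto (fun α => |Real.log α|) (𝓝[>] (0 : ℝ)) atTop :=
  tendsto_abs_atBot_atTop.comp Real.tendsto_log_nhdsGT_zero

/-- The error terms of the lower bound, with `Λ = |log α|`. -/
theorem eventually_lower_bound_errors {I Dm V s ε : ℝ} (hI : 0 < I) (hV : 0 ≤ V) (hε : 0 < ε)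
    (hε1 : ε < 1) : ∀ᶠ Λ : ℝ in atTop, ∀ D, I ≤ D → D ≤ Dm → ∀ n : ℕ, n = ⌊(1 - ε) * (Λ / D)⌋₊ →
      n * (D + ε * I / 2) + s < (1 - ε / 4) * Λ ∧
      Real.exp (-Λ) + Real.exp ((1 - ε / 4) * Λ) * (n * Real.exp (-Λ)) +
        V * n / ((1 - ε / 4) * Λ - (n * (D + ε * I / 2) + s)) ^ 2 ≤ ε ∧
      3 ≤ ε * (Λ / D) := by
  have t1 : Tendsto (fun Λ : ℝ => Real.exp (-Λ) + Λ / I * Real.exp (-(ε / 4) * Λ) +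
      64 * V / (I * ε ^ 2) / Λ) atTop (𝓝 (0 + I⁻¹ * 0 + 0)) := by
    refine (Tendsto.add ?_ ?_).add (tendsto_const_nhds.div_atTop tendsto_id)
    · exact Real.tendsto_exp_atBot.comp tendsto_neg_atTop_atBot
    · have h := (Real.tendsto_pow_mul_exp_neg_atTop_nhds_zero 1).comp
        (tendsto_id.const_mul_atTop (show 0 < ε / 4 by positivity))
      have h2 := (h.const_mul (4 / ε)).const_mul I⁻¹
      rw [mul_zero] at h2
      refine h2.congr fun Λ => ?_
      simp only [Function.comp, pow_one, id]
      field_simp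
  have e1 : ∀ᶠ Λ : ℝ in atTop, Real.exp (-Λ) + Λ / I * Real.exp (-(ε / 4) * Λ) +
      64 * V / (I * ε ^ 2) / Λ ≤ ε := by
    have h0 : (0 : ℝ) + I⁻¹ * 0 + 0 < ε := by simpa using hε
    exact (t1.eventually (eventually_lt_nhds h0)).mono fun _ h => h.le
  filter_upwards [e1, eventually_ge_atTop (8 / ε * s), eventually_gt_atTop 0,
    eventually_ge_atTop (3 * Dm / ε)] with Λ h1 h2 h3 h4 D hID hDm n hn
  have hD : 0 < D := by linarith
  have hn1 : (n : ℝ) ≤ (1 - ε) * (Λ / D) := by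
    rw [hn]
    exact Nat.floor_le (mul_nonneg (by linarith) (by positivity))
  have hn2 : (n : ℝ) ≤ Λ / I := by
    refine hn1.trans ?_
    have h5 : Λ / D ≤ Λ / I := div_le_div_of_nonneg_left h3.le hI hID
    have h6 : 0 ≤ Λ / D := by positivity
    nlinarith
  have hnn : (0 : ℝ) ≤ n := Nat.cast_nonneg n
  have hnD : n * (D + ε * I / 2) ≤ (1 - ε / 2) * Λ := by
    have h5 : D + ε * I / 2 ≤ D * (1 + ε / 2) := by nlinarith
    calc n * (D + ε * I / 2) ≤ (1 - ε) * (Λ / D) * (D * (1 + ε / 2)) :=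
          mul_le_mul hn1 h5 (by positivity) (mul_nonneg (by linarith) (by positivity))
      _ = (1 - ε) * (1 + ε / 2) * Λ := by field_simp
      _ ≤ (1 - ε / 2) * Λ := by nlinarith
  have hs : s ≤ ε / 8 * Λ := by
    have : s = ε / 8 * (8 / ε * s) := by field_simp
    rw [this]
    gcongr
  have hgap : ε / 8 * Λ ≤ (1 - ε / 4) * Λ - (n * (D + ε * I / 2) + s) := by nlinarith
  have hgap0 : 0 < ε / 8 * Λ := by positivity
  refine ⟨by linarith, le_trans (add_le_add (add_le_add le_rfl ?_) ?_) h1, ?_⟩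
  · have : Real.exp ((1 - ε / 4) * Λ) * (n * Real.exp (-Λ)) = n * Real.exp (-(ε / 4) * Λ) := by
      rw [mul_left_comm, ← Real.exp_add]
      ring_nf
    rw [this]
    gcongr
  · calc V * n / ((1 - ε / 4) * Λ - (n * (D + ε * I / 2) + s)) ^ 2 ≤
          V * (Λ / I) / (ε / 8 * Λ) ^ 2 := by gcongr
      _ = 64 * V / (I * ε ^ 2) / Λ := by field_simp; norm_num
  · rw [div_le_iff₀ hε] at h4
    rw [← mul_div_assoc, le_div_iff₀ hD]
    nlinarith

/-- The thresholds are such that the bounds for all later cycles are at most of the order of `b₁`. -/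
theorem later_cycles_le {I Dm κ C r z ℓ A b₁ d : ℝ} (hI : 0 < I) (hDm : 0 < Dm) (hκ : 0 < κ)
    (hC : 0 ≤ C) (hr : 0 < r) (hb1 : 1 ≤ b₁) (hA1 : 1 ≤ A) (hAb : A ≤ b₁ / I)
    (hzA : Real.exp z ≤ A) (hℓA : ℓ / Dm ≤ A) (hd : d = b₁ * (A / κ)) (hd1 : 1 ≤ d) :
    Real.exp z + (max 0 (Real.log b₁ + z) + C) / r + (max 0 (Real.log d) + C) / r +
      (max 0 (ℓ - Real.log (b₁ / d)) + C) / r ≤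
      (1 / I + (1 + 1 / I + C) / r + (1 + 1 / I + |Real.log κ| + C) / r +
        (Dm / I + 1 / I + |Real.log κ| + C) / r) * b₁ := by
  have hA0 : 0 < A := by linarith
  have hb0 : 0 < b₁ := by linarith
  have hd0 : 0 < d := by linarith
  have hlb : 0 ≤ Real.log b₁ := Real.log_nonneg hb1
  have hlogd : Real.log d = Real.log b₁ + (Real.log A - Real.log κ) := by
    rw [hd, Real.log_mul hb0.ne' (by positivity), Real.log_div hA0.ne' hκ.ne']
  have hlogbd : Real.log (b₁ / d) = Real.log b₁ - Real.log d := Real.log_div hb0.ne' hd0.ne'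
  have c1 : Real.exp z ≤ 1 / I * b₁ := by
    rw [one_div_mul_eq_div]; linarith
  have c2 : Real.log b₁ ≤ b₁ := (Real.log_le_sub_one_of_pos hb0).trans (by linarith)
  have c3 : z ≤ 1 / I * b₁ := by have := Real.add_one_le_exp z; linarith
  have c4 : Real.log A ≤ 1 / I * b₁ := by
    rw [one_div_mul_eq_div]
    exact (Real.log_le_sub_one_of_pos hA0).trans (by linarith)
  have c5 : C ≤ C * b₁ := le_mul_of_one_le_right hC hb1
  have c6 : -Real.log κ ≤ |Real.log κ| * b₁ :=
    (neg_le_abs _).trans (le_mul_of_one_le_right (abs_nonneg _) hb1)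
  have c7 : ℓ ≤ Dm / I * b₁ := by
    have h6 : ℓ / Dm ≤ b₁ / I := by linarith
    rw [div_le_iff₀ hDm] at h6
    calc ℓ ≤ b₁ / I * Dm := h6
      _ = Dm / I * b₁ := by ring
  have m1 : max 0 (Real.log b₁ + z) ≤ b₁ + 1 / I * b₁ := max_le (by positivity) (by linarith)
  have m3 : max 0 (Real.log d) ≤ b₁ + 1 / I * b₁ + |Real.log κ| * b₁ :=
    max_le (by positivity) (by rw [hlogd]; linarith)
  have m4 : max 0 (ℓ - Real.log (b₁ / d)) ≤ Dm / I * b₁ + 1 / I * b₁ + |Real.log κ| * b₁ := by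
    refine max_le (by positivity) ?_
    rw [hlogbd, hlogd]
    linarith
  have e : (1 / I + (1 + 1 / I + C) / r + (1 + 1 / I + |Real.log κ| + C) / r +
        (Dm / I + 1 / I + |Real.log κ| + C) / r) * b₁ =
      1 / I * b₁ + (b₁ + 1 / I * b₁ + C * b₁) / r +
        (b₁ + 1 / I * b₁ + |Real.log κ| * b₁ + C * b₁) / r +
        (Dm / I * b₁ + 1 / I * b₁ + |Real.log κ| * b₁ + C * b₁) / r := by ring
  rw [e]
  refine add_le_add (add_le_add (add_le_add c1 ?_) ?_) ?_ <;>
    exact div_le_div_of_nonneg_right (by linarith) hr.le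

/-- The two stages of the first cycle: the training stage has little effect on the total, since
`(1 / D₁ - 1 / D) * log b₁` is of the order of `log A`. -/
theorem first_cycle_le {I C ε Λ z ℓ D₁ D A b₁ : ℝ} (hI : 0 < I) (hC : 0 ≤ C) (hε1 : ε < 1)
    (hΛ : 0 < Λ) (hz : 0 ≤ z) (hℓ0 : 0 ≤ ℓ) (hℓ2 : ℓ ≤ Λ) (hID₁ : I ≤ D₁) (hD₁D : D₁ < D)
    (hA : A = Real.exp z + ℓ / D) (hb₁ : b₁ = A / (1 / D₁ - 1 / D)) (hlb : 0 ≤ Real.log b₁)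
    (hlog : Real.log b₁ ≤ ℓ) :
    (max 0 (Real.log b₁ + z) + C) / ((1 - ε) * D₁) +
      (max 0 (ℓ - Real.log b₁) + C) / ((1 - ε) * D) ≤
      1 / (1 - ε) * (Λ / D + 2 * z / I + (2 * C / I + 1 + Real.log (1 + Λ / I) / I)) := by
  have hε0 : 0 < 1 - ε := by linarith
  have hD₁ : 0 < D₁ := by linarith
  have hD : 0 < D := by linarith
  have hz1 : 1 ≤ Real.exp z := Real.one_le_exp hz
  have hℓD : 0 ≤ ℓ / D := by positivity
  have hA1 : 1 ≤ A := by linarith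
  have hA0 : 0 < A := by linarith
  have hlA : 0 ≤ Real.log A := Real.log_nonneg hA1
  have hΔ0 : 0 < 1 / D₁ - 1 / D := sub_pos.mpr (one_div_lt_one_div_of_lt hD₁ hD₁D)
  have hΔI : 1 / D₁ - 1 / D ≤ 1 / I := by
    have h6 : 1 / D₁ ≤ 1 / I := one_div_le_one_div_of_le hI hID₁
    have h7 : 0 < 1 / D := by positivity
    linarith
  have e0 : (Real.log b₁ + z + C) / ((1 - ε) * D₁) + (ℓ - Real.log b₁ + C) / ((1 - ε) * D) =
      1 / (1 - ε) * (ℓ / D + (1 / D₁ - 1 / D) * Real.log b₁ + (z + C) / D₁ + C / D) := by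
    field_simp
    ring
  have m1 : max 0 (Real.log b₁ + z) = Real.log b₁ + z := max_eq_right (by linarith)
  have m2 : max 0 (ℓ - Real.log b₁) = ℓ - Real.log b₁ := max_eq_right (by linarith)
  rw [m1, m2, e0]
  generalize 1 / D₁ - 1 / D = Δ at *
  have hΔb : Δ * Real.log b₁ ≤ (z + Real.log (1 + Λ / I)) / I + 1 := by
    have h6 : Real.log A ≤ z + Real.log (1 + Λ / I) := by
      rw [← Real.log_exp z, ← Real.log_mul (Real.exp_pos z).ne' (by positivity)]
      refine Real.log_le_log hA0 ?_
      have h7 : ℓ / D ≤ Λ / I :=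
        div_le_div₀ hΛ.le hℓ2 hI (by linarith)
      have h8 : 0 ≤ Λ / I := by positivity
      rw [hA]
      nlinarith
    -- `b₁` is large when `Δ` is small, but `Δ * |log Δ|` stays bounded
    have h9 : -Real.log Δ ≤ 1 / Δ := by
      rw [← Real.log_inv, one_div]
      exact (Real.log_le_sub_one_of_pos (inv_pos.mpr hΔ0)).trans (by linarith)
    have h10 : Real.log b₁ = Real.log A - Real.log Δ := by
      rw [hb₁, Real.log_div hA0.ne' hΔ0.ne']
    have h11 : Δ * -Real.log Δ ≤ 1 := by
      have := mul_le_mul_of_nonneg_left h9 hΔ0.le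
      rwa [mul_one_div_cancel hΔ0.ne'] at this
    have h12 : Δ * Real.log A ≤ (z + Real.log (1 + Λ / I)) / I := by
      rw [div_eq_inv_mul, ← one_div]
      exact mul_le_mul hΔI h6 hlA (by positivity)
    rw [h10]
    linarith
  have h6 : (z + C) / D₁ ≤ (z + C) / I := div_le_div_of_nonneg_left (by linarith) hI hID₁
  have h7 : C / D ≤ C / I := div_le_div_of_nonneg_left hC hI (by linarith)
  have h8 : ℓ / D ≤ Λ / D := by gcongr
  refine mul_le_mul_of_nonneg_left ?_ (by positivity)
  have e2 : Λ / D + 2 * z / I + (2 * C / I + 1 + Real.log (1 + Λ / I) / I) =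
      Λ / D + ((z + Real.log (1 + Λ / I)) / I + 1) + (z + C) / I + C / I := by ring
  rw [e2]
  linarith

/-- The bound for the expected duration of the procedure, with `Λ = |log α|`, `z = |log ζ|` and
`ℓ = log bK`.  The training probability `ζ` is allowed to be as small as `exp (-ν * Λ)`. -/
theorem eventually_upper_bound {I Dm κ C ε r η : ℝ} (hI : 0 < I) (hIDm : I ≤ Dm) (hκ : 0 < κ)
    (hC : 0 ≤ C) (hr : 0 < r) (hε1 : ε < 1) (hη : 1 / (1 - ε) < 1 + η) :
    ∃ ν > 0, ∀ᶠ Λ : ℝ in atTop, ∀ z ℓ D₁ D A b₁ d : ℝ, 0 ≤ z → z ≤ ν * Λ → Λ - 1 ≤ ℓ → ℓ ≤ Λ →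
      I ≤ D₁ → D₁ < D → D ≤ Dm → A = Real.exp z + ℓ / D → b₁ = A / (1 / D₁ - 1 / D) →
      d = b₁ * (A / κ) → Real.log b₁ ≤ ℓ →
      0 < b₁ ∧ 1 ≤ d ∧ (1 + κ) / b₁ ≤ 1 / 2 ∧ 1 / (1 + b₁) + 1 / d ≤ (1 + κ) / b₁ ∧
      (max 0 (Real.log b₁ + z) + C) / ((1 - ε) * D₁) + (max 0 (ℓ - Real.log b₁) + C) / ((1 - ε) * D) +
        3 * ((1 + κ) / b₁) * (Real.exp z + (max 0 (Real.log b₁ + z) + C) / r +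
          (max 0 (Real.log d) + C) / r + (max 0 (ℓ - Real.log (b₁ / d)) + C) / r) ≤
        (1 + η) * (Λ / D) := by
  have hDm0 : 0 < Dm := by linarith
  have hε0 : 0 < 1 - ε := by linarith
  obtain ⟨s, hs⟩ : ∃ s, s = 1 + η - 1 / (1 - ε) := ⟨_, rfl⟩
  have hs0 : 0 < s := by rw [hs]; linarith
  obtain ⟨M, hM⟩ : ∃ M, M = 1 / I + (1 + 1 / I + C) / r + (1 + 1 / I + |Real.log κ| + C) / r +
    (Dm / I + 1 / I + |Real.log κ| + C) / r := ⟨_, rfl⟩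
  refine ⟨s * (1 - ε) * I / (4 * Dm), by positivity, ?_⟩
  have t1 : Tendsto (fun Λ : ℝ => (1 / (1 - ε) * (2 * C / I + 1 + Real.log (1 + Λ / I) / I) +
      3 * (1 + κ) * M) / Λ) atTop (𝓝 0) := by
    have h1 : Tendsto (fun Λ : ℝ => Real.log (1 + Λ / I) / Λ) atTop (𝓝 0) := by
      have hlin : Tendsto (fun Λ : ℝ => 1 + Λ / I) atTop atTop :=
        tendsto_atTop_add_const_left _ _ (tendsto_id.atTop_div_const hI)
      have h2 := (Real.tendsto_pow_log_div_mul_add_atTop I (-I) 1 hI.ne').comp hlin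
      refine h2.congr fun Λ => ?_
      simp only [Function.comp, pow_one]
      congr 1
      field_simp
      ring
    have h3 : Tendsto (fun Λ : ℝ => (1 / (1 - ε) * (2 * C / I + 1) + 3 * (1 + κ) * M) / Λ +
        1 / (1 - ε) / I * (Real.log (1 + Λ / I) / Λ)) atTop (𝓝 (0 + 1 / (1 - ε) / I * 0)) :=
      (tendsto_const_nhds.div_atTop tendsto_id).add (h1.const_mul _)
    rw [mul_zero, add_zero] at h3
    refine h3.congr fun Λ => ?_
    ring
  filter_upwards [t1.eventually (eventually_lt_nhds (show 0 < s / (2 * Dm) by positivity)),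
    eventually_ge_atTop 1, eventually_ge_atTop (Dm * (1 / I) + 1),
    eventually_ge_atTop (Dm * (2 * (1 + κ) / I) + 1), eventually_ge_atTop (Dm * κ + 1)]
    with Λ h1 h2 h3 h4 h5 z ℓ D₁ D A b₁ d hz hzν hℓ1 hℓ2 hID₁ hD₁D hDDm hA hb₁ hd hlog
  have hD₁ : 0 < D₁ := by linarith
  have hD : 0 < D := by linarith
  have hΛ : 0 < Λ := by linarith
  have hℓ0 : 0 ≤ ℓ := by linarith
  have hz1 : 1 ≤ Real.exp z := Real.one_le_exp hz
  have hℓD : 0 ≤ ℓ / D := by positivity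
  have hℓDm : ℓ / Dm ≤ ℓ / D := div_le_div_of_nonneg_left hℓ0 hD hDDm
  have hA1 : 1 ≤ A := by linarith
  have hAge : ∀ x, Dm * x + 1 ≤ Λ → x ≤ A := by
    intro x hx
    have : x ≤ ℓ / Dm := by rw [le_div_iff₀ hDm0]; linarith
    linarith
  have hA0 : 0 < A := by linarith
  set Δ := 1 / D₁ - 1 / D with hΔ
  have hΔ0 : 0 < Δ := sub_pos.mpr (one_div_lt_one_div_of_lt hD₁ hD₁D)
  have hΔI : Δ ≤ 1 / I := by
    have h6 : 1 / D₁ ≤ 1 / I := one_div_le_one_div_of_le hI hID₁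
    have h7 : 0 < 1 / D := by positivity
    rw [hΔ]; linarith
  have hbA : I * A ≤ b₁ := by
    rw [hb₁, le_div_iff₀ hΔ0]
    have : I * Δ ≤ 1 := by
      have := mul_le_mul_of_nonneg_left hΔI hI.le
      rwa [mul_one_div_cancel hI.ne'] at this
    calc I * A * Δ = I * Δ * A := by ring
      _ ≤ 1 * A := by gcongr
      _ = A := one_mul A
  have hAb : A ≤ b₁ / I := by rw [le_div_iff₀ hI]; linarith
  have hb1 : 1 ≤ b₁ := by
    have := hAge _ h3
    have h6 : I * (1 / I) ≤ I * A := by gcongr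
    rw [mul_one_div_cancel hI.ne'] at h6
    linarith
  have hb0 : 0 < b₁ := by linarith
  have hb2 : 2 * (1 + κ) ≤ b₁ := by
    have := hAge _ h4
    have h6 : I * (2 * (1 + κ) / I) ≤ I * A := by gcongr
    rw [mul_div_cancel₀ _ hI.ne'] at h6
    linarith
  have hAκ : 1 ≤ A / κ := by rw [le_div_iff₀ hκ, one_mul]; exact hAge _ h5
  have hd1 : 1 ≤ d := by rw [hd]; exact one_le_mul_of_one_le_of_one_le hb1 hAκ
  have hd0 : 0 < d := by linarith
  have hlb : 0 ≤ Real.log b₁ := Real.log_nonneg hb1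
  have hzA : Real.exp z ≤ A := by rw [hA]; exact le_add_of_nonneg_right hℓD
  have hℓA : ℓ / Dm ≤ A := by rw [hA]; exact hℓDm.trans (le_add_of_nonneg_left (Real.exp_pos z).le)
  have hinner := later_cycles_le hI hDm0 hκ hC hr hb1 hA1 hAb hzA hℓA hd hd1
  rw [← hM] at hinner
  refine ⟨hb0, hd1, ?_, ?_, ?_⟩
  · rw [div_le_iff₀ hb0]; linarith only [hb2]
  · have h6 : 1 / (1 + b₁) ≤ 1 / b₁ := one_div_le_one_div_of_le hb0 (by linarith)
    have h7 : 1 / d ≤ κ / b₁ := by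
      rw [hd, div_le_div_iff₀ (by positivity) hb0]
      have : κ * (b₁ * (A / κ)) = b₁ * A := by field_simp
      rw [this, one_mul]
      exact le_mul_of_one_le_right hb0.le hA1
    rw [add_div]
    exact add_le_add h6 h7
  · have hq : 3 * ((1 + κ) / b₁) * (Real.exp z + (max 0 (Real.log b₁ + z) + C) / r +
        (max 0 (Real.log d) + C) / r + (max 0 (ℓ - Real.log (b₁ / d)) + C) / r) ≤
        3 * (1 + κ) * M := by
      calc _ ≤ 3 * ((1 + κ) / b₁) * (M * b₁) := by gcongr
        _ = 3 * (1 + κ) * M := by rw [mul_assoc, mul_assoc, mul_left_comm ((1 + κ) / b₁), div_mul_cancel₀ _ hb0.ne']; ring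
    have hmain := first_cycle_le hI hC hε1 hΛ hz hℓ0 hℓ2 hID₁ hD₁D hA hb₁ hlb hlog
    have hz2 : 1 / (1 - ε) * (2 * z / I) ≤ s / (2 * Dm) * Λ := by
      calc 1 / (1 - ε) * (2 * z / I) ≤ 1 / (1 - ε) * (2 * (s * (1 - ε) * I / (4 * Dm) * Λ) / I) := by
            gcongr
        _ = s / (2 * Dm) * Λ := by field_simp; norm_num
    rw [div_lt_iff₀ hΛ] at h1
    have hfin : s / (2 * Dm) * Λ + s / (2 * Dm) * Λ ≤ s * (Λ / D) := by
      have h6 : Λ / Dm ≤ Λ / D := div_le_div_of_nonneg_left hΛ.le hD hDDm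
      calc _ = s * (Λ / Dm) := by field_simp; norm_num
        _ ≤ _ := by gcongr
    have e3 : (1 + η) * (Λ / D) = 1 / (1 - ε) * (Λ / D) + s * (Λ / D) := by rw [hs]; ring
    have e4 : 1 / (1 - ε) * (Λ / D + 2 * z / I + (2 * C / I + 1 + Real.log (1 + Λ / I) / I)) =
        1 / (1 - ε) * (Λ / D) + 1 / (1 - ε) * (2 * z / I) +
        1 / (1 - ε) * (2 * C / I + 1 + Real.log (1 + Λ / I) / I) := by ring
    rw [e4] at hmain
    rw [e3]
    refine (add_le_add hmain hq).trans ?_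
    linarith only [h1, hz2, hfin]

end

end ChangeAccel

namespace ChangeAccel

noncomputable section

/-! ### The change-point models for small `α` -/

section

variable {k : ℕ} {π : ℝ → Transition k} {p : Fin (k + 1) → ℝ → ℝ} {δ : ℝ}

theorem limit_le_of_le (hMarkov : AsympMarkovian π p)
    (hπδ : ∀ α ∈ Set.Ioo (0 : ℝ) 1, ∀ t z, π α t z ≤ 1 - δ) {α : ℝ}
    (hα : α ∈ Set.Ioo (0 : ℝ) 1) (x : Fin (k + 1)) : p x α ≤ 1 - δ := by
  refine le_of_forall_pos_le_add fun ε hε => ?_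
  obtain ⟨t₀, ht₀⟩ := hMarkov.2 x ε hε
  have h1 := abs_le.mp (ht₀ t₀ le_rfl α hα fun _ => 0)
  have h2 := hπδ α hα (t₀ + 1) (Fin.snoc (α := fun _ => Fin (k + 1)) (fun _ : Fin t₀ => 0) x)
  linarith [h1.1]

/-- In the long run, the hazards are close to `|log (1 - p_x)|`, uniformly in `α`. -/
theorem exists_abs_hazard_sub_le (hMarkov : AsympMarkovian π p) (hδ : 0 < δ)
    (hπδ : ∀ α ∈ Set.Ioo (0 : ℝ) 1, ∀ t z, π α t z ≤ 1 - δ) {ε : ℝ} (hε : 0 < ε) :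
    ∃ t₀ : ℕ, 1 ≤ t₀ ∧ ∀ α ∈ Set.Ioo (0 : ℝ) 1, ∀ {Ω : Type*} (X : ℕ → Ω → Fin (k + 1)),
      ∀ j ≥ t₀, ∀ ω, |System.hazard (π α) X j ω - (|Real.log (1 - p (X j ω) α)|)| ≤ ε := by
  choose t ht using fun x => hMarkov.2 x (ε * δ) (by positivity)
  refine ⟨Finset.univ.sup t + 1, by omega, fun α hα Ω X j hj ω => ?_⟩
  obtain ⟨i, rfl⟩ := Nat.exists_eq_add_of_le' (show 1 ≤ j by omega)
  have hi : t (X (i + 1) ω) ≤ i :=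
    (Finset.le_sup (f := t) (Finset.mem_univ (X (i + 1) ω))).trans (by omega)
  have h1 := ht (X (i + 1) ω) i hi α hα fun j => X (j + 1) ω
  rw [← transitionProb_eq_snoc (π := π α) (X := X) (ω := ω) rfl] at h1
  have hp := limit_le_of_le hMarkov hπδ hα (X (i + 1) ω)
  have hp0 := (hMarkov.1 (X (i + 1) ω) α hα).1
  have htr : transitionProb (π α) X (i + 1) ω ≤ 1 - δ := hπδ α hα _ _
  rw [abs_of_nonpos (Real.log_nonpos (by linarith) (by linarith))]
  have h2 := abs_log_sub_log_le hδ (a := 1 - p (X (i + 1) ω) α)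
    (b := 1 - transitionProb (π α) X (i + 1) ω) (by linarith) (by linarith)
  have e : System.hazard (π α) X (i + 1) ω - -Real.log (1 - p (X (i + 1) ω) α) =
      Real.log (1 - p (X (i + 1) ω) α) - Real.log (1 - transitionProb (π α) X (i + 1) ω) := by
    rw [System.hazard]; ring
  rw [e]
  refine h2.trans ?_
  rw [div_le_iff₀ hδ]
  rwa [sub_sub_sub_cancel_left]

theorem zeta_le_one {π : Transition k} (hπ : ∀ t z, π t z ∈ Set.Icc (0 : ℝ) 1) (x : Fin (k + 1)) :
    zeta π x ≤ 1 :=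
  (zeta_le (fun t z => (hπ t z).1) x 0 Fin.elim0).trans (hπ _ _).2

variable {Y : Type*} [MeasurableSpace Y] {R : ResponseModel k Y}

theorem D_le (hMarkov : AsympMarkovian π p) (hδ : 0 < δ)
    (hπδ : ∀ α ∈ Set.Ioo (0 : ℝ) 1, ∀ t z, π α t z ≤ 1 - δ) {α : ℝ}
    (hα : α ∈ Set.Ioo (0 : ℝ) 1) (x : Fin (k + 1)) : D R p x α ≤ R.I x - Real.log δ := by
  have hp := limit_le_of_le hMarkov hπδ hα x
  have hp0 := (hMarkov.1 x α hα).1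
  rw [D, abs_of_nonpos (Real.log_nonpos (by linarith) (by linarith))]
  have := Real.log_le_log hδ (show δ ≤ 1 - p x α by linarith)
  linarith

theorem I_le_D (x : Fin (k + 1)) (α : ℝ) : R.I x ≤ D R p x α :=
  le_add_of_nonneg_right (abs_nonneg _)

variable {Ω : Type*} [MeasurableSpace Ω] {S : System R Ω}

theorem lamStar_lt_top {π : Transition k} (hπ : ∀ t z, π t z ∈ Set.Icc (0 : ℝ) 1)
    (hζ : 0 < zeta π 0) : S.lamStar π < ⊤ := by
  have hP := S.isProb
  have h := System.lintegral_maxChangePoint_le (S := S) hπ hζ (fun t => ?_) zero_le_one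
    (A := Set.univ) (by simp)
  · rw [Measure.restrict_univ] at h
    exact h.trans_lt ENNReal.ofReal_lt_top
  · have h1 := zeta_le (fun t z => (hπ t z).1) 0 t fun _ => 0
    convert h1 using 2
    funext i
    refine Fin.lastCases ?_ (fun i => ?_) i <;> simp

end

end

end ChangeAccel

namespace ChangeAccel

noncomputable section

/-! ### Asymptotic optimality -/

theorem eventually_mem_Ioo : ∀ᶠ α in 𝓝[>] (0 : ℝ), α ∈ Set.Ioo (0 : ℝ) 1 :=
  Ioo_mem_nhdsGT zero_lt_one

theorem le_liminf_of_forall_lt_one {ι : Type*} {l : Filter ι} {u : ι → ℝ≥0∞}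
    (h : ∀ η : ℝ, 0 < η → η < 1 → ∀ᶠ i in l, ENNReal.ofReal (1 - η) ≤ u i) :
    1 ≤ liminf u l := by
  refine le_of_forall_lt fun c hc => ?_
  have hc' : c ≠ ⊤ := (hc.trans ENNReal.one_lt_top).ne
  have h1 : c.toReal < 1 := by
    rw [← ENNReal.toReal_one]
    exact (ENNReal.toReal_lt_toReal hc' ENNReal.one_ne_top).mpr hc
  have h0 : 0 ≤ c.toReal := ENNReal.toReal_nonneg
  refine lt_of_lt_of_le ?_ (le_liminf_of_le (h := h ((1 - c.toReal) / 2) (by linarith) (by linarith)))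
  rw [← ENNReal.ofReal_toReal hc', ENNReal.ofReal_lt_ofReal_iff_of_nonneg h0,
    ENNReal.toReal_ofReal h0]
  linarith

theorem limsup_le_of_forall_pos {ι : Type*} {l : Filter ι} {u : ι → ℝ≥0∞}
    (h : ∀ η : ℝ, 0 < η → ∀ᶠ i in l, u i ≤ ENNReal.ofReal (1 + η)) : limsup u l ≤ 1 := by
  refine ENNReal.le_of_forall_pos_le_add fun η hη _ => ?_
  refine (limsup_le_of_le (h := h η hη)).trans ?_
  rw [ENNReal.ofReal_add zero_le_one (NNReal.coe_nonneg η), ENNReal.ofReal_one, ENNReal.ofReal_coe_nnreal]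

section

variable {k : ℕ} {π : ℝ → Transition k} {p : Fin (k + 1) → ℝ → ℝ}
  {Y : Type*} [MeasurableSpace Y] {R : ResponseModel k Y}
  {Ω : Type*} [MeasurableSpace Ω] {S : System R Ω}

/-- The asymptotic lower bound: within the time `(1 - ε) |log α| / D_K` after the change, no
procedure of the class collects enough evidence. -/
theorem eventually_le_optimal (hπ : IsTransitionFamily π) (hR : R.Regular)
    (hMarkov : AsympMarkovian π p) (hζ : SlowTraining π) (hδ : BoundedAwayFromOne π)
    (hord : Ordered R S π p) {η : ℝ} (hη : 0 < η) (hη1 : η < 1) : ∀ᶠ α in 𝓝[>] (0 : ℝ),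
      ENNReal.ofReal (1 - η) * (S.lamStar (π α) +
        ENNReal.ofReal (|Real.log α| / D R p (Fin.last k) α)) ≤ S.optimal (π α) α := by
  obtain ⟨δ, hδ01, hδmax⟩ := hδ
  have hπδ : ∀ α ∈ Set.Ioo (0 : ℝ) 1, ∀ t z, π α t z ≤ 1 - δ := fun α hα t z =>
    (le_maxTransition (π α) t z).trans (hδmax α hα t)
  set I := R.I (Fin.last k) with hI
  have hI0 : 0 < I := hR.I_pos _
  set ε := η / 3 with hε
  have hε0 : 0 < ε := by positivity
  have hε1 : ε < 1 := by rw [hε]; linarith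
  obtain ⟨t₀, ht₀, hhaz⟩ := exists_abs_hazard_sub_le hMarkov hδ01.1 hπδ
    (show 0 < ε * I / 2 by positivity)
  have herr := tendsto_abs_log_atTop.eventually (eventually_lower_bound_errors (I := I)
    (Dm := I - Real.log δ) (V := R.secondMoment) (s := t₀ * (-Real.log δ)) hI0
    R.secondMoment_nonneg hε0 hε1)
  have hzeta := hζ.2.eventually (eventually_lt_nhds (show (0 : ℝ) < 1 / 2 by norm_num))
  filter_upwards [eventually_mem_Ioo, herr, hzeta, hζ.1,
    tendsto_abs_log_atTop.eventually (eventually_gt_atTop 0)] with α hα h1 h2 h3 hΛ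
  have hIcc := hπ α hα
  have hIco : ∀ t z, π α t z ∈ Set.Ico (0 : ℝ) 1 := fun t z =>
    ⟨(hIcc t z).1, lt_of_le_of_lt (hπδ α hα t z) (by linarith [hδ01.1])⟩
  set Dk := D R p (Fin.last k) α with hDk
  have hIDk : I ≤ Dk := I_le_D _ _
  have hDk0 : 0 < Dk := by linarith
  set Λ := |Real.log α| with hΛdef
  have hlogα : Real.log α = -Λ := by
    rw [hΛdef, abs_of_neg (Real.log_neg hα.1 hα.2), neg_neg]
  have hαΛ : α = Real.exp (-Λ) := by rw [← hlogα, Real.exp_log hα.1]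
  obtain ⟨g1, g2, g3⟩ := h1 Dk hIDk (D_le hMarkov hδ01.1 hπδ hα _) _ rfl
  set n := ⌊(1 - ε) * (Λ / Dk)⌋₊ with hn
  -- `|log ζ| ≤ |log α| / 2`
  have hζsq : 2 * √α / zeta (π α) 0 ≤ 2 := by
    have h4 : Real.log (zeta (π α) 0) ≥ -(Λ / 2) := by
      rw [div_lt_iff₀ hΛ] at h2
      have := neg_abs_le (Real.log (zeta (π α) 0))
      linarith
    have h5 : √α ≤ zeta (π α) 0 := by
      calc √α = Real.exp (-Λ / 2) := by rw [Real.exp_half, ← hαΛ]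
        _ ≤ Real.exp (Real.log (zeta (π α) 0)) := Real.exp_le_exp.mpr (by linarith)
        _ = zeta (π α) 0 := Real.exp_log h3
    rw [div_le_iff₀ h3]
    linarith
  -- constant assignment of treatment `0`
  have hconst : ∀ t, zeta (π α) 0 ≤ π α (t + 1) fun _ => 0 := fun t => by
    have h4 := zeta_le (fun t z => (hIcc t z).1) 0 t fun _ => 0
    convert h4 using 2
    funext i
    refine Fin.lastCases ?_ (fun i => ?_) i <;> simp
  have hlam := (lamStar_lt_top (S := S) hIcc h3).ne
  refine le_iInf fun T => le_iInf fun X => le_iInf fun hTX => ?_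
  have hdrift : ∀ j ≥ t₀, ∀ ω, R.I (X j ω) + System.hazard (π α) X j ω ≤ Dk + ε * I / 2 := by
    intro j hj ω
    have h4 := (abs_le.mp (hhaz α hα X j hj ω)).2
    have h5 := (hord α hα (X j ω)).2
    rw [D] at h5
    linarith
  have hDm : ∀ x, R.I x ≤ Dk + ε * I / 2 := fun x => by
    have h4 := (I_le_D (R := R) (p := p) x α).trans (hord α hα x).2
    have : 0 < ε * I / 2 := by positivity
    linarith
  have key := hTX.lower_bound hIco hR hδ01.1 (hπδ α hα) h3 hconst hα.1.le hDm ht₀ hdrift g1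
  have herr2 : α + Real.exp ((1 - ε / 4) * Λ) * (n * α) +
      R.secondMoment * n / ((1 - ε / 4) * Λ - (n * (Dk + ε * I / 2) + t₀ * (-Real.log δ))) ^ 2 ≤ ε := by
    have h4 := g2
    rw [← hαΛ] at h4
    exact h4
  have key2 : S.lamStar (π α) + n ≤ expect S.P T + ENNReal.ofReal (2 + n * ε) := by
    refine key.trans ?_
    rw [add_assoc, ENNReal.ofReal_add zero_le_two (by positivity),
      ENNReal.ofReal_mul (Nat.cast_nonneg n), ENNReal.ofReal_natCast]
    gcongr
  by_cases hT : expect S.P T = ⊤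
  · rw [hT]; exact le_top
  rw [← ENNReal.ofReal_toReal hT, ← ENNReal.ofReal_toReal hlam] at key2 ⊢
  set l := (S.lamStar (π α)).toReal
  set e := (expect S.P T).toReal
  have hl0 : 0 ≤ l := ENNReal.toReal_nonneg
  have he0 : 0 ≤ e := ENNReal.toReal_nonneg
  have hn0 : (0 : ℝ) ≤ n := Nat.cast_nonneg n
  rw [← ENNReal.ofReal_natCast n, ← ENNReal.ofReal_add hl0 hn0,
    ← ENNReal.ofReal_add he0 (by positivity), ENNReal.ofReal_le_ofReal_iff (by positivity)] at key2
  rw [← ENNReal.ofReal_add hl0 (by positivity), ← ENNReal.ofReal_mul (by linarith)]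
  apply ENNReal.ofReal_le_ofReal
  have hnge : (1 - ε) * (Λ / Dk) - 1 ≤ n := (Nat.sub_one_lt_floor _).le
  have h6 : (1 - ε) * ((1 - ε) * (Λ / Dk) - 1) ≤ (1 - ε) * n :=
    mul_le_mul_of_nonneg_left hnge (by linarith)
  have h7 : 0 ≤ ε ^ 2 * (Λ / Dk) := by positivity
  have h8 : 0 ≤ η * l := by positivity
  have h9 : η = 3 * ε := by rw [hε]; ring
  rw [h9] at h8 ⊢
  nlinarith

/-- The asymptotic upper bound for the mastery-learning procedure. -/
theorem eventually_expect_le (hπ : IsTransitionFamily π) (hR : R.Regular)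
    (hMarkov : AsympMarkovian π p) (hζ : SlowTraining π) (hδ : BoundedAwayFromOne π)
    (hev : ∀ᶠ α in 𝓝[>] (0 : ℝ), D R p 0 α < D R p (Fin.last k) α ∧ b1 R π p α < bK α)
    {X : ℝ → ℕ → Ω → Fin (k + 1)} (hX : ∀ α ∈ Set.Ioo (0 : ℝ) 1,
      S.IsMasteryRule (π α) (X α) (b1 R π p α) (bK α) (dThr R π p α)) {η : ℝ} (hη : 0 < η) :
    ∀ᶠ α in 𝓝[>] (0 : ℝ),
      expect S.P (S.masteryTime (π α) (X α) (b1 R π p α) (bK α) (dThr R π p α)) ≤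
        ENNReal.ofReal (1 + η) * (S.lam (π α) 0 +
          ENNReal.ofReal (|Real.log α| / D R p (Fin.last k) α)) := by
  obtain ⟨δ, hδ01, hδmax⟩ := hδ
  have hπδ : ∀ α ∈ Set.Ioo (0 : ℝ) 1, ∀ t z, π α t z ≤ 1 - δ := fun α hα t z =>
    (le_maxTransition (π α) t z).trans (hδmax α hα t)
  have hI₁ := hR.I_pos 0
  have hIK := hR.I_pos (Fin.last k)
  have hJK := hR.J_pos (Fin.last k)
  obtain ⟨ε, hε0, hε1, hεη⟩ : ∃ ε : ℝ, 0 < ε ∧ ε < 1 / 2 ∧ 1 / (1 - ε) < 1 + η := by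
    refine ⟨min (1 / 4) (η / (2 * (1 + η))), by positivity,
      (min_le_left _ _).trans_lt (by norm_num), ?_⟩
    have h1 : min (1 / 4) (η / (2 * (1 + η))) ≤ η / (2 * (1 + η)) := min_le_right _ _
    have h2 : min (1 / 4) (η / (2 * (1 + η))) ≤ 1 / 4 := min_le_left _ _
    rw [le_div_iff₀ (by positivity)] at h1
    rw [div_lt_iff₀ (by linarith)]
    nlinarith
  obtain ⟨I, hI0, hII₁, hIIK, hIJK⟩ : ∃ I : ℝ, 0 < I ∧ I ≤ R.I 0 ∧ I ≤ R.I (Fin.last k) ∧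
      I ≤ R.J (Fin.last k) :=
    ⟨min (R.I 0) (min (R.I (Fin.last k)) (R.J (Fin.last k))), by positivity, min_le_left _ _,
      (min_le_right _ _).trans (min_le_left _ _), (min_le_right _ _).trans (min_le_right _ _)⟩
  have hV := R.secondMoment_nonneg
  -- the overshoot takes at most the fraction `ε / 2` of the drift
  obtain ⟨c, hc0, hcV⟩ : ∃ c : ℝ, 0 < c ∧ R.secondMoment / (4 * c) ≤ ε * I / 2 := by
    refine ⟨(R.secondMoment + 1) / (2 * ε * I), by positivity, ?_⟩
    rw [div_le_iff₀ (by positivity)]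
    field_simp
    linarith
  have hV0 : 0 ≤ R.secondMoment / (4 * c) := by positivity
  obtain ⟨t₀, ht₀, hhaz⟩ := exists_abs_hazard_sub_le hMarkov hδ01.1 hπδ
    (show 0 < ε * I / 2 by positivity)
  have hlδ : 0 ≤ -Real.log δ := neg_nonneg.mpr (Real.log_nonpos hδ01.1.le hδ01.2.le)
  obtain ⟨Dm, hDmK, hDmJ⟩ : ∃ Dm : ℝ, R.I (Fin.last k) - Real.log δ ≤ Dm ∧ R.J (Fin.last k) ≤ Dm :=
    ⟨max _ _, le_max_left _ _, le_max_right _ _⟩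
  have hDm0 : 0 < Dm := by linarith
  set C := c + -Real.log δ + Dm * t₀ with hC
  have hC0 : 0 ≤ C := by positivity
  set κ := 1 / R.I (Fin.last k) + 1 / R.J (Fin.last k) with hκ
  have hκ0 : 0 < κ := by positivity
  obtain ⟨ν, hν0, hbound⟩ := eventually_upper_bound (I := I) (Dm := Dm) (κ := κ) (C := C) (ε := ε)
    (r := (1 - ε) * I) (η := η) hI0 (by linarith) hκ0 hC0 (mul_pos (by linarith) hI0)
    (by linarith) hεη
  have hzeta := hζ.2.eventually (eventually_lt_nhds hν0)
  filter_upwards [eventually_mem_Ioo, tendsto_abs_log_atTop.eventually hbound, hzeta, hζ.1, hev,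
    tendsto_abs_log_atTop.eventually (eventually_ge_atTop 1)] with α hα h1 h2 h3 h4 hΛ
  have hIcc := hπ α hα
  have hIco : ∀ t z, π α t z ∈ Set.Ico (0 : ℝ) 1 := fun t z =>
    ⟨(hIcc t z).1, lt_of_le_of_lt (hπδ α hα t z) (by linarith [hδ01.1])⟩
  set Λ := |Real.log α| with hΛdef
  have hlogα : Real.log α = -Λ := by
    rw [hΛdef, abs_of_neg (Real.log_neg hα.1 hα.2), neg_neg]
  have hαΛ : α = Real.exp (-Λ) := by rw [← hlogα, Real.exp_log hα.1]
  have hαhalf : α ≤ 1 / 2 := by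
    rw [hαΛ]
    have h5 := Real.add_one_le_exp Λ
    rw [Real.exp_neg, inv_eq_one_div]
    exact one_div_le_one_div_of_le two_pos (by linarith)
  have hℓ : Real.log (bK α) = Real.log (1 - α) + Λ := by
    rw [bK, Real.log_div (by linarith) hα.1.ne', hlogα]; ring
  have hℓ1 : -1 ≤ Real.log (1 - α) := by
    rw [← Real.log_exp (-1)]
    refine Real.log_le_log (Real.exp_pos _) ?_
    have h5 := Real.add_one_le_exp 1
    rw [Real.exp_neg, inv_eq_one_div]
    have h6 : 1 / Real.exp 1 ≤ 1 / 2 := one_div_le_one_div_of_le two_pos (by linarith)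
    linarith
  have hℓ2 : Real.log (1 - α) ≤ 0 := Real.log_nonpos (by linarith [hα.2]) (by linarith [hα.1])
  have hζ1 := zeta_le_one hIcc 0
  set z := |Real.log (zeta (π α) 0)| with hz
  have hlogζ : Real.log (zeta (π α) 0) = -z := by
    rw [hz, abs_of_nonpos (Real.log_nonpos h3.le hζ1), neg_neg]
  have hexpz : Real.exp z = 1 / zeta (π α) 0 := by
    rw [← neg_neg z, ← hlogζ, Real.exp_neg, Real.exp_log h3, one_div]
  have hzν : z ≤ ν * Λ := by
    rw [div_lt_iff₀ (by linarith)] at h2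
    exact h2.le
  set D₁ := D R p 0 α with hD₁
  set DK := D R p (Fin.last k) α with hDK
  have hID₁ : I ≤ D₁ := hII₁.trans (I_le_D _ _)
  have hDKm : DK ≤ Dm := (D_le hMarkov hδ01.1 hπδ hα _).trans hDmK
  set ℓ := Real.log (bK α) with hℓdef
  have hbK0 : 0 < bK α := div_pos (by linarith [hα.2]) hα.1
  -- `D₁ < D_K` makes the denominator of `b₁` positive
  have hb0 : 0 < b1 R π p α := by
    refine div_pos ?_ (sub_pos.mpr (one_div_lt_one_div_of_lt (by linarith) h4.1))
    have h5 : 0 ≤ ℓ / DK := div_nonneg (by linarith) (by linarith)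
    have h6 : 0 < 1 / zeta (π α) 0 := by positivity
    exact add_pos_of_pos_of_nonneg h6 h5
  obtain ⟨-, hd1, hq2, hq, hmain⟩ := h1 z ℓ D₁ DK (1 / zeta (π α) 0 + ℓ / DK) (b1 R π p α)
    (dThr R π p α) (abs_nonneg _) hzν (by linarith) (by linarith) hID₁ h4.1 hDKm (by rw [hexpz])
    rfl rfl (Real.log_le_log hb0 h4.2.le)
  have hdrift₁ : ∀ j ≥ t₀, ∀ ω, X α j ω = 0 →
      D₁ - ε * I / 2 ≤ R.I 0 + System.hazard (π α) (X α) j ω := by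
    intro j hj ω h0
    have h5 := (abs_le.mp (hhaz α hα (X α) j hj ω)).1
    rw [h0] at h5
    rw [hD₁, D]
    linarith
  have hdriftK : ∀ j ≥ t₀, ∀ ω, X α j ω = Fin.last k →
      DK - ε * I / 2 ≤ R.I (Fin.last k) + System.hazard (π α) (X α) j ω := by
    intro j hj ω h0
    have h5 := (abs_le.mp (hhaz α hα (X α) j hj ω)).1
    rw [h0] at h5
    rw [hDK, D]
    linarith
  have hεI : ε * I < 1 / 2 * I := mul_lt_mul_of_pos_right hε1 hI0
  have hup := (hX α hα).expect_masteryTime_le hIco hR hδ01.1 hδ01.2.le (hπδ α hα) hc0 h3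
    (fun t ω => zeta_le_transitionProb fun t z => (hIcc t z).1) hb0 hd1
    (m₁ := D₁ - ε * I / 2) (mK := DK - ε * I / 2) (by linarith) (by linarith) (by linarith)
    hdrift₁ hdriftK hq hq2
  -- replacing the drifts by their limits
  have hstep : ∀ m M b : ℝ, 0 < M → M ≤ m - R.secondMoment / (4 * c) → m ≤ Dm →
      stepBound R δ t₀ c m b ≤ (max 0 b + C) / M := by
    intro m M b hM hMm hmD
    have h5 : m * t₀ ≤ Dm * t₀ := by gcongr
    have h6 : 0 ≤ max 0 b := le_max_left _ _
    exact div_le_div₀ (by linarith) (by rw [hC]; linarith) hM hMm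
  have hεD₁ : ε * I ≤ ε * D₁ := by gcongr
  have hεDK : ε * I ≤ ε * DK := mul_le_mul_of_nonneg_left (by linarith) hε0.le
  have hεJ : ε * I ≤ ε * R.J (Fin.last k) := by gcongr
  have hr0 : 0 < (1 - ε) * I := mul_pos (by linarith) hI0
  have s1 := hstep (D₁ - ε * I / 2) ((1 - ε) * D₁) (Real.log (b1 R π p α) + z)
    (mul_pos (by linarith) (by linarith)) (by linarith) (by linarith)
  have s2 := hstep (DK - ε * I / 2) ((1 - ε) * DK) (ℓ - Real.log (b1 R π p α))
    (mul_pos (by linarith) (by linarith)) (by linarith) (by linarith)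
  have s3 := hstep (D₁ - ε * I / 2) ((1 - ε) * I) (Real.log (b1 R π p α) + z)
    hr0 (by linarith) (by linarith)
  have s4 := hstep (R.J (Fin.last k)) ((1 - ε) * I) (Real.log (dThr R π p α))
    hr0 (by linarith) hDmJ
  have s5 := hstep (DK - ε * I / 2) ((1 - ε) * I) (ℓ - Real.log (b1 R π p α / dThr R π p α))
    hr0 (by linarith) (by linarith)
  have hq0 : 0 ≤ (1 + κ) / b1 R π p α := by positivity
  rw [hlogζ, sub_neg_eq_add, ← hexpz] at hup
  refine hup.trans ?_
  rw [mul_add (ENNReal.ofReal (1 + η)), ← ENNReal.ofReal_mul (by linarith)]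
  refine add_le_add (le_mul_of_one_le_left zero_le ?_) (ENNReal.ofReal_le_ofReal (le_trans ?_ hmain))
  · rw [← ENNReal.ofReal_one]
    exact ENNReal.ofReal_le_ofReal (by linarith)
  · gcongr

end

end

end ChangeAccel

theorem theorem2 {k : ℕ} {Y : Type*} [TopologicalSpace Y] [PolishSpace Y] [MeasurableSpace Y]
    [BorelSpace Y] {Ω : Type*} [MeasurableSpace Ω]
    (R : ChangeAccel.ResponseModel k Y) (S : ChangeAccel.System R Ω)
    (π : ℝ → ChangeAccel.Transition k) (p : Fin (k + 1) → ℝ → ℝ)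
    (hπ : ChangeAccel.IsTransitionFamily π)
    (hR : R.Regular)
    (hMarkov : ChangeAccel.AsympMarkovian π p)
    (hζ : ChangeAccel.SlowTraining π)
    (hδ : ChangeAccel.BoundedAwayFromOne π)
    (hord : ChangeAccel.Ordered R S π p) :
    (1 ≤ liminf (fun α => S.optimal (π α) α /
        (S.lamStar (π α) +
          ENNReal.ofReal (|Real.log α| / ChangeAccel.D R p (Fin.last k) α))) (𝓝[>] (0 : ℝ))) ∧
    (∀ α ∈ Set.Ioo (0 : ℝ) 1, 0 < ChangeAccel.zeta (π α) 0 →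
      ChangeAccel.D R p 0 α < ChangeAccel.D R p (Fin.last k) α →
      ∀ X : ℕ → Ω → Fin (k + 1),
        S.IsMasteryRule (π α) X
          (ChangeAccel.b1 R π p α) (ChangeAccel.bK α) (ChangeAccel.dThr R π p α) →
        S.InClass (π α) α
          (S.masteryTime (π α) X
            (ChangeAccel.b1 R π p α) (ChangeAccel.bK α) (ChangeAccel.dThr R π p α)) X) ∧
    ((∀ᶠ α in 𝓝[>] (0 : ℝ), ChangeAccel.D R p 0 α < ChangeAccel.D R p (Fin.last k) α ∧
        ChangeAccel.b1 R π p α < ChangeAccel.bK α) →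
      ∀ X : ℝ → ℕ → Ω → Fin (k + 1),
        (∀ α ∈ Set.Ioo (0 : ℝ) 1, S.IsMasteryRule (π α) (X α)
          (ChangeAccel.b1 R π p α) (ChangeAccel.bK α) (ChangeAccel.dThr R π p α)) →
        limsup (fun α => ChangeAccel.expect S.P (S.masteryTime (π α) (X α)
            (ChangeAccel.b1 R π p α) (ChangeAccel.bK α) (ChangeAccel.dThr R π p α)) /
          (S.lam (π α) 0 +
            ENNReal.ofReal (|Real.log α| / ChangeAccel.D R p (Fin.last k) α))) (𝓝[>] (0 : ℝ))
          ≤ 1) := by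
  have hIco : ∀ α ∈ Set.Ioo (0 : ℝ) 1, ∀ t z, π α t z ∈ Set.Ico (0 : ℝ) 1 := by
    obtain ⟨δ, hδ01, hδmax⟩ := hδ
    intro α hα t z
    have h1 := (ChangeAccel.le_maxTransition (π α) t z).trans (hδmax α hα t)
    exact ⟨(hπ α hα t z).1, by linarith [hδ01.1]⟩
  have hbK : ∀ α ∈ Set.Ioo (0 : ℝ) 1, 0 ≤ ChangeAccel.bK α ∧ 1 / (1 + ChangeAccel.bK α) = α := by
    intro α hα
    refine ⟨div_nonneg (by linarith [hα.2]) hα.1.le, ?_⟩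
    have h1 := hα.1.ne'
    rw [ChangeAccel.bK]
    field_simp
    ring
  refine ⟨?_, ?_, ?_⟩
  · refine ChangeAccel.le_liminf_of_forall_lt_one fun η hη hη1 => ?_
    filter_upwards [ChangeAccel.eventually_le_optimal hπ hR hMarkov hζ hδ hord hη hη1, hζ.1,
      ChangeAccel.eventually_mem_Ioo] with α h1 h2 hα
    refine (ENNReal.le_div_iff_mul_le (Or.inl ?_) (Or.inl ?_)).mpr h1
    · refine (lt_of_lt_of_le (ENNReal.ofReal_pos.mpr (div_pos ?_ ?_)) le_add_self).ne'
      · exact abs_pos.mpr (Real.log_neg hα.1 hα.2).ne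
      · exact (hR.I_pos _).trans_le (ChangeAccel.I_le_D _ _)
    · exact ENNReal.add_ne_top.mpr
        ⟨(ChangeAccel.lamStar_lt_top (hπ α hα) h2).ne, ENNReal.ofReal_ne_top⟩
  · intro α hα h1 _ X hX
    exact hX.inClass (hIco α hα) hR h1 (hbK α hα).1 (hbK α hα).2.le
  · intro hev X hX
    refine ChangeAccel.limsup_le_of_forall_pos fun η hη => ?_
    filter_upwards [ChangeAccel.eventually_expect_le (S := S) hπ hR hMarkov hζ hδ hev hX hη]
      with α h1
    exact ENNReal.div_le_of_le_mul h1
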